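/- Let $S^2\subset\mathbb R^3$ be the unit sphere with round metric $\gamma$, covariant derivative $D_A$ and antipodal map $x\mapsto -x$. Let $\mathcal H=(-1,1)\times S^2$, with points $(s,x)$, be the unit hyperboloid with metric $$h=-\frac{ds^2}{(1-s^2)^2}+\frac{\gamma}{1-s^2}$$ and covariant derivative $\mathcal D_a$. An \emph{even solution} is a smooth $\bar\lambda:\mathcal H\to\mathbb R$ with $\mathcal D_a\mathcal D^a\bar\lambda=0$ and $\bar\lambda(-s,-x)=\bar\lambda(s,x)$. Let $P_l$ be the Legendre polynomials, $Q_l=\frac12P_l\log\frac{1+s}{1-s}-\sum_{k=1}^l\frac1kP_{k-1}P_{l-k}$ the Legendre functions of the second kind, $\alpha_l=(1-s^2)\partial_sQ_l$, and $Y_{l,m}$ ($-l\le m\le l$) the orthonormal real spherical harmonics. Harmonic coefficients below are always rapidly decreasing in $l$; a function $f$ on $S^2$ is smooth if and only if it has a unique expansion $f=\sum f_{l,m}Y_{l,m}$ with such coefficients. Then the following hold. 1. For smooth $\bar\lambda$, $\mathcal D_a\mathcal D^a\bar\lambda=-(1-s^2)^2\partial_s^2\bar\lambda+(1-s^2)D_AD^A\bar\lambda$.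 2. $P_l(\pm1)=(\pm1)^l=\lim_{s\to\pm1}\alpha_l(s)$ and $\lim_{s\to\pm1}(1-s^2)\partial_s\alpha_l=0$. Moreover $\alpha_0=1$, $\alpha_1=s+\frac{1-s^2}2\log\frac{1+s}{1-s}$, $\alpha_2=3s^2-2+\frac{3s(1-s^2)}2\log\frac{1+s}{1-s}$, and $\alpha_{2k}(0)\ne0$, $\partial_s\alpha_{2k+1}(0)\ne0$ for all $k\ge 0$. 3. A function $\bar\lambda$ on $\mathcal H$ is an even solution if and only if it has a unique expansion $\bar\lambda=\sum_{l,m}\bar\lambda_{l,m}\,\alpha_l(s)\,Y_{l,m}(x)$. 4. For an even solution, $\epsilon^{\mathcal J}=\sum\bar\lambda_{l,m}Y_{l,m}$ is smooth and $\lim_{s\to\pm1}\bar\lambda(s,x)=\epsilon^{\mathcal J}(\pm x)$. If $\lambda(\eta,s,x)$ satisfies $|\lambda-\bar\lambda|\le C/\rho$ for $\rho=\eta\sqrt{1-s^2}\ge\rho_0>0$, uniformly in $(s,x)$, then at fixed $\rho\ge\rho_0$ any limit of $\lambda$ as $s\to\pm1$ differs from $\epsilon^{\mathcal J}(\pm x)$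 by at most $C/\rho$. The map $\bar\lambda\mapsto\epsilon^{\mathcal J}$ is a bijection from even solutions onto $C^\infty(S^2)$. 5. The Cauchy data $\bar\epsilon=\bar\lambda|_{s=0}$ and $\bar\mu=\partial_s\bar\lambda|_{s=0}$ of an even solution are smooth, with $\bar\epsilon$ even and $\bar\mu$ odd. They are related to $\bar\lambda_{l,m}$ by $\bar\lambda_{2k,m}\alpha_{2k}(0)=\bar\epsilon_{2k,m}$ and $\bar\lambda_{2k+1,m}\,\partial_s\alpha_{2k+1}(0)=\bar\mu_{2k+1,m}$; in particular $\bar\lambda_{0,0}=\bar\epsilon_{0,0}$, $\bar\lambda_{1,m}=\frac12\bar\mu_{1,m}$ and $\bar\lambda_{2,m}=-\frac12\bar\epsilon_{2,m}$. Every pair of smooth functions ($\bar\epsilon$ even, $\bar\mu$ odd) comes from exactly one even solution. 6. For $M=\begin{pmatrix}A&c\\ c^{T}&0\end{pmatrix}\in\mathfrak{so}(3,1)$ put $b(x)=-c\cdot x$ and $Y(x)=Ax$. Let $\delta_M\bar\lambda$ be the Lie derivative of $\bar\lambda$ along the vector field $\mathcal Y^s=-(1-s^2)b$, $\mathcal Y^A=Y^A-sD^Ab$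 on $\mathcal H$. This field is the one induced by the linear vector field $p\mapsto Mp$ on the spacelike points $(t,y)=(rs,rx)$, $r>0$, of Minkowski space. Then $\delta_M$ maps even solutions to even solutions. On the two parametrizations it acts by $$\delta_M\epsilon^{\mathcal J}=(Y^A-D^Ab)\,\partial_A\epsilon^{\mathcal J},$$ $$\delta_M\bar\epsilon=Y^A\partial_A\bar\epsilon-b\bar\mu,\qquad \delta_M\bar\mu=Y^A\partial_A\bar\mu-D_A(b\,D^A\bar\epsilon),$$ and $\lim_{s\to\pm1}\delta_M\bar\lambda(s,x)=(\delta_M\epsilon^{\mathcal J})(\pm x)$. 7. $M\mapsto-\delta_M$ is a representation of $\mathfrak{so}(3,1)$ on $V_H=\{(\bar\epsilon,\bar\mu)\in C^\infty(S^2)^2:\ \bar\epsilon\text{ even},\ \bar\mu\text{ odd}\}$ and on $V_{\mathcal J}=C^\infty(S^2)$. The map $\Phi:V_H\to V_{\mathcal J}$ sending the Cauchy data of an even solution to its parameter $\epsilon^{\mathcal J}$ is an $\mathfrak{so}(3,1)$-equivariant linear isomorphism. Hence $(v,M)\mapsto(\Phi v,M)$ is an isomorphism of the semidirect sums of the abelian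 Lie algebras $V_H$ and $V_{\mathcal J}$ with $\mathfrak{so}(3,1)$. 8. The pairs (limit at $s\to1$, limit at $s\to-1$) of even solutions are exactly the pairs $(f^+,f^-)\in C^\infty(S^2)^2$ with $f^-(x)=f^+(-x)$, that is, the (antipodally matched) diagonal subgroup. -/

import Mathlib

open Set Filter Topology
open scoped Manifold ContDiff

noncomputable section

namespace LargeU1

/-! ### The round two-sphere and its calculus -/

/-- Euclidean three-space. -/
abbrev E3 : Type := EuclideanSpace ℝ (Fin 3)

/-- The unit two-sphere; the antipodal map is `x ↦ -x`. -/
abbrev S2 : Type := Metric.sphere (0 : E3) 1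

/-- Smooth real functions on the sphere. -/
def SmoothS2 (f : S2 → ℝ) : Prop := ContMDiff (𝓡 2) 𝓘(ℝ, ℝ) ∞ f

/-- The extension of a function on the sphere to `E3 ∖ {0}`, constant along rays
(with value `0` at the origin). -/
def radialExt {F : Type*} [Zero F] (f : S2 → F) (y : E3) : F :=
  if h : y = 0 then 0
  else f ⟨‖y‖⁻¹ • y, by
    have hy : ‖y‖ ≠ 0 := norm_ne_zero_iff.mpr h
    simp [norm_smul, inv_mul_cancel₀ hy]⟩

/-- The gradient `D^A f` for the round metric, as a vector of `E3` tangent to the sphere. -/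
def sphereGrad (f : S2 → ℝ) (x : S2) : E3 := gradient (radialExt f) (x : E3)

/-- The divergence `D_A V^A` of a tangential vector field `V` for the round metric. -/
def sphereDiv (V : S2 → E3) (x : S2) : ℝ :=
  LinearMap.trace ℝ E3 (fderiv ℝ (radialExt V) (x : E3)).toLinearMap

/-- The Laplacian `D_A D^A f` for the round metric. -/
def sphereLaplacian (f : S2 → ℝ) (x : S2) : ℝ := sphereDiv (sphereGrad f) x

/-- The derivative `V^A ∂_A f` of `f` along a tangential vector field `V`. -/
def along (V : S2 → E3) (f : S2 → ℝ) (x : S2) : ℝ := inner ℝ (V x) (sphereGrad f x)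

/-! ### The unit hyperboloid

Its points are `(s, x)` with `-1 < s < 1` and `x` on the sphere, and its metric is
`h = h_ss ds² + h_γ γ` with `γ` the round metric. Functions on it are written as functions
`ℝ → S2 → ℝ` that are only looked at for `-1 < s < 1`. -/

/-- The coefficient `h_ss` of the metric. -/
def hss (s : ℝ) : ℝ := -1 / (1 - s ^ 2) ^ 2

/-- The factor `h_γ` of the metric in front of the round metric. -/
def hsph (s : ℝ) : ℝ := 1 / (1 - s ^ 2)

/-- The volume density `√|det h|` relative to the volume density of `ds² + γ`. -/
def hvol (s : ℝ) : ℝ := Real.sqrt |hss s * hsph s ^ 2|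

/-- Smooth functions on the hyperboloid. -/
def SmoothHyp (lam : ℝ → S2 → ℝ) : Prop :=
  ContMDiffOn (𝓘(ℝ, ℝ).prod (𝓡 2)) 𝓘(ℝ, ℝ) ∞ (Function.uncurry lam)
    (Ioo (-1 : ℝ) 1 ×ˢ (univ : Set S2))

/-- The wave operator `D_a D^a = |h|^{-1/2} ∂_a (|h|^{1/2} h^{ab} ∂_b)` of the metric `h`. -/
def hypBox (lam : ℝ → S2 → ℝ) (s : ℝ) (x : S2) : ℝ :=
  (hvol s)⁻¹ * deriv (fun σ => hvol σ * (hss σ)⁻¹ * deriv (fun τ => lam τ x) σ) s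
    + (hsph s)⁻¹ * sphereLaplacian (lam s) x

/-- Smooth solutions of `D_a D^a lam = 0` that are even, i.e. invariant under the antipodal
map `(s, x) ↦ (-s, -x)` of the hyperboloid. -/
structure IsEvenSolution (lam : ℝ → S2 → ℝ) : Prop where
  smooth : SmoothHyp lam
  wave : ∀ s ∈ Ioo (-1 : ℝ) 1, ∀ x, hypBox lam s x = 0
  even : ∀ s ∈ Ioo (-1 : ℝ) 1, ∀ x, lam (-s) (-x) = lam s x

/-- `f` is the limit of `lam` as `s → 1`. -/
def FutureLimit (lam : ℝ → S2 → ℝ) (f : S2 → ℝ) : Prop :=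
  ∀ x, Tendsto (fun s => lam s x) (𝓝[<] 1) (𝓝 (f x))

/-- `f` is the limit of `lam` as `s → -1`. -/
def PastLimit (lam : ℝ → S2 → ℝ) (f : S2 → ℝ) : Prop :=
  ∀ x, Tendsto (fun s => lam s x) (𝓝[>] (-1)) (𝓝 (f x))

/-- `p = (ε, μ)` is the pair of the values of `lam` and of `∂_s lam` at `s = 0`. -/
def CauchyData (lam : ℝ → S2 → ℝ) (p : (S2 → ℝ) × (S2 → ℝ)) : Prop :=
  ∀ x, lam 0 x = p.1 x ∧ deriv (fun s => lam s x) 0 = p.2 x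

/-! ### Legendre functions and spherical harmonics -/

/-- The Legendre polynomial `P_l`, by Rodrigues' formula. -/
def legendreP (l : ℕ) : Polynomial ℝ :=
  Polynomial.C (1 / ((2 : ℝ) ^ l * (l.factorial : ℝ))) *
    (Polynomial.derivative^[l] ((Polynomial.X ^ 2 - 1) ^ l))

/-- The Legendre function of the second kind on `(-1, 1)`,
`Q_l = P_l · ½ log((1+s)/(1-s)) - ∑_{k=1}^{l} (1/k) P_{k-1} P_{l-k}`. -/
def legendreQ (l : ℕ) (s : ℝ) : ℝ :=
  (legendreP l).eval s * (1 / 2 * Real.log ((1 + s) / (1 - s)))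
    - ∑ k ∈ Finset.range l,
        1 / ((k : ℝ) + 1) * (legendreP k).eval s * (legendreP (l - 1 - k)).eval s

/-- `α_l = (1 - s²) ∂_s Q_l`. -/
def alpha (l : ℕ) (s : ℝ) : ℝ := (1 - s ^ 2) * deriv (legendreQ l) s

/-- The pairs `(l, m)` with `-l ≤ m ≤ l`. -/
abbrev HarmonicIndex : Type := Σ l : ℕ, {m : ℤ // |m| ≤ (l : ℤ)}

/-- The azimuthal factor: `1`, `√2 Re (x₁ + i x₂)^m`, `√2 Im (x₁ + i x₂)^|m|` for
`m = 0`, `m > 0`, `m < 0`. -/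
def azimuthal (m : ℤ) (x : E3) : ℝ :=
  if m = 0 then 1
  else if 0 < m then Real.sqrt 2 * (((x 0 : ℂ) + (x 1 : ℂ) * Complex.I) ^ m.natAbs).re
  else Real.sqrt 2 * (((x 0 : ℂ) + (x 1 : ℂ) * Complex.I) ^ m.natAbs).im

/-- The real spherical harmonics `Y_{l,m}`, orthonormal in `L²` of the sphere. On the sphere the
`k`-th derivative of `P_l` at `x₃ = cos θ`, times `sin^k θ`, is the associated Legendre function. -/
def realY (i : HarmonicIndex) (x : S2) : ℝ :=
  Real.sqrt ((2 * (i.1 : ℝ) + 1) / (4 * Real.pi)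
      * (((i.1 - i.2.1.natAbs).factorial : ℝ) / ((i.1 + i.2.1.natAbs).factorial : ℝ)))
    * (Polynomial.derivative^[i.2.1.natAbs] (legendreP i.1)).eval ((x : E3) 2)
    * azimuthal i.2.1 (x : E3)

/-- Coefficients that decrease faster than every power of `l`. -/
def RapidlyDecreasing (c : HarmonicIndex → ℝ) : Prop :=
  ∀ k : ℕ, ∃ C : ℝ, ∀ i, ((i.1 : ℝ) + 1) ^ k * |c i| ≤ C

/-- `f = ∑_{l,m} c_{l,m} Y_{l,m}` with rapidly decreasing coefficients. -/
def HasHarmonicExpansion (f : S2 → ℝ) (c : HarmonicIndex → ℝ) : Prop :=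
  RapidlyDecreasing c ∧ ∀ x, HasSum (fun i => c i * realY i x) (f x)

/-- `lam = ∑_{l,m} c_{l,m} α_l(s) Y_{l,m}` with rapidly decreasing coefficients. -/
def HasModeExpansion (lam : ℝ → S2 → ℝ) (c : HarmonicIndex → ℝ) : Prop :=
  RapidlyDecreasing c ∧
    ∀ s ∈ Ioo (-1 : ℝ) 1, ∀ x, HasSum (fun i => c i * alpha i.1 s * realY i x) (lam s x)

/-! ### The Lorentz algebra -/

/-- The Lorentz algebra: real matrices that are skew for `diag(1, 1, 1, -1)`. The index
`Sum.inr 0` is the time direction. -/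
abbrev so31 : Type := LieAlgebra.Orthogonal.so' (Fin 3) (Fin 1) ℝ

/-- The linear vector field `p ↦ M p` on Minkowski space, with points `p = (t, y)`. -/
def linearField (M : so31) (p : ℝ × E3) : ℝ × E3 :=
  (M.1 (Sum.inr 0) (Sum.inr 0) * p.1 + ∑ j, M.1 (Sum.inr 0) (Sum.inl j) * p.2 j,
    WithLp.toLp 2 (fun i =>
      M.1 (Sum.inl i) (Sum.inr 0) * p.1 + ∑ j, M.1 (Sum.inl i) (Sum.inl j) * p.2 j))

/-- The boost parameter `b = b_i x^i` of a Lorentz generator. -/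
def boostPart (M : so31) (x : S2) : ℝ :=
  -∑ i, M.1 (Sum.inl i) (Sum.inr 0) * (x : E3) i

/-- The rotation parameter `Y^A` of a Lorentz generator: the Killing field `x ↦ A x` of the
sphere with `A` the skew spatial block. -/
def rotPart (M : so31) (x : S2) : E3 :=
  WithLp.toLp 2 (fun i => ∑ j, M.1 (Sum.inl i) (Sum.inl j) * (x : E3) j)

/-- The Lie derivative of `lam` along the vector field on the hyperboloid with components
`-(1 - s²) b` along `∂_s` and `Y^A - s D^A b` along the sphere. -/
def hypLie (b : S2 → ℝ) (Y : S2 → E3) (lam : ℝ → S2 → ℝ) (s : ℝ) (x : S2) : ℝ :=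
  -(1 - s ^ 2) * b x * deriv (fun σ => lam σ x) s
    + along (fun z => Y z - s • sphereGrad b z) (lam s) x

/-- The Lorentz action at null infinity, `(Y^A - D^A b) ∂_A f`. -/
def deltaScri (b : S2 → ℝ) (Y : S2 → E3) (f : S2 → ℝ) (x : S2) : ℝ :=
  along (fun z => Y z - sphereGrad b z) f x

/-- The Hamiltonian Lorentz action at spatial infinity,
`(ε, μ) ↦ (Y^A ∂_A ε - b μ, Y^A ∂_A μ - D_A (b D^A ε))`. -/
def deltaHam (b : S2 → ℝ) (Y : S2 → E3) (p : (S2 → ℝ) × (S2 → ℝ)) : (S2 → ℝ) × (S2 → ℝ) :=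
  (fun x => along Y p.1 x - b x * p.2 x,
    fun x => along Y p.2 x - sphereDiv (fun z => b z • sphereGrad p.1 z) x)

/-! ### The spaces of gauge parameters -/

theorem smoothS2_const_smul (c : ℝ) {f : S2 → ℝ} (hf : SmoothS2 f) : SmoothS2 (c • f) :=
  ContMDiff.mul (contMDiff_const (c := c)) hf

/-- The null-infinity parameters: all smooth functions on the sphere. -/
def scriParams : Submodule ℝ (S2 → ℝ) where
  carrier := {f | SmoothS2 f}
  zero_mem' := contMDiff_const
  add_mem' hf hg := ContMDiff.add hf hg
  smul_mem' c _ hf := smoothS2_const_smul c hf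

/-- The Hamiltonian parameters: pairs `(ε, μ)` of smooth functions on the sphere, with `ε` even
and `μ` odd under the antipodal map. -/
def hamParams : Submodule ℝ ((S2 → ℝ) × (S2 → ℝ)) where
  carrier := {p | SmoothS2 p.1 ∧ SmoothS2 p.2 ∧
    (∀ x, p.1 (-x) = p.1 x) ∧ ∀ x, p.2 (-x) = -p.2 x}
  zero_mem' := ⟨contMDiff_const, contMDiff_const, by simp, by simp⟩
  add_mem' hp hq := ⟨ContMDiff.add hp.1 hq.1, ContMDiff.add hp.2.1 hq.2.1,
    fun x => by simp [hp.2.2.1 x, hq.2.2.1 x],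
    fun x => by simp only [Prod.snd_add, Pi.add_apply, hp.2.2.2 x, hq.2.2.2 x]; ring⟩
  smul_mem' c _ hp := ⟨smoothS2_const_smul c hp.1, smoothS2_const_smul c hp.2.1,
    fun x => by simp [hp.2.2.1 x], fun x => by simp [hp.2.2.2 x]⟩

/-- The pairs (parameter at future null infinity, parameter at past null infinity) that are
antipodally matched. -/
def antipodalDiagonal : AddSubgroup (scriParams × scriParams) where
  carrier := {q | ∀ x, q.2.1 x = q.1.1 (-x)}
  zero_mem' := fun _ => rfl
  add_mem' hp hq := fun x => congrArg₂ (· + ·) (hp x) (hq x)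
  neg_mem' hp := fun x => congrArg (fun r : ℝ => -r) (hp x)

/-- The gauge transformations commute: the bracket of two parameters is zero. -/
instance : LieRing scriParams where
  bracket _ _ := 0
  add_lie _ _ _ := (add_zero _).symm
  lie_add _ _ _ := (add_zero _).symm
  lie_self _ := rfl
  leibniz_lie _ _ _ := (add_zero _).symm

instance : LieAlgebra ℝ scriParams where
  lie_smul t _ _ := (smul_zero t).symm

/-- The gauge transformations commute: the bracket of two parameters is zero. -/
instance : LieRing hamParams where
  bracket _ _ := 0
  add_lie _ _ _ := (add_zero _).symm
  lie_add _ _ _ := (add_zero _).symm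
  lie_self _ := rfl
  leibniz_lie _ _ _ := (add_zero _).symm

instance : LieAlgebra ℝ hamParams where
  lie_smul t _ _ := (smul_zero t).symm

end LargeU1

end

noncomputable section

namespace LargeU1

/-! The proof is separation of variables. Since √|h| h^{ss} = -1, the wave equation reads (1 - s²)
∂_s² λ = Δλ, and on a harmonic of degree l it becomes (1 - s²) f'' = -l(l+1) f. The function α_l =
(1 - s²) Q_l' solves this because α_l' = -l(l+1) Q_l (`hasDerivAt_alpha`). Both α_l and Y_{l,m} have
parity (-1)^l, so their product is even. Conversely, the projection of an even solution on Y_{l,m}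
has parity (-1)^l in s; this leaves one free datum at s = 0, which a multiple of α_l matches
(`IsEvenSolution.harmCoeff_eq`).

Convergence rests on one monotone quantity: l(l+1) f² + (1 - s²) f'² decreases on [0, 1)
(`energy_le`). It bounds α_l by l + 1 and √(1 - s²) α_l' by (l + 1)² up to the ends, while α_{2k}(0)
and α_{2k+1}'(0) have absolute value at least 1. Hence the passage from Cauchy data to mode
coefficients preserves rapid decrease, and limits s → 1 may be taken term by term. As α_l → 1 there,
the limit function has the same coefficients as the mode expansion, and evenness gives the other
end. So the Cauchy data and the limit each parametrize the even solutions, without constraint.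

The harmonic analysis starts from the rotational derivatives L_j along e_j × x, whose squares sum to
the Laplacian (`sphereLaplacian_eq`). The ladder relations give the eigenvalues, polynomial bounds
on all derivatives and, with integration by parts, orthogonality and norms; Stone-Weierstrass gives
completeness (`eq_zero_of_integral_mul_realY`). Powers of 1 - Δ show that smooth functions have
rapidly decreasing coefficients. Conversely, mode sums are smooth because their derivatives are
again built from mode sums (`RadialPair.contDiffOn`).

Rotations commute with the wave equation. Boosts preserve its solutions by the commutators of Δ with
multiplication by x_i and with differentiation along the gradient of x_i (`lap_coordS_mul`,
`lap_gradD`, `IsEvenSolution.boostD`). As s → 1 the ∂_s part of a boost dies with its factor 1 - s²,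
leaving the conformal field Y - Db; at s = 0 the wave equation eliminates ∂_s² λ. One solution δ_M λ
realises both actions, so Φ is equivariant without comparing formulas (`Matched.neg_delta`). The
bracket relations are checked only for vector fields on the sphere (`deltaScri_lie`) and transported
to the Cauchy data by Φ. -/

open Polynomial in
/-- The polynomial `(X² - 1)^l / (2^l l!)` whose `l`-th derivative is `P_l`. -/
def rodriguesPoly (l : ℕ) : Polynomial ℝ :=
  C (1 / ((2 : ℝ) ^ l * (l.factorial : ℝ))) * (X ^ 2 - 1) ^ l

/-! ### Legendre polynomials: recursions, differential equation, parity, leading coefficient. -/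

section Legendre
open Polynomial

theorem legendreP_eq (l : ℕ) : legendreP l = derivative^[l] (rodriguesPoly l) := by
  rw [legendreP, rodriguesPoly, iterate_derivative_C_mul]

theorem derivative_rodriguesPoly_succ (l : ℕ) :
    derivative (rodriguesPoly (l + 1)) = X * rodriguesPoly l := by
  have h : (1 / ((2 : ℝ) ^ (l + 1) * ((l + 1).factorial : ℝ))) * ((l + 1 : ℕ) * 2)
      = 1 / ((2 : ℝ) ^ l * (l.factorial : ℝ)) := by
    have := Nat.cast_ne_zero (R := ℝ).2 (Nat.factorial_ne_zero l)
    rw [Nat.factorial_succ, pow_succ]; push_cast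
    field_simp
  rw [rodriguesPoly, rodriguesPoly, derivative_C_mul, derivative_pow_succ, ← h]
  simp only [derivative_sub, derivative_X_pow, derivative_one, map_mul, C_eq_natCast]
  simp
  rw [show (C (2:ℝ)) = 2 from rfl]
  ring

theorem iterate_derivative_X_mul' (n : ℕ) (p : ℝ[X]) :
    derivative^[n + 1] (X * p) = X * derivative^[n + 1] p + ((n : ℝ[X]) + 1) * derivative^[n] p := by
  induction n with
  | zero => simp [derivative_mul]; ring
  | succ n ih =>
    rw [Function.iterate_succ_apply', ih]
    simp only [derivative_add, derivative_mul, derivative_X, Function.iterate_succ_apply',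
      derivative_natCast, derivative_one]
    push_cast
    ring

/-- `P_{l+1}' = X P_l' + (l+1) P_l`. -/
theorem derivative_legendreP_succ (l : ℕ) :
    derivative (legendreP (l + 1)) = X * derivative (legendreP l) + ((l : ℝ[X]) + 1) * legendreP l := by
  have : derivative (legendreP (l + 1)) = derivative^[l + 1] (X * rodriguesPoly l) := by
    rw [legendreP_eq, ← derivative_rodriguesPoly_succ, ← Function.iterate_succ_apply' derivative,
      ← Function.iterate_succ_apply]
  rw [this, iterate_derivative_X_mul', legendreP_eq, Function.iterate_succ_apply']

/-- A power of X² - 1 satisfies a first-order equation; its l-th derivative is the source of the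
recursions for P_l. -/
theorem X_sq_sub_one_mul_derivative_rodriguesPoly (l : ℕ) :
    (X ^ 2 - 1) * derivative (rodriguesPoly l) = 2 * (l : ℝ[X]) * (X * rodriguesPoly l) := by
  cases l with
  | zero => simp [rodriguesPoly]
  | succ l =>
    rw [rodriguesPoly, derivative_C_mul, derivative_pow_succ]
    simp
    ring

theorem iterate_derivative_X_sq_sub_one_mul (n : ℕ) (p : ℝ[X]) :
    derivative^[n + 1] ((X ^ 2 - 1) * derivative p) = (X ^ 2 - 1) * derivative^[n + 2] p
      + 2 * ((n : ℝ[X]) + 1) * X * derivative^[n + 1] p + ((n : ℝ[X]) + 1) * (n : ℝ[X]) * derivative^[n] p := by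
  induction n with
  | zero => simp [derivative_mul]; ring
  | succ n ih =>
    rw [Function.iterate_succ_apply', ih]
    simp only [derivative_add, derivative_mul, derivative_X, Function.iterate_succ_apply',
      derivative_natCast, derivative_one, derivative_sub, derivative_X_pow, derivative_ofNat]
    simp
    rw [show (C (2:ℝ)) = 2 from rfl]
    ring

/-- `(X² - 1) P_l' = (l+1) (P_{l+1} - X P_l)`. -/
theorem X_sq_sub_one_mul_derivative_legendreP (l : ℕ) :
    (X ^ 2 - 1) * derivative (legendreP l)
      = ((l : ℝ[X]) + 1) * (legendreP (l + 1) - X * legendreP l) := by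
  have h1 : legendreP (l + 1) = derivative^[l] (X * rodriguesPoly l) := by
    rw [legendreP_eq, ← derivative_rodriguesPoly_succ, ← Function.iterate_succ_apply]
  cases l with
  | zero => rw [h1]; simp [legendreP, rodriguesPoly]
  | succ n =>
    -- The first-order equation is differentiated l = n + 1 times. Leibniz stops after three terms
    -- because X² - 1 is quadratic.
    have h2 := congrArg (derivative^[n + 1]) (X_sq_sub_one_mul_derivative_rodriguesPoly (n + 1))
    rw [iterate_derivative_X_sq_sub_one_mul,
      show (2 * ((n + 1 : ℕ) : ℝ[X]) * (X * rodriguesPoly (n + 1)))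
        = C (2 * ((n + 1 : ℕ) : ℝ)) * (X * rodriguesPoly (n + 1)) by
          simp [map_mul]; left; left; rfl,
      iterate_derivative_C_mul, iterate_derivative_X_mul'] at h2
    rw [h1, iterate_derivative_X_mul', legendreP_eq, ← Function.iterate_succ_apply' derivative]
    have h3 : (C (2 * ((n + 1 : ℕ) : ℝ))) = 2 * ((n : ℝ[X]) + 1) := by
      simp [map_mul]; left; rfl
    rw [h3] at h2
    push_cast
    linear_combination h2

theorem legendreP_zero : legendreP 0 = 1 := by simp [legendreP]

theorem legendreP_one : legendreP 1 = X := by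
  have := X_sq_sub_one_mul_derivative_legendreP 0
  rw [legendreP_zero] at this
  simp at this
  linear_combination -this

/-- Bonnet's recursion. -/
theorem legendreP_bonnet (l : ℕ) :
    ((l : ℝ[X]) + 2) * legendreP (l + 2)
      = (2 * (l : ℝ[X]) + 3) * X * legendreP (l + 1) - ((l : ℝ[X]) + 1) * legendreP l := by
  have h1 := X_sq_sub_one_mul_derivative_legendreP (l + 1)
  have h2 := X_sq_sub_one_mul_derivative_legendreP l
  have h3 := derivative_legendreP_succ l
  push_cast at h1
  linear_combination -h1 + (X ^ 2 - 1) * h3 + X * h2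

theorem legendreP_bonnet_eval (l : ℕ) (s : ℝ) :
    ((l : ℝ) + 2) * (legendreP (l + 2)).eval s
      = (2 * (l : ℝ) + 3) * s * (legendreP (l + 1)).eval s - ((l : ℝ) + 1) * (legendreP l).eval s := by
  have := congrArg (eval s) (legendreP_bonnet l)
  simpa using this

theorem legendreP_eval_one (l : ℕ) : (legendreP l).eval 1 = 1 := by
  induction l with
  | zero => simp [legendreP]
  | succ l ih =>
    have := congrArg (eval 1) (X_sq_sub_one_mul_derivative_legendreP l)
    simp [ih] at this
    have h : (l : ℝ) + 1 ≠ 0 := by positivity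
    rcases this with h' | h'
    · exact absurd h' h
    · linarith

theorem legendreP_eval_neg_one (l : ℕ) : (legendreP l).eval (-1) = (-1) ^ l := by
  induction l with
  | zero => simp [legendreP]
  | succ l ih =>
    have := congrArg (eval (-1)) (X_sq_sub_one_mul_derivative_legendreP l)
    simp [ih] at this
    have h : (l : ℝ) + 1 ≠ 0 := by positivity
    rcases this with h' | h'
    · exact absurd h' h
    · rw [pow_succ]; linarith

theorem legendreP_eval_neg (l : ℕ) (s : ℝ) :
    (legendreP l).eval (-s) = (-1) ^ l * (legendreP l).eval s := by
  induction l using Nat.twoStepInduction with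
  | zero => simp [legendreP]
  | one => simp [legendreP_one]
  | more n h1 h2 =>
    have e1 := legendreP_bonnet_eval n s
    have e2 := legendreP_bonnet_eval n (-s)
    rw [h1, h2] at e2
    have h : (n : ℝ) + 2 ≠ 0 := by positivity
    apply mul_left_cancel₀ h
    rw [e2]
    linear_combination -(-1 : ℝ) ^ (n + 2) * e1

/-- The Legendre equation. -/
theorem legendreP_ode (l : ℕ) :
    (1 - X ^ 2) * derivative (derivative (legendreP l)) - 2 * X * derivative (legendreP l)
      + (l : ℝ[X]) * ((l : ℝ[X]) + 1) * legendreP l = 0 := by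
  have h1 := congrArg derivative (X_sq_sub_one_mul_derivative_legendreP l)
  have h2 := derivative_legendreP_succ l
  simp only [derivative_add, derivative_mul, derivative_X, derivative_natCast, derivative_one,
    derivative_sub, derivative_X_pow] at h1
  have h3 : (C (2:ℝ)) = 2 := rfl
  simp [h3] at h1
  linear_combination -h1 - ((l : ℝ[X]) + 1) * h2

/-- Comparison of coefficients in P_{l+1}' = X P_l' + (l+1) P_l. Positivity of the leading
coefficient is what makes the P_l and their derivatives triangular with respect to the monomials in
the completeness argument. -/
theorem natDegree_legendreP_le_and_coeff_pos (l : ℕ) :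
    (legendreP l).natDegree ≤ l ∧ 0 < (legendreP l).coeff l := by
  induction l with
  | zero => simp [legendreP_zero]
  | succ l ih =>
    obtain ⟨h1, h2⟩ := ih
    have hd := derivative_legendreP_succ l
    have hnd : (legendreP (l + 1)).natDegree ≤ l + 1 := by
      have : (derivative (legendreP (l + 1))).natDegree ≤ l := by
        rw [hd]
        refine (natDegree_add_le _ _).trans (max_le ?_ ?_)
        · rcases Nat.eq_zero_or_pos l with rfl | hl
          · simp [legendreP_zero]
          · refine natDegree_mul_le.trans ?_
            have := natDegree_derivative_le (legendreP l)
            rw [natDegree_X]; omega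
        · refine natDegree_mul_le.trans ?_
          have : ((l : ℝ[X]) + 1).natDegree = 0 := by
            rw [show ((l : ℝ[X]) + 1) = ((l + 1 : ℕ) : ℝ[X]) by push_cast; rfl]
            exact natDegree_natCast _
          omega
      rw [natDegree_le_iff_coeff_eq_zero] at this ⊢
      intro N hN
      obtain ⟨M, rfl⟩ : ∃ M, N = M + 1 := ⟨N - 1, by omega⟩
      have h := this M (by omega)
      rw [coeff_derivative] at h
      have : (M : ℝ) + 1 ≠ 0 := by positivity
      simpa [this] using h
    refine ⟨hnd, ?_⟩
    have hc := congrArg (fun p => coeff p l) hd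
    simp only [coeff_derivative, coeff_add] at hc
    have e1 : (X * derivative (legendreP l)).coeff l = l * (legendreP l).coeff l := by
      cases l with
      | zero => simp
      | succ n => rw [coeff_X_mul, coeff_derivative]; push_cast; ring
    have e2 : (((l : ℝ[X]) + 1) * legendreP l).coeff l = (l + 1) * (legendreP l).coeff l := by
      rw [show ((l : ℝ[X]) + 1) = C ((l : ℝ) + 1) by simp, coeff_C_mul]
    rw [e1, e2] at hc
    have : 0 < (legendreP (l + 1)).coeff (l + 1) * ((l : ℝ) + 1) := by rw [hc]; positivity
    exact pos_of_mul_pos_left this (by positivity)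

/-- The `k`-times differentiated Legendre equation. -/
theorem legendreP_iterate_ode (l k : ℕ) :
    (1 - X ^ 2) * derivative^[k + 2] (legendreP l)
      - 2 * ((k : ℝ[X]) + 1) * X * derivative^[k + 1] (legendreP l)
      + ((l : ℝ[X]) * ((l : ℝ[X]) + 1) - (k : ℝ[X]) * ((k : ℝ[X]) + 1)) * derivative^[k] (legendreP l)
      = 0 := by
  induction k with
  | zero => simpa using legendreP_ode l
  | succ k ih =>
    have h := congrArg derivative ih
    simp only [derivative_add, derivative_mul, derivative_X, derivative_natCast, derivative_one,
      derivative_sub, derivative_X_pow, derivative_ofNat, derivative_zero,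
      ← Function.iterate_succ_apply' derivative] at h
    have h3 : (C (2:ℝ)) = 2 := rfl
    simp [h3, -Function.iterate_succ] at h
    push_cast
    linear_combination h

theorem iterate_derivative_legendreP_eq_zero {l k : ℕ} (h : l < k) :
    derivative^[k] (legendreP l) = 0 :=
  iterate_derivative_eq_zero ((natDegree_legendreP_le_and_coeff_pos l).1.trans_lt h)

end Legendre

/-! ### The polynomial part of Q_l, through generating series. -/

/-- The polynomial part `∑_{k=1}^{l} (1/k) P_{k-1} P_{l-k}` of the Legendre function of the second
kind. -/
def legendreW (l : ℕ) (s : ℝ) : ℝ :=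
  ∑ k ∈ Finset.range l,
    1 / ((k : ℝ) + 1) * (legendreP k).eval s * (legendreP (l - 1 - k)).eval s

section Generating
open PowerSeries

/-- The generating series of the Legendre polynomials at `s`. -/
def legendreGen (s : ℝ) : PowerSeries ℝ := PowerSeries.mk fun l => (legendreP l).eval s

/-- The primitive of `legendreGen`. -/
def legendreGenInt (s : ℝ) : PowerSeries ℝ :=
  PowerSeries.mk fun l => if l = 0 then 0 else (legendreP (l - 1)).eval s / l

/-- Bonnet's recursion read coefficient by coefficient; formally the series is (1 - 2sX +
X²)^{-1/2}. -/
theorem legendreGen_ode (s : ℝ) :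
    (1 - C (2 * s) * X + X * X) * d⁄dX ℝ (legendreGen s) = (C s - X) * legendreGen s := by
  ext n
  have e : (1 - C (2 * s) * X + X * X) * d⁄dX ℝ (legendreGen s)
      = d⁄dX ℝ (legendreGen s) - C (2 * s) * (X * d⁄dX ℝ (legendreGen s))
        + X * (X * d⁄dX ℝ (legendreGen s)) := by ring
  rw [e, sub_mul]
  simp only [map_add, map_sub, coeff_C_mul]
  match n with
  | 0 =>
    simp [coeff_derivative, legendreGen, legendreP_zero, legendreP_one]
  | 1 =>
    have := legendreP_bonnet_eval 0 s
    simp only [coeff_succ_X_mul, coeff_zero_X_mul, coeff_derivative, legendreGen, coeff_mk]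
    norm_num at this ⊢
    linear_combination this
  | n + 2 =>
    have := legendreP_bonnet_eval (n + 1) s
    simp only [coeff_succ_X_mul, coeff_derivative, legendreGen, coeff_mk]
    push_cast at this ⊢
    linear_combination this

/-- By the differential equation the left side has derivative zero, and its constant term is 1. This
replaces the closed form with a square root. -/
theorem legendreGen_sq (s : ℝ) :
    (1 - C (2 * s) * X + X * X) * (legendreGen s * legendreGen s) = 1 := by
  apply derivative.ext
  · have h := legendreGen_ode s
    simp only [Derivation.leibniz, map_add, map_sub, Derivation.map_one_eq_zero, smul_eq_mul,
      derivative_C, derivative_X, ]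
    have h2 : (C (2 * s) : PowerSeries ℝ) = 2 * C s := by
      rw [map_mul]; rfl
    rw [h2] at h ⊢
    linear_combination 2 * legendreGen s * h
  · simp [legendreGen, legendreP_zero]

theorem derivative_legendreGenInt (s : ℝ) : d⁄dX ℝ (legendreGenInt s) = legendreGen s := by
  ext n
  have : (n : ℝ) + 1 ≠ 0 := by positivity
  simp [coeff_derivative, legendreGenInt, legendreGen, this]

/-- The weights 1/k come from integrating the generating series, so the sum is a Cauchy product of
the series with its primitive. -/
theorem coeff_legendreGen_mul_int (s : ℝ) (l : ℕ) :
    coeff l (legendreGen s * legendreGenInt s) = legendreW l s := by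
  rw [mul_comm, coeff_mul, legendreW,
    Finset.Nat.sum_antidiagonal_eq_sum_range_succ
      (fun i j => coeff i (legendreGenInt s) * coeff j (legendreGen s)), Finset.sum_range_succ']
  simp only [legendreGenInt, legendreGen, coeff_mk]
  simp only [Nat.succ_ne_zero, if_false, if_true, zero_mul, add_zero, Nat.add_sub_cancel]
  refine Finset.sum_congr rfl fun k hk => ?_
  rw [show l - (k + 1) = l - 1 - k by omega]
  push_cast
  ring

/-- Bonnet's recursion for the polynomial part. -/
theorem legendreW_bonnet (l : ℕ) (s : ℝ) :
    ((l : ℝ) + 2) * legendreW (l + 2) s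
      = (2 * (l : ℝ) + 3) * s * legendreW (l + 1) s - ((l : ℝ) + 1) * legendreW l s := by
  set U := legendreGen s * legendreGenInt s with hU
  -- The product obeys the equation of the generating series up to the inhomogeneity (1 - 2sX + X²)
  -- G² = 1. That constant enters only coefficient 0, so in degree l + 1 the recursion is Bonnet's.
  have h : (1 - C (2 * s) * X + X * X) * d⁄dX ℝ U = (C s - X) * U + 1 := by
    have h1 := legendreGen_ode s
    have h2 := legendreGen_sq s
    simp only [hU, Derivation.leibniz, smul_eq_mul, derivative_legendreGenInt]
    linear_combination legendreGenInt s * h1 + h2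
  have e : (1 - C (2 * s) * X + X * X) * d⁄dX ℝ U
      = d⁄dX ℝ U - C (2 * s) * (X * d⁄dX ℝ U) + X * (X * d⁄dX ℝ U) := by ring
  rw [e, sub_mul] at h
  have hc := congrArg (coeff (l + 1)) h
  have hW := coeff_legendreGen_mul_int s
  rw [← hU] at hW
  cases l with
  | zero =>
    simp only [map_add, map_sub, coeff_C_mul, coeff_succ_X_mul, coeff_zero_X_mul, coeff_derivative,
      coeff_one, hW] at hc
    norm_num at hc ⊢
    linear_combination hc
  | succ n =>
    simp only [map_add, map_sub, coeff_C_mul, coeff_succ_X_mul, coeff_derivative,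
      coeff_one, hW] at hc
    norm_num at hc ⊢
    linear_combination hc

end Generating

/-! ### The Legendre functions Q_l and the radial functions α_l. -/

/-- The function `½ log ((1+s)/(1-s))`. -/
def legendreT (s : ℝ) : ℝ := 1 / 2 * Real.log ((1 + s) / (1 - s))

theorem legendreQ_eq (l : ℕ) (s : ℝ) :
    legendreQ l s = (legendreP l).eval s * legendreT s - legendreW l s := rfl

theorem legendreQ_zero (s : ℝ) : legendreQ 0 s = legendreT s := by
  simp [legendreQ_eq, legendreP_zero, legendreW]

theorem legendreQ_one (s : ℝ) : legendreQ 1 s = s * legendreT s - 1 := by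
  simp [legendreQ_eq, legendreP_zero, legendreP_one, legendreW]

theorem legendreQ_bonnet (l : ℕ) (s : ℝ) :
    ((l : ℝ) + 2) * legendreQ (l + 2) s
      = (2 * (l : ℝ) + 3) * s * legendreQ (l + 1) s - ((l : ℝ) + 1) * legendreQ l s := by
  simp only [legendreQ_eq]
  linear_combination legendreT s * legendreP_bonnet_eval l s - legendreW_bonnet l s

theorem legendreT_neg (s : ℝ) : legendreT (-s) = -legendreT s := by
  rw [legendreT, legendreT, ← mul_neg, ← Real.log_inv, inv_div]
  norm_num [sub_eq_add_neg]

theorem legendreQ_neg (l : ℕ) (s : ℝ) :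
    legendreQ l (-s) = -(-1) ^ l * legendreQ l s := by
  induction l using Nat.twoStepInduction with
  | zero => simp [legendreQ_zero, legendreT_neg s]
  | one => simp [legendreQ_one, legendreT_neg s]
  | more n h1 h2 =>
    have e1 := legendreQ_bonnet n s
    have e2 := legendreQ_bonnet n (-s)
    rw [h1, h2] at e2
    have h : (n : ℝ) + 2 ≠ 0 := by positivity
    apply mul_left_cancel₀ h
    rw [e2]
    linear_combination (-1 : ℝ) ^ (n + 2) * e1

theorem one_sub_sq_pos {s : ℝ} (hs : s ∈ Ioo (-1 : ℝ) 1) : 0 < 1 - s ^ 2 := by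
  nlinarith [hs.1, hs.2]

theorem hasDerivAt_legendreT {s : ℝ} (hs : s ∈ Ioo (-1 : ℝ) 1) :
    HasDerivAt legendreT (1 / (1 - s ^ 2)) s := by
  have h1 : 0 < 1 + s := by linarith [hs.1]
  have h2 : 0 < 1 - s := by linarith [hs.2]
  have := (((hasDerivAt_id s).const_add 1).div ((hasDerivAt_id s).const_sub 1) h2.ne').log
    (div_pos h1 h2).ne'
  have := this.const_mul (1 / 2)
  refine this.congr_deriv ?_
  have h3 := one_sub_sq_pos hs
  simp
  field_simp
  ring

theorem contDiffOn_legendreT : ContDiffOn ℝ ∞ legendreT (Ioo (-1 : ℝ) 1) := by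
  have : ContDiffOn ℝ ∞ (fun s : ℝ => (1 + s) / (1 - s)) (Ioo (-1 : ℝ) 1) := by
    apply ContDiffOn.div (by fun_prop) (by fun_prop)
    intro s hs
    linarith [hs.2]
  refine contDiffOn_const.mul (this.log ?_)
  intro s hs
  have h1 : 0 < 1 + s := by linarith [hs.1]
  have h2 : 0 < 1 - s := by linarith [hs.2]
  exact (div_pos h1 h2).ne'

theorem contDiff_polynomial_eval (p : Polynomial ℝ) : ContDiff ℝ ∞ fun s => p.eval s := by
  simpa [Polynomial.coe_aeval_eq_eval] using p.contDiff_aeval (𝕜 := ℝ) ∞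

theorem contDiff_legendreW (l : ℕ) : ContDiff ℝ ∞ (legendreW l) := by
  unfold legendreW
  refine ContDiff.sum fun k _ => ?_
  exact (contDiff_const.mul (contDiff_polynomial_eval _)).mul (contDiff_polynomial_eval _)

theorem contDiffOn_legendreQ (l : ℕ) : ContDiffOn ℝ ∞ (legendreQ l) (Ioo (-1 : ℝ) 1) := by
  have h1 := (contDiff_polynomial_eval (legendreP l)).contDiffOn (s := Ioo (-1 : ℝ) 1)
  exact (h1.mul contDiffOn_legendreT).sub (contDiff_legendreW l).contDiffOn

theorem differentiableAt_legendreQ (l : ℕ) {s : ℝ} (hs : s ∈ Ioo (-1 : ℝ) 1) :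
    DifferentiableAt ℝ (legendreQ l) s :=
  ((contDiffOn_legendreQ l).contDiffAt (isOpen_Ioo.mem_nhds hs)).differentiableAt (by simp)

/-- `(1 - s²) Q_{l+1}' = (l+1) (Q_l - s Q_{l+1})` and `(1 - s²) Q_l' = (l+1) (s Q_l - Q_{l+1})`. -/
theorem deriv_legendreQ_relations (l : ℕ) {s : ℝ} (hs : s ∈ Ioo (-1 : ℝ) 1) :
    (1 - s ^ 2) * deriv (legendreQ (l + 1)) s
        = ((l : ℝ) + 1) * (legendreQ l s - s * legendreQ (l + 1) s) ∧
      (1 - s ^ 2) * deriv (legendreQ l) s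
        = ((l : ℝ) + 1) * (s * legendreQ l s - legendreQ (l + 1) s) := by
  have h3 := one_sub_sq_pos hs
  induction l with
  | zero =>
    have e0 : legendreQ 0 = legendreT := funext legendreQ_zero
    have e1 : legendreQ 1 = fun s => s * legendreT s - 1 := funext legendreQ_one
    have hT := hasDerivAt_legendreT hs
    have h1 : deriv (legendreQ 1) s = legendreT s + s * (1 / (1 - s ^ 2)) := by
      rw [e1]
      simpa using (((hasDerivAt_id s).mul hT).sub_const 1).deriv
    simp only [zero_add, h1, legendreQ_one, e0, hT.deriv]
    constructor <;> · field_simp; ring_nf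
  | succ l ih =>
    obtain ⟨hA, hB⟩ := ih
    have hbon := legendreQ_bonnet l s
    -- Bonnet's recursion turns the first relation at l into the second at l + 1. The first relation
    -- at l + 1 then follows from the differentiated recursion `hd`.
    have hB' : (1 - s ^ 2) * deriv (legendreQ (l + 1)) s
        = ((l : ℝ) + 1 + 1) * (s * legendreQ (l + 1) s - legendreQ (l + 2) s) := by
      linear_combination hA + hbon
    have hd : ((l : ℝ) + 2) * deriv (legendreQ (l + 2)) s
        = (2 * (l : ℝ) + 3) * (legendreQ (l + 1) s + s * deriv (legendreQ (l + 1)) s)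
          - ((l : ℝ) + 1) * deriv (legendreQ l) s := by
      have f1 := ((differentiableAt_legendreQ (l + 2) hs).hasDerivAt.const_mul ((l : ℝ) + 2))
      have f2 := (((hasDerivAt_id s).mul (differentiableAt_legendreQ (l + 1) hs).hasDerivAt).const_mul
        (2 * (l : ℝ) + 3)).sub
          ((differentiableAt_legendreQ l hs).hasDerivAt.const_mul ((l : ℝ) + 1))
      have f3 := f1.unique (f2.congr_of_eventuallyEq (Eventually.of_forall fun x => by
        have := legendreQ_bonnet l x
        simp; linear_combination this))
      rw [f3]; simp
    refine ⟨?_, by push_cast; exact hB'⟩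
    have hl : (l : ℝ) + 2 ≠ 0 := by positivity
    apply mul_left_cancel₀ hl
    push_cast
    linear_combination (1 - s ^ 2) * hd + (2 * (l : ℝ) + 3) * s * hB' - ((l : ℝ) + 1) * hB
      - ((l : ℝ) + 1) * s * hbon

theorem alpha_eq (l : ℕ) {s : ℝ} (hs : s ∈ Ioo (-1 : ℝ) 1) :
    alpha l s = ((l : ℝ) + 1) * (s * legendreQ l s - legendreQ (l + 1) s) :=
  (deriv_legendreQ_relations l hs).2

theorem alpha_succ_eq (l : ℕ) {s : ℝ} (hs : s ∈ Ioo (-1 : ℝ) 1) :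
    alpha (l + 1) s = ((l : ℝ) + 1) * (legendreQ l s - s * legendreQ (l + 1) s) :=
  (deriv_legendreQ_relations l hs).1

/-- `α_l' = -l(l+1) Q_l`. -/
theorem hasDerivAt_alpha (l : ℕ) {s : ℝ} (hs : s ∈ Ioo (-1 : ℝ) 1) :
    HasDerivAt (alpha l) (-((l : ℝ) * (l + 1)) * legendreQ l s) s := by
  have h3 := one_sub_sq_pos hs
  have hq := fun k => (differentiableAt_legendreQ k hs).hasDerivAt
  have := ((((hasDerivAt_id s).mul (hq l)).sub (hq (l + 1))).const_mul ((l : ℝ) + 1))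
  refine (this.congr_of_eventuallyEq ?_).congr_deriv ?_
  · filter_upwards [isOpen_Ioo.mem_nhds hs] with x hx using alpha_eq l hx
  · obtain ⟨h1, h2⟩ := deriv_legendreQ_relations l hs
    apply mul_left_cancel₀ h3.ne'
    simp only [id]
    linear_combination ((l : ℝ) + 1) * s * h2 - ((l : ℝ) + 1) * h1

theorem deriv_alpha (l : ℕ) {s : ℝ} (hs : s ∈ Ioo (-1 : ℝ) 1) :
    deriv (alpha l) s = -((l : ℝ) * (l + 1)) * legendreQ l s := (hasDerivAt_alpha l hs).deriv

/-- `(1 - s²) α_l'' = -l(l+1) α_l`. -/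
theorem hasDerivAt_deriv_alpha (l : ℕ) {s : ℝ} (hs : s ∈ Ioo (-1 : ℝ) 1) :
    HasDerivAt (deriv (alpha l)) (((l : ℝ) * (l + 1)) * (-1 / (1 - s ^ 2)) * alpha l s) s := by
  have h3 := one_sub_sq_pos hs
  have := (differentiableAt_legendreQ l hs).hasDerivAt.const_mul (-((l : ℝ) * (l + 1)))
  refine (this.congr_of_eventuallyEq ?_).congr_deriv ?_
  · filter_upwards [isOpen_Ioo.mem_nhds hs] with x hx using deriv_alpha l hx
  · rw [alpha]; field_simp

theorem zero_mem_Ioo' : (0 : ℝ) ∈ Ioo (-1 : ℝ) 1 := by norm_num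

theorem neg_mem_Ioo' {s : ℝ} (hs : s ∈ Ioo (-1 : ℝ) 1) : -s ∈ Ioo (-1 : ℝ) 1 :=
  ⟨by linarith [hs.2], by linarith [hs.1]⟩

theorem alpha_neg (l : ℕ) {s : ℝ} (hs : s ∈ Ioo (-1 : ℝ) 1) :
    alpha l (-s) = (-1) ^ l * alpha l s := by
  rw [alpha_eq l hs, alpha_eq l (neg_mem_Ioo' hs), legendreQ_neg l s, legendreQ_neg (l + 1) s]
  ring

/-- At s = 0 Bonnet's recursion is (l+2) Q_{l+2} = -(l+1) Q_l. The even values inherit Q_0(0) = 0.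
For the odd ones, starting from |Q_1(0)| = 1, the values |Q_{2k+1}(0)| decrease while (2k+1)
|Q_{2k+1}(0)| increases. -/
theorem legendreQ_zero_values (k : ℕ) :
    legendreQ (2 * k) 0 = 0 ∧ 1 ≤ (2 * k + 1) * |legendreQ (2 * k + 1) 0| ∧
      |legendreQ (2 * k + 1) 0| ≤ 1 := by
  induction k with
  | zero => simp [legendreQ_zero, legendreQ_one, legendreT]
  | succ k ih =>
    obtain ⟨h1, h2, h3⟩ := ih
    have e1 := legendreQ_bonnet (2 * k) 0
    have e2 := legendreQ_bonnet (2 * k + 1) 0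
    rw [h1] at e1
    have a1 : legendreQ (2 * (k + 1)) 0 = 0 := by
      have : (2 * (k : ℝ)) + 2 ≠ 0 := by positivity
      rw [show 2 * (k + 1) = 2 * k + 2 by ring]
      push_cast at e1
      simpa [this] using e1
    have a2 : (2 * (k : ℝ) + 3) * |legendreQ (2 * (k + 1) + 1) 0|
        = (2 * k + 2) * |legendreQ (2 * k + 1) 0| := by
      have := congrArg abs e2
      rw [show 2 * (k + 1) + 1 = 2 * k + 1 + 2 by ring]
      push_cast at this
      simp only [mul_zero, zero_mul, zero_sub, abs_neg, abs_mul] at this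
      rw [abs_of_pos (show (0 : ℝ) < 2 * k + 1 + 2 by positivity),
        abs_of_pos (show (0 : ℝ) < 2 * k + 1 + 1 by positivity)] at this
      linear_combination this
    refine ⟨a1, ?_, ?_⟩
    · push_cast
      nlinarith [abs_nonneg (legendreQ (2 * k + 1) 0)]
    · have hk : (0 : ℝ) ≤ k := by positivity
      have := abs_nonneg (legendreQ (2 * (k + 1) + 1) 0)
      nlinarith

theorem alpha_odd_zero (k : ℕ) : alpha (2 * k + 1) 0 = 0 := by
  rw [alpha_succ_eq _ zero_mem_Ioo', (legendreQ_zero_values k).1]; simp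

theorem deriv_alpha_even_zero (k : ℕ) : deriv (alpha (2 * k)) 0 = 0 := by
  rw [deriv_alpha _ zero_mem_Ioo', (legendreQ_zero_values k).1]; simp

theorem alpha_zero {s : ℝ} (hs : s ∈ Ioo (-1 : ℝ) 1) : alpha 0 s = 1 := by
  rw [alpha_eq 0 hs, legendreQ_zero, legendreQ_one]; simp

/-- The lower bound makes division of Cauchy coefficients harmless; the upper bound is the initial
value in the energy estimate. The next lemma does the same for odd degree. -/
theorem abs_alpha_even_zero (k : ℕ) :
    1 ≤ |alpha (2 * k) 0| ∧ |alpha (2 * k) 0| ≤ 2 * k + 1 := by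
  obtain ⟨-, h2, h3⟩ := legendreQ_zero_values k
  have : |alpha (2 * k) 0| = (2 * k + 1) * |legendreQ (2 * k + 1) 0| := by
    rw [alpha_eq _ zero_mem_Ioo', abs_mul, abs_of_pos (by positivity)]
    simp
  rw [this]
  refine ⟨h2, ?_⟩
  have hk : (0 : ℝ) ≤ k := by positivity
  nlinarith

theorem abs_deriv_alpha_odd_zero (k : ℕ) :
    1 ≤ |deriv (alpha (2 * k + 1)) 0| ∧
      |deriv (alpha (2 * k + 1)) 0| ≤ (2 * k + 1) * (2 * k + 2) := by
  obtain ⟨-, h2, h3⟩ := legendreQ_zero_values k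
  have : |deriv (alpha (2 * k + 1)) 0|
      = (2 * k + 2) * ((2 * k + 1) * |legendreQ (2 * k + 1) 0|) := by
    rw [deriv_alpha _ zero_mem_Ioo', abs_mul, abs_neg, abs_of_nonneg (by positivity)]
    push_cast; ring
  rw [this]
  have hk : (0 : ℝ) ≤ k := by positivity
  constructor
  · nlinarith
  · have : (2 * (k:ℝ) + 2) * (2 * k + 1) * |legendreQ (2 * k + 1) 0| ≤ (2 * k + 2) * (2 * k + 1) * 1 :=
      mul_le_mul_of_nonneg_left h3 (by positivity)
    linarith

/-! ### Energy estimates, uniform up to the ends of the interval. -/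

/-- For a solution of `(1 - s²) f'' = -L f`, the energy `L f² + (1 - s²) f'²` is at most its value
at `0`. -/
theorem energy_le {L : ℝ} {f f' : ℝ → ℝ}
    (hf : ∀ s ∈ Ioo (-1 : ℝ) 1, HasDerivAt f (f' s) s)
    (hf' : ∀ s ∈ Ioo (-1 : ℝ) 1, HasDerivAt f' (L * (-1 / (1 - s ^ 2)) * f s) s)
    {s : ℝ} (hs : s ∈ Ico (0 : ℝ) 1) :
    L * f s ^ 2 + (1 - s ^ 2) * f' s ^ 2 ≤ L * f 0 ^ 2 + f' 0 ^ 2 := by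
  -- The equation cancels the mixed terms ± 2L f f'; only the derivative of the weight 1 - s²
  -- survives.
  have hd : ∀ t ∈ Ioo (-1 : ℝ) 1,
      HasDerivAt (fun s => L * f s ^ 2 + (1 - s ^ 2) * f' s ^ 2) (-2 * t * f' t ^ 2) t := by
    intro t ht
    have h3 := one_sub_sq_pos ht
    have := (((hf t ht).pow 2).const_mul L).add
      ((((hasDerivAt_id t).pow 2).const_sub 1).mul ((hf' t ht).pow 2))
    refine this.congr_deriv ?_
    simp
    field_simp
    ring
  have hanti : AntitoneOn (fun s => L * f s ^ 2 + (1 - s ^ 2) * f' s ^ 2) (Ico (0 : ℝ) 1) := by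
    apply antitoneOn_of_deriv_nonpos (convex_Ico 0 1)
    · intro t ht
      exact (hd t ⟨by linarith [ht.1], ht.2⟩).continuousAt.continuousWithinAt
    · intro t ht
      rw [interior_Ico] at ht
      exact (hd t ⟨by linarith [ht.1], ht.2⟩).differentiableAt.differentiableWithinAt
    · intro t ht
      rw [interior_Ico] at ht
      rw [(hd t ⟨by linarith [ht.1], ht.2⟩).deriv]
      nlinarith [ht.1, sq_nonneg (f' t), mul_nonneg ht.1.le (sq_nonneg (f' t))]
  have := hanti (left_mem_Ico.2 one_pos) hs hs.1
  simpa using this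

theorem deriv_alpha_neg (l : ℕ) {s : ℝ} (hs : s ∈ Ioo (-1 : ℝ) 1) :
    deriv (alpha l) (-s) = -(-1) ^ l * deriv (alpha l) s := by
  rw [deriv_alpha l hs, deriv_alpha l (neg_mem_Ioo' hs), legendreQ_neg l s]; ring

/-- At 0 only one of α_l, α_l' is nonzero, of size at most l + 1 for even l and l(l+1) for odd l;
either way the initial energy is within the bound. Parity carries the estimate to negative s. -/
theorem alpha_energy_le (l : ℕ) {s : ℝ} (hs : s ∈ Ioo (-1 : ℝ) 1) :
    (l : ℝ) * (l + 1) * alpha l s ^ 2 + (1 - s ^ 2) * deriv (alpha l) s ^ 2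
      ≤ (l : ℝ) * (l + 1) * ((l : ℝ) + 1) ^ 2 := by
  have key : ∀ t ∈ Ico (0 : ℝ) 1,
      (l : ℝ) * (l + 1) * alpha l t ^ 2 + (1 - t ^ 2) * deriv (alpha l) t ^ 2
        ≤ (l : ℝ) * (l + 1) * ((l : ℝ) + 1) ^ 2 := by
    intro t ht
    refine (energy_le (L := (l : ℝ) * (l + 1)) (f := alpha l) (f' := deriv (alpha l))
      (fun s hs => (hasDerivAt_alpha l hs).differentiableAt.hasDerivAt)
      (fun s hs => hasDerivAt_deriv_alpha l hs) ht).trans ?_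
    rcases Nat.even_or_odd' l with ⟨k, rfl | rfl⟩
    · have h := (abs_alpha_even_zero k).2
      rw [deriv_alpha_even_zero, ← sq_abs (alpha _ _)]
      push_cast
      have : |alpha (2 * k) 0| ^ 2 ≤ (2 * (k : ℝ) + 1) ^ 2 := by gcongr
      have h0 : (0 : ℝ) ≤ 2 * k * (2 * k + 1) := by positivity
      nlinarith
    · have h := (abs_deriv_alpha_odd_zero k).2
      rw [alpha_odd_zero, ← sq_abs (deriv _ _)]
      push_cast
      have : |deriv (alpha (2 * k + 1)) 0| ^ 2 ≤ ((2 * (k : ℝ) + 1) * (2 * k + 2)) ^ 2 := by gcongr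
      have h0 : (0 : ℝ) ≤ k := by positivity
      refine (by simpa using this : _ ≤ _).trans ?_
      have : 0 ≤ (2 * (k : ℝ) + 1) * (2 * k + 2) ^ 2 := by positivity
      nlinarith
  rcases le_total 0 s with h | h
  · exact key s ⟨h, hs.2⟩
  · have := key (-s) ⟨by linarith, by linarith [hs.1]⟩
    rw [alpha_neg l hs, deriv_alpha_neg l hs] at this
    have e : ((-1 : ℝ) ^ l) ^ 2 = 1 := by rw [← pow_mul, mul_comm, pow_mul]; simp
    simpa [mul_pow, e] using this

theorem abs_alpha_le (l : ℕ) {s : ℝ} (hs : s ∈ Ioo (-1 : ℝ) 1) : |alpha l s| ≤ (l : ℝ) + 1 := by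
  -- For l = 0 the energy does not see α_l itself, so this degree is treated directly.
  rcases Nat.eq_zero_or_pos l with rfl | hl
  · simp [alpha_zero hs]
  · have h := alpha_energy_le l hs
    have h3 := one_sub_sq_pos hs
    have hl' : (0 : ℝ) < l := by exact_mod_cast hl
    apply abs_le_of_sq_le_sq _ (by positivity)
    have : (l : ℝ) * (l + 1) * alpha l s ^ 2 ≤ (l : ℝ) * (l + 1) * ((l : ℝ) + 1) ^ 2 := by
      nlinarith [sq_nonneg (deriv (alpha l) s), mul_nonneg h3.le (sq_nonneg (deriv (alpha l) s))]
    exact le_of_mul_le_mul_left this (by positivity)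

/-- The other half of the energy. A weight vanishing at the ends is needed, since α_l' is a multiple
of Q_l, which has a logarithmic singularity there. -/
theorem sqrt_mul_abs_deriv_alpha_le (l : ℕ) {s : ℝ} (hs : s ∈ Ioo (-1 : ℝ) 1) :
    Real.sqrt (1 - s ^ 2) * |deriv (alpha l) s| ≤ ((l : ℝ) + 1) ^ 2 := by
  have h := alpha_energy_le l hs
  have h3 := one_sub_sq_pos hs
  rw [← abs_of_nonneg (Real.sqrt_nonneg (1 - s ^ 2)), ← abs_mul]
  apply abs_le_of_sq_le_sq _ (by positivity)
  rw [mul_pow, Real.sq_sqrt h3.le]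
  have h4 : 0 ≤ (l : ℝ) * (l + 1) * alpha l s ^ 2 := by positivity
  have h5 : (l : ℝ) * (l + 1) * ((l : ℝ) + 1) ^ 2 ≤ (((l : ℝ) + 1) ^ 2) ^ 2 := by
    have : (l : ℝ) * (l + 1) ≤ ((l : ℝ) + 1) ^ 2 := by nlinarith [(Nat.cast_nonneg l : (0 : ℝ) ≤ l)]
    calc _ ≤ ((l : ℝ) + 1) ^ 2 * ((l : ℝ) + 1) ^ 2 := by gcongr
      _ = _ := by ring
  linarith

/-! ### Boundary values and first examples of α_l. -/

/-- The continuous extension of `(1 - s²) ½ log ((1+s)/(1-s))`. -/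
def legendreH (s : ℝ) : ℝ :=
  1 / 2 * ((1 - s) * ((1 + s) * Real.log (1 + s)) - (1 + s) * ((1 - s) * Real.log (1 - s)))

theorem continuous_legendreH : Continuous legendreH := by
  have h1 := Real.continuous_mul_log.comp (continuous_const_add (1 : ℝ))
  have h2 := Real.continuous_mul_log.comp (continuous_sub_left (1 : ℝ))
  simp only [Function.comp_def] at h1 h2
  unfold legendreH
  fun_prop

theorem legendreH_eq {s : ℝ} (hs : s ∈ Ioo (-1 : ℝ) 1) :
    legendreH s = (1 - s ^ 2) * legendreT s := by
  have h1 : 0 < 1 + s := by linarith [hs.1]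
  have h2 : 0 < 1 - s := by linarith [hs.2]
  rw [legendreH, legendreT, Real.log_div h1.ne' h2.ne']
  ring

theorem tendsto_boundary_of_continuous {f g : ℝ → ℝ} (hg : Continuous g)
    (h : ∀ s ∈ Ioo (-1 : ℝ) 1, f s = g s) :
    Tendsto f (𝓝[<] 1) (𝓝 (g 1)) ∧ Tendsto f (𝓝[>] (-1)) (𝓝 (g (-1))) := by
  constructor
  · refine ((hg.tendsto 1).mono_left nhdsWithin_le_nhds).congr' ?_
    filter_upwards [Ioo_mem_nhdsLT (show (-1 : ℝ) < 1 by norm_num)] with s hs using (h s hs).symm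
  · refine ((hg.tendsto (-1)).mono_left nhdsWithin_le_nhds).congr' ?_
    filter_upwards [Ioo_mem_nhdsGT (show (-1 : ℝ) < 1 by norm_num)] with s hs using (h s hs).symm

/-- In (1 - s²) Q_l' the logarithm occurs only with the factor 1 - s², and (1 - s²) times the
derivative of ½ log((1+s)/(1-s)) is 1. What survives at the ends is P_l(±1). -/
theorem alpha_boundary (l : ℕ) :
    Tendsto (alpha l) (𝓝[<] 1) (𝓝 1) ∧ Tendsto (alpha l) (𝓝[>] (-1)) (𝓝 ((-1) ^ l)) := by
  have hW := ((contDiff_legendreW l).continuous_deriv (by simp))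
  have hP := fun p => (contDiff_polynomial_eval p).continuous
  have hc : Continuous fun s => (Polynomial.derivative (legendreP l)).eval s * legendreH s
      + (legendreP l).eval s - (1 - s ^ 2) * deriv (legendreW l) s :=
    (((hP _).mul continuous_legendreH).add (hP _)).sub (by fun_prop)
  have := tendsto_boundary_of_continuous (f := alpha l) hc ?_
  · simpa [legendreH, legendreP_eval_one, legendreP_eval_neg_one] using this
  · intro s hs
    have h3 := one_sub_sq_pos hs
    have h := (((legendreP l).hasDerivAt s).mul (hasDerivAt_legendreT hs)).sub
      ((contDiff_legendreW l).differentiable (by simp) s).hasDerivAt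
    rw [alpha, show legendreQ l = (fun s => (legendreP l).eval s) * legendreT - legendreW l from
      funext fun s => legendreQ_eq l s, h.deriv, legendreH_eq hs]
    field_simp

/-- α_l' is a multiple of Q_l, which grows only logarithmically, so the factor 1 - s² kills it. -/
theorem deriv_alpha_boundary (l : ℕ) :
    Tendsto (fun s => (1 - s ^ 2) * deriv (alpha l) s) (𝓝[<] 1) (𝓝 0) ∧
      Tendsto (fun s => (1 - s ^ 2) * deriv (alpha l) s) (𝓝[>] (-1)) (𝓝 0) := by
  have hW := (contDiff_legendreW l).continuous
  have hP := fun p => (contDiff_polynomial_eval p).continuous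
  have hc : Continuous fun s => -((l : ℝ) * (l + 1)) *
      ((legendreP l).eval s * legendreH s - (1 - s ^ 2) * legendreW l s) :=
    continuous_const.mul (((hP _).mul continuous_legendreH).sub (by fun_prop))
  have := tendsto_boundary_of_continuous (f := fun s => (1 - s ^ 2) * deriv (alpha l) s) hc ?_
  · simpa [legendreH] using this
  · intro s hs
    simp only [deriv_alpha l hs, legendreQ_eq, legendreH_eq hs]
    ring

theorem alpha_one {s : ℝ} (hs : s ∈ Ioo (-1 : ℝ) 1) :
    alpha 1 s = s + (1 - s ^ 2) / 2 * Real.log ((1 + s) / (1 - s)) := by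
  have h := alpha_succ_eq 0 hs
  rw [zero_add] at h
  rw [h, legendreQ_zero, legendreQ_one, legendreT]
  norm_num
  ring

theorem alpha_two {s : ℝ} (hs : s ∈ Ioo (-1 : ℝ) 1) :
    alpha 2 s = 3 * s ^ 2 - 2 + 3 * s * (1 - s ^ 2) / 2 * Real.log ((1 + s) / (1 - s)) := by
  have h := legendreQ_bonnet 0 s
  have h2 := alpha_succ_eq 1 hs
  rw [one_add_one_eq_two] at h2
  rw [h2]
  simp only [zero_add, legendreQ_zero, legendreQ_one, legendreT] at h ⊢
  norm_num at h ⊢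
  linear_combination -s * h

theorem alpha_even_zero_ne (k : ℕ) : alpha (2 * k) 0 ≠ 0 := fun h => by
  have := (abs_alpha_even_zero k).1
  rw [h] at this; norm_num at this

theorem deriv_alpha_odd_zero_ne (k : ℕ) : deriv (alpha (2 * k + 1)) 0 ≠ 0 := fun h => by
  have := (abs_deriv_alpha_odd_zero k).1
  rw [h] at this; norm_num at this

theorem deriv_alpha_one_zero : deriv (alpha 1) 0 = 2 := by
  rw [deriv_alpha 1 zero_mem_Ioo', legendreQ_one]; norm_num

theorem alpha_two_zero : alpha 2 0 = -2 := by
  rw [alpha_two zero_mem_Ioo']; norm_num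

/-! ### Radial extensions -/

/-- The radial projection onto the sphere. -/
def proj (y : E3) : S2 :=
  -- An arbitrary point of the sphere, there to make the projection total.
  if h : y = 0 then ⟨EuclideanSpace.single 0 1, by simp⟩
  else ⟨‖y‖⁻¹ • y, by
    have hy : ‖y‖ ≠ 0 := norm_ne_zero_iff.mpr h
    simp [norm_smul, inv_mul_cancel₀ hy]⟩

theorem proj_coe_eq {y : E3} (hy : y ≠ 0) : (proj y : E3) = ‖y‖⁻¹ • y := by
  simp [proj, hy]

theorem norm_coe (x : S2) : ‖(x : E3)‖ = 1 := norm_eq_of_mem_sphere x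

theorem coe_ne_zero (x : S2) : (x : E3) ≠ 0 := ne_zero_of_mem_unit_sphere x

theorem proj_coe (x : S2) : proj (x : E3) = x := by
  apply Subtype.ext
  rw [proj_coe_eq (coe_ne_zero x), norm_coe]; simp

theorem proj_smul {r : ℝ} (hr : 0 < r) {y : E3} (hy : y ≠ 0) : proj (r • y) = proj y := by
  apply Subtype.ext
  rw [proj_coe_eq hy, proj_coe_eq (smul_ne_zero hr.ne' hy), norm_smul, Real.norm_of_nonneg hr.le,
    smul_smul]
  congr 1
  field_simp

theorem radialExt_eq {F : Type*} [Zero F] (f : S2 → F) {y : E3} (hy : y ≠ 0) :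
    radialExt f y = f (proj y) := by
  simp [radialExt, proj, hy]

theorem radialExt_coe {F : Type*} [Zero F] (f : S2 → F) (x : S2) :
    radialExt f (x : E3) = f x := by
  rw [radialExt_eq f (coe_ne_zero x), proj_coe]

theorem radialExt_smul {F : Type*} [Zero F] (f : S2 → F) {r : ℝ} (hr : 0 < r) {y : E3}
    (hy : y ≠ 0) : radialExt f (r • y) = radialExt f y := by
  rw [radialExt_eq f hy, radialExt_eq f (smul_ne_zero hr.ne' hy), proj_smul hr hy]

theorem contMDiff_coe_S2 : ContMDiff (𝓡 2) 𝓘(ℝ, E3) ∞ ((↑) : S2 → E3) :=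
  haveI := Fact.mk (@finrank_euclideanSpace_fin ℝ _ (2 + 1))
  contMDiff_coe_sphere (n := 2)

theorem contMDiff_codRestrict_S2 {H M : Type*} [TopologicalSpace H] {F : Type*}
    [NormedAddCommGroup F] [NormedSpace ℝ F] {I : ModelWithCorners ℝ F H} [TopologicalSpace M]
    [ChartedSpace H M] [IsManifold I ∞ M] {f : M → E3} (hf : ContMDiff I 𝓘(ℝ, E3) ∞ f)
    (hf' : ∀ x, f x ∈ Metric.sphere (0 : E3) 1) :
    ContMDiff I (𝓡 2) ∞ (Set.codRestrict f (Metric.sphere (0 : E3) 1) hf' : M → S2) :=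
  haveI := Fact.mk (@finrank_euclideanSpace_fin ℝ _ (2 + 1))
  ContMDiff.codRestrict_sphere (n := 2) hf hf'

/-- Restricting the codomain to the sphere needs a map that takes values in it everywhere. The
normalization is therefore first regarded as a map on the open submanifold of nonzero vectors. -/
theorem contMDiffAt_proj {y : E3} (hy : y ≠ 0) : ContMDiffAt 𝓘(ℝ, E3) (𝓡 2) ∞ proj y := by
  let U : TopologicalSpace.Opens E3 := ⟨{0}ᶜ, isOpen_compl_singleton⟩
  have hU : ∀ z : U, (z : E3) ≠ 0 := fun z => z.2
  have h1 : ContMDiff 𝓘(ℝ, E3) 𝓘(ℝ, E3) ∞ (fun z : U => ‖(z : E3)‖⁻¹ • (z : E3)) := by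
    intro z
    have h : ContMDiffAt 𝓘(ℝ, E3) 𝓘(ℝ, E3) ∞ (fun z : E3 => ‖z‖⁻¹ • z) (z : E3) := by
      apply ContDiffAt.contMDiffAt
      exact ((contDiffAt_norm ℝ (hU z)).inv (norm_ne_zero_iff.2 (hU z))).smul contDiffAt_id
    exact contMDiffAt_subtype_iff.2 h
  have h2 := contMDiff_codRestrict_S2 h1 (fun z => by
    have : ‖(z : E3)‖ ≠ 0 := norm_ne_zero_iff.2 (hU z)
    simp [norm_smul, inv_mul_cancel₀ this])
  have h3 := h2 ⟨y, hy⟩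
  have h4 : (Set.codRestrict (fun z : U => ‖(z : E3)‖⁻¹ • (z : E3)) (Metric.sphere (0 : E3) 1)
      (fun z => by
        have : ‖(z : E3)‖ ≠ 0 := norm_ne_zero_iff.2 (hU z)
        simp [norm_smul, inv_mul_cancel₀ this])) = fun z : U => proj z := by
    funext z
    apply Subtype.ext
    rw [proj_coe_eq (hU z)]; rfl
  rw [h4] at h3
  exact contMDiffAt_subtype_iff.1 h3

/-- The extension of a function on the hyperboloid to `(-1, 1) × (E3 ∖ {0})`, constant along rays. -/
def flatExt (lam : ℝ → S2 → ℝ) (p : ℝ × E3) : ℝ := radialExt (lam p.1) p.2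

/-- The domain `(-1, 1) × (E3 ∖ {0})`. -/
def flatDom : Set (ℝ × E3) := Ioo (-1 : ℝ) 1 ×ˢ {0}ᶜ

theorem isOpen_flatDom : IsOpen flatDom := isOpen_Ioo.prod isOpen_compl_singleton

theorem coe_mem_flatDom {s : ℝ} (hs : s ∈ Ioo (-1 : ℝ) 1) (x : S2) : (s, (x : E3)) ∈ flatDom :=
  ⟨hs, coe_ne_zero x⟩

theorem flatExt_coe (lam : ℝ → S2 → ℝ) (s : ℝ) (x : S2) : flatExt lam (s, (x : E3)) = lam s x :=
  radialExt_coe _ x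

theorem flatExt_eq (lam : ℝ → S2 → ℝ) {p : ℝ × E3} (hp : p.2 ≠ 0) :
    flatExt lam p = lam p.1 (proj p.2) := radialExt_eq _ hp

/-- Composition with the inclusion and with the radial projection goes back and forth. From here on,
smoothness is ordinary calculus on an open subset of ℝ × E3. -/
theorem smoothHyp_iff {lam : ℝ → S2 → ℝ} :
    SmoothHyp lam ↔ ContDiffOn ℝ ∞ (flatExt lam) flatDom := by
  constructor
  · intro h
    rw [← contMDiffOn_iff_contDiffOn]
    have h1 : ContMDiffOn 𝓘(ℝ, ℝ × E3) (𝓘(ℝ, ℝ).prod (𝓡 2)) ∞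
        (fun p : ℝ × E3 => (p.1, proj p.2)) flatDom := by
      intro p hp
      apply ContMDiffWithinAt.prodMk
      · exact contDiff_fst.contMDiff.contMDiffAt.contMDiffWithinAt
      · exact ((contMDiffAt_proj hp.2).comp p
          (contDiff_snd.contMDiff.contMDiffAt)).contMDiffWithinAt
    refine (ContMDiffOn.comp h h1 ?_).congr fun p hp => flatExt_eq lam hp.2
    intro p hp
    exact ⟨hp.1, mem_univ _⟩
  · intro h
    rw [← contMDiffOn_iff_contDiffOn] at h
    have h1 : ContMDiffOn (𝓘(ℝ, ℝ).prod (𝓡 2)) 𝓘(ℝ, ℝ × E3) ∞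
        (fun q : ℝ × S2 => (q.1, (q.2 : E3))) (Ioo (-1 : ℝ) 1 ×ˢ (univ : Set S2)) := by
      apply ContMDiff.contMDiffOn
      exact contMDiff_fst.prodMk_space (contMDiff_coe_S2.comp contMDiff_snd)
    refine (h.comp h1 ?_).congr fun q _ => (flatExt_coe lam q.1 q.2).symm
    intro q hq
    exact coe_mem_flatDom hq.1 q.2

theorem smoothS2_iff_smoothHyp {f : S2 → ℝ} : SmoothS2 f ↔ SmoothHyp fun _ => f := by
  constructor
  · intro h
    exact (ContMDiff.comp h contMDiff_snd).contMDiffOn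
  · intro h
    have h1 : ContMDiff (𝓡 2) (𝓘(ℝ, ℝ).prod (𝓡 2)) ∞ (fun x : S2 => ((0 : ℝ), x)) :=
      contMDiff_const.prodMk contMDiff_id
    rw [SmoothS2, ← contMDiffOn_univ]
    exact ContMDiffOn.comp (g := Function.uncurry fun _ : ℝ => f) h h1.contMDiffOn
      fun x _ => ⟨by norm_num, mem_univ _⟩

theorem SmoothHyp.slice {lam : ℝ → S2 → ℝ} (h : SmoothHyp lam) {s : ℝ} (hs : s ∈ Ioo (-1 : ℝ) 1) :
    SmoothS2 (lam s) := by
  have h1 : ContMDiff (𝓡 2) (𝓘(ℝ, ℝ).prod (𝓡 2)) ∞ (fun x : S2 => (s, x)) :=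
    contMDiff_const.prodMk contMDiff_id
  rw [SmoothS2, ← contMDiffOn_univ]
  exact ContMDiffOn.comp (g := Function.uncurry lam) h h1.contMDiffOn
    fun x _ => ⟨hs, mem_univ _⟩

theorem SmoothS2.contDiffOn {f : S2 → ℝ} (h : SmoothS2 f) :
    ContDiffOn ℝ ∞ (radialExt f) {0}ᶜ := by
  have h1 := smoothHyp_iff.1 (smoothS2_iff_smoothHyp.1 h)
  have h2 : ContDiff ℝ ∞ (fun y : E3 => ((0 : ℝ), y)) := contDiff_const.prodMk contDiff_id
  exact h1.comp h2.contDiffOn fun y hy => ⟨by norm_num, hy⟩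

theorem SmoothS2.differentiableAt {f : S2 → ℝ} (h : SmoothS2 f) {y : E3} (hy : y ≠ 0) :
    DifferentiableAt ℝ (radialExt f) y :=
  (h.contDiffOn.contDiffAt (isOpen_compl_singleton.mem_nhds hy)).differentiableAt (by simp)

theorem SmoothS2.continuous {f : S2 → ℝ} (h : SmoothS2 f) : Continuous f := ContMDiff.continuous h

theorem smoothS2_of_contDiff {G : E3 → ℝ} (hG : ContDiff ℝ ∞ G) : SmoothS2 fun x => G x :=
  hG.contMDiff.comp contMDiff_coe_S2

theorem SmoothHyp.contDiffAt {lam : ℝ → S2 → ℝ} (h : SmoothHyp lam) {p : ℝ × E3}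
    (hp : p ∈ flatDom) : ContDiffAt ℝ ∞ (flatExt lam) p :=
  (smoothHyp_iff.1 h).contDiffAt (isOpen_flatDom.mem_nhds hp)

theorem SmoothHyp.differentiableAt {lam : ℝ → S2 → ℝ} (h : SmoothHyp lam) {p : ℝ × E3}
    (hp : p ∈ flatDom) : DifferentiableAt ℝ (flatExt lam) p :=
  (h.contDiffAt hp).differentiableAt (by simp)

theorem SmoothHyp.congr {lam lam' : ℝ → S2 → ℝ} (h : SmoothHyp lam)
    (heq : ∀ s ∈ Ioo (-1 : ℝ) 1, ∀ x, lam' s x = lam s x) : SmoothHyp lam' :=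
  ContMDiffOn.congr h fun q hq => heq q.1 hq.1 q.2

theorem SmoothHyp.add {lam lam' : ℝ → S2 → ℝ} (h : SmoothHyp lam) (h' : SmoothHyp lam') :
    SmoothHyp fun s x => lam s x + lam' s x := ContMDiffOn.add h h'

theorem SmoothHyp.mul {lam lam' : ℝ → S2 → ℝ} (h : SmoothHyp lam) (h' : SmoothHyp lam') :
    SmoothHyp fun s x => lam s x * lam' s x := ContMDiffOn.mul h h'

theorem smoothHyp_of_contDiffOn {a : ℝ → ℝ} (ha : ContDiffOn ℝ ∞ a (Ioo (-1 : ℝ) 1)) :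
    SmoothHyp fun s _ => a s :=
  ha.contMDiffOn.comp contMDiffOn_fst fun _ hq => hq.1

theorem SmoothHyp.sum {ι : Type*} {t : Finset ι} {lam : ι → ℝ → S2 → ℝ}
    (h : ∀ i ∈ t, SmoothHyp (lam i)) : SmoothHyp fun s x => ∑ i ∈ t, lam i s x := by
  classical
  induction t using Finset.induction_on with
  | empty => simpa using smoothHyp_of_contDiffOn (contDiffOn_const (c := (0 : ℝ)))
  | insert a t ha ih =>
    simp only [Finset.sum_insert ha]
    exact (h a (by simp)).add (ih fun i hi => h i (by simp [hi]))

/-! ### Rotational derivatives -/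

/-- The infinitesimal rotation `y ↦ e_j × y`. -/
def rotGen (j : Fin 3) : E3 →L[ℝ] E3 :=
  LinearMap.toContinuousLinearMap
    { toFun := fun y => WithLp.toLp 2
        (![![0, -y 2, y 1], ![y 2, 0, -y 0], ![-y 1, y 0, 0]] j)
      map_add' := fun y z => by ext i; fin_cases j <;> fin_cases i <;> simp [add_comm]
      map_smul' := fun c y => by ext i; fin_cases j <;> fin_cases i <;> simp }

theorem rotGen_apply (j : Fin 3) (y : E3) : rotGen j y = WithLp.toLp 2
    (![![0, -y 2, y 1], ![y 2, 0, -y 0], ![-y 1, y 0, 0]] j) := rfl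

theorem inner_E3 (y z : E3) : inner ℝ y z = y 0 * z 0 + y 1 * z 1 + y 2 * z 2 := by
  simp [PiLp.inner_apply, Fin.sum_univ_three]; ring

theorem norm_sq_E3 (y : E3) : ‖y‖ ^ 2 = y 0 ^ 2 + y 1 ^ 2 + y 2 ^ 2 := by
  rw [← real_inner_self_eq_norm_sq, inner_E3]; ring

theorem inner_rotGen_self (j : Fin 3) (y : E3) : inner ℝ y (rotGen j y) = 0 := by
  rw [inner_E3]; fin_cases j <;> simp [rotGen_apply] <;> ring

/-- The identity for the double vector product. It resolves the tangential projection into the three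
rotation fields, which therefore serve as a global (overcomplete) frame. -/
theorem sum_inner_rotGen_smul (y v : E3) :
    ∑ j, (inner ℝ (rotGen j y) v : ℝ) • rotGen j y = ‖y‖ ^ 2 • v - (inner ℝ y v : ℝ) • y := by
  ext i
  rw [norm_sq_E3]
  simp only [inner_E3, Fin.sum_univ_three]
  fin_cases i <;> simp [rotGen_apply] <;> ring

/-- The derivative of a function on the sphere along the rotation about the `j`-th axis. -/
def rotD (j : Fin 3) (f : S2 → ℝ) (x : S2) : ℝ :=
  fderiv ℝ (radialExt f) (x : E3) (rotGen j x)

/-- A function that is homogeneous of degree 0 has a differential of degree -1. -/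
theorem fderiv_radialExt_proj {f : S2 → ℝ} {y : E3} (hy : y ≠ 0)
    (hf : DifferentiableAt ℝ (radialExt f) y) (v : E3) :
    fderiv ℝ (radialExt f) (proj y) (‖y‖⁻¹ • v) = fderiv ℝ (radialExt f) y v := by
  have hn : 0 < ‖y‖ := norm_pos_iff.2 hy
  have hy' : y = ‖y‖ • (proj y : E3) := by
    rw [proj_coe_eq hy, smul_smul, mul_inv_cancel₀ hn.ne', one_smul]
  have h1 : HasFDerivAt (fun z : E3 => radialExt f (‖y‖ • z))
      ((fderiv ℝ (radialExt f) y).comp (‖y‖ • ContinuousLinearMap.id ℝ E3)) (proj y : E3) := by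
    have h2 : HasFDerivAt (fun z : E3 => ‖y‖ • z) (‖y‖ • ContinuousLinearMap.id ℝ E3)
      (proj y : E3) :=
      (‖y‖ • ContinuousLinearMap.id ℝ E3).hasFDerivAt
    have h3 : HasFDerivAt (radialExt f) (fderiv ℝ (radialExt f) y) (‖y‖ • (proj y : E3)) := by
      rw [← hy']; exact hf.hasFDerivAt
    exact h3.comp _ h2
  have h4 : HasFDerivAt (radialExt f)
      ((fderiv ℝ (radialExt f) y).comp (‖y‖ • ContinuousLinearMap.id ℝ E3)) (proj y : E3) := by
    refine h1.congr_of_eventuallyEq ?_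
    filter_upwards [isOpen_compl_singleton.mem_nhds (coe_ne_zero (proj y))] with z hz
    exact (radialExt_smul f hn hz).symm
  rw [h4.fderiv]
  simp
  field_simp

/-- Euler's relation in degree 0: the extension is constant along the ray through y. -/
theorem fderiv_radialExt_self {f : S2 → ℝ} {y : E3} (hy : y ≠ 0)
    (hf : DifferentiableAt ℝ (radialExt f) y) : fderiv ℝ (radialExt f) y y = 0 := by
  have h1 : HasDerivAt (fun t : ℝ => radialExt f (y + t • y)) (fderiv ℝ (radialExt f) y y) 0 :=
    hf.hasFDerivAt.hasLineDerivAt y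
  have h2 : HasDerivAt (fun t : ℝ => radialExt f (y + t • y)) 0 0 := by
    refine (hasDerivAt_const (0 : ℝ) (radialExt f y)).congr_of_eventuallyEq ?_
    filter_upwards [Ioi_mem_nhds (show (-1 : ℝ) < 0 by norm_num)] with t ht
    have : y + t • y = (1 + t) • y := by rw [add_smul, one_smul]
    rw [this, radialExt_smul f (by simp at ht; linarith) hy]
  exact h1.unique h2

theorem fderiv_radialExt_rotGen {f : S2 → ℝ} {y : E3} (hy : y ≠ 0)
    (hf : DifferentiableAt ℝ (radialExt f) y) (j : Fin 3) :
    fderiv ℝ (radialExt f) y (rotGen j y) = radialExt (rotD j f) y := by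
  rw [radialExt_eq _ hy, rotD, proj_coe_eq hy, map_smul, ← proj_coe_eq hy,
    fderiv_radialExt_proj hy hf]

/-- The differential of a radial extension in terms of the rotational derivatives. -/
theorem fderiv_radialExt {f : S2 → ℝ} {y : E3} (hy : y ≠ 0)
    (hf : DifferentiableAt ℝ (radialExt f) y) (v : E3) :
    fderiv ℝ (radialExt f) y v
      = ∑ j, (‖y‖ ^ 2)⁻¹ * radialExt (rotD j f) y * inner ℝ (rotGen j y) v := by
  have hn : 0 < ‖y‖ := norm_pos_iff.2 hy
  -- The differential is applied to the resolution of the tangential projection; the radial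
  -- component is killed by homogeneity.
  have h := congrArg (fderiv ℝ (radialExt f) y) (sum_inner_rotGen_smul y v)
  simp only [map_sum, map_smul, map_sub, fderiv_radialExt_self hy hf,
    fderiv_radialExt_rotGen hy hf, smul_eq_mul, mul_zero, sub_zero] at h
  have h2 : fderiv ℝ (radialExt f) y v = (‖y‖ ^ 2)⁻¹ * (‖y‖ ^ 2 * fderiv ℝ (radialExt f) y v) := by
    field_simp
  rw [h2, ← h, Finset.mul_sum]
  exact Finset.sum_congr rfl fun j _ => by ring

theorem sphereGrad_eq {f : S2 → ℝ} (hf : SmoothS2 f) (x : S2) :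
    sphereGrad f x = ∑ j, rotD j f x • rotGen j x := by
  apply ext_inner_right ℝ
  intro v
  rw [sphereGrad, gradient, InnerProductSpace.toDual_symm_apply,
    fderiv_radialExt (coe_ne_zero x) (hf.differentiableAt (coe_ne_zero x)), sum_inner]
  refine Finset.sum_congr rfl fun j _ => ?_
  rw [radialExt_coe, norm_coe, real_inner_smul_left]; simp

theorem along_eq {f : S2 → ℝ} (hf : SmoothS2 f) (V : S2 → E3) (x : S2) :
    along V f x = ∑ j, inner ℝ (V x) (rotGen j x) * rotD j f x := by
  rw [along, sphereGrad_eq hf, inner_sum]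
  exact Finset.sum_congr rfl fun j _ => by rw [real_inner_smul_right]; ring

theorem trace_E3 (T : E3 →ₗ[ℝ] E3) :
    LinearMap.trace ℝ E3 T = ∑ i, T (EuclideanSpace.single i 1) i := by
  rw [LinearMap.trace_eq_sum_inner T (EuclideanSpace.basisFun (Fin 3) ℝ)]
  simp [EuclideanSpace.inner_single_left]

theorem sum_single_E3 (v : E3) : ∑ i, v i • EuclideanSpace.single i (1 : ℝ) = v := by
  ext i; fin_cases i <;> simp [Fin.sum_univ_three]

/-- The rotation fields are divergence-free, so only the derivatives of the coefficients along them
contribute. -/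
theorem sphereDiv_sum_rotGen {g : Fin 3 → S2 → ℝ} (hg : ∀ j, SmoothS2 (g j)) (x : S2) :
    sphereDiv (fun z => ∑ j, g j z • rotGen j z) x = ∑ j, rotD j (g j) x := by
  have hx := coe_ne_zero x
  -- Since `rotGen j` is linear, the field constant along rays is `rotGen j y` divided by ‖y‖. The
  -- derivative of the norm adds nothing to the trace, because the field is orthogonal to the
  -- radius.
  have h1 : HasFDerivAt (fun y : E3 => ∑ j, (radialExt (g j) y * ‖y‖⁻¹) • rotGen j y)
      (∑ j, ((radialExt (g j) x * ‖(x : E3)‖⁻¹) • rotGen j +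
        ((radialExt (g j) x • -((‖(x : E3)‖ ^ 2)⁻¹ • (‖(x : E3)‖⁻¹ • innerSL ℝ (x : E3)))
          + ‖(x : E3)‖⁻¹ • fderiv ℝ (radialExt (g j)) x)).smulRight (rotGen j x))) (x : E3) := by
    have hnorm : HasFDerivAt (fun y : E3 => ‖y‖) (‖(x : E3)‖⁻¹ • innerSL ℝ (x : E3)) (x : E3) := by
      have := (hasStrictFDerivAt_norm_sq (x : E3)).hasFDerivAt.sqrt (by simp)
      simp only [norm_nonneg, Real.sqrt_sq] at this
      exact this.congr_fderiv (by ext v; simp)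
    have hinv : HasFDerivAt (fun y : E3 => ‖y‖⁻¹)
        (-((‖(x : E3)‖ ^ 2)⁻¹ • (‖(x : E3)‖⁻¹ • innerSL ℝ (x : E3)))) (x : E3) := by
      have := (hasDerivAt_inv (norm_ne_zero_iff.2 hx)).comp_hasFDerivAt (x : E3) hnorm
      exact this.congr_fderiv (by ext v; simp)
    refine HasFDerivAt.fun_sum fun j _ => ?_
    exact (((hg j).differentiableAt hx).hasFDerivAt.mul hinv).smul (rotGen j).hasFDerivAt
  have h2 := h1.congr_of_eventuallyEq (f₁ := radialExt fun z : S2 => ∑ j, g j z • rotGen j z) <| by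
    filter_upwards [isOpen_compl_singleton.mem_nhds hx] with y hy
    rw [radialExt_eq _ hy]
    refine Finset.sum_congr rfl fun j _ => ?_
    rw [radialExt_eq _ hy, proj_coe_eq hy, map_smul, smul_smul]
  rw [sphereDiv, h2.fderiv, trace_E3]
  simp only [norm_coe, radialExt_coe, ContinuousLinearMap.coe_coe, rotD]
  have h3 : ∀ j, fderiv ℝ (radialExt (g j)) x (rotGen j x)
      = ∑ i, rotGen j x i * fderiv ℝ (radialExt (g j)) x (EuclideanSpace.single i 1) := by
    intro j
    conv_lhs => rw [← sum_single_E3 (rotGen j x)]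
    simp
  simp only [h3]
  have h4 : ∀ i : Fin 3, (inner ℝ (x : E3) (EuclideanSpace.single i (1 : ℝ)) : ℝ) = (x : E3) i := by
    intro i; rw [inner_E3]; fin_cases i <;> simp
  simp [Fin.sum_univ_three, h4, rotGen_apply]
  ring

theorem SmoothS2.mul {f g : S2 → ℝ} (hf : SmoothS2 f) (hg : SmoothS2 g) :
    SmoothS2 fun x => f x * g x := ContMDiff.mul hf hg

theorem SmoothS2.add {f g : S2 → ℝ} (hf : SmoothS2 f) (hg : SmoothS2 g) :
    SmoothS2 fun x => f x + g x := ContMDiff.add hf hg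

theorem contDiff_rotGen (j : Fin 3) : ContDiff ℝ ∞ (rotGen j) := (rotGen j).contDiff

theorem SmoothS2.rotD {f : S2 → ℝ} (hf : SmoothS2 f) (j : Fin 3) : SmoothS2 (rotD j f) := by
  have h1 : ContDiffOn ℝ ∞ (fun y => fderiv ℝ (radialExt f) y (rotGen j y)) {0}ᶜ := by
    have := hf.contDiffOn.fderiv_of_isOpen (m := ∞) isOpen_compl_singleton (by simp)
    exact this.clm_apply (contDiff_rotGen j).contDiffOn
  have h2 := h1.contMDiffOn.comp contMDiff_coe_S2.contMDiffOn (s := univ) (fun x _ => coe_ne_zero x)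
  rw [contMDiffOn_univ] at h2
  exact h2

/-- The gradient has components L_j f in the frame of rotation fields, and these fields are
divergence-free: the Laplacian is the Casimir element of the rotation algebra. -/
theorem sphereLaplacian_eq {f : S2 → ℝ} (hf : SmoothS2 f) (x : S2) :
    sphereLaplacian f x = ∑ j, rotD j (rotD j f) x := by
  rw [sphereLaplacian, ← sphereDiv_sum_rotGen (fun j => hf.rotD j)]
  congr 1
  funext z
  exact sphereGrad_eq hf z

/-- The derivative `∂_s` of a function on the hyperboloid. -/
def dS (lam : ℝ → S2 → ℝ) (s : ℝ) (x : S2) : ℝ := deriv (fun σ => lam σ x) s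

theorem hasDerivAt_of_smoothHyp {lam : ℝ → S2 → ℝ} (h : SmoothHyp lam) {s : ℝ}
    (hs : s ∈ Ioo (-1 : ℝ) 1) (x : S2) : HasDerivAt (fun σ => lam σ x) (dS lam s x) s := by
  have h1 := (h.differentiableAt (coe_mem_flatDom hs x)).hasFDerivAt
  have h2 : HasDerivAt (fun σ : ℝ => (σ, (x : E3))) ((1 : ℝ), (0 : E3)) s :=
    (hasDerivAt_id s).prodMk (hasDerivAt_const s (x : E3))
  have h3 := h1.comp_hasDerivAt s h2
  simp only [Function.comp_def, flatExt_coe] at h3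
  exact h3.differentiableAt.hasDerivAt

theorem fderiv_flatExt_fst {lam : ℝ → S2 → ℝ} (h : SmoothHyp lam) {p : ℝ × E3}
    (hp : p ∈ flatDom) : fderiv ℝ (flatExt lam) p (1, 0) = flatExt (dS lam) p := by
  have h1 := (h.differentiableAt hp).hasFDerivAt
  have h2 : HasDerivAt (fun σ : ℝ => (σ, p.2)) ((1 : ℝ), (0 : E3)) p.1 :=
    (hasDerivAt_id p.1).prodMk (hasDerivAt_const p.1 p.2)
  have h3 := HasFDerivAt.comp_hasDerivAt p.1 (f := fun σ : ℝ => (σ, p.2)) h1 h2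
  rw [flatExt_eq _ hp.2, dS, ← h3.deriv]
  congr 1
  funext σ
  exact flatExt_eq lam (p := (σ, p.2)) hp.2

theorem fderiv_flatExt_snd {lam : ℝ → S2 → ℝ} (h : SmoothHyp lam) {p : ℝ × E3}
    (hp : p ∈ flatDom) (v : E3) :
    fderiv ℝ (flatExt lam) p (0, v) = fderiv ℝ (radialExt (lam p.1)) p.2 v := by
  have h1 := (h.differentiableAt hp).hasFDerivAt
  have h2 : HasFDerivAt (fun y : E3 => (p.1, y)) (ContinuousLinearMap.inr ℝ ℝ E3) p.2 :=
    hasFDerivAt_prodMk_right p.1 p.2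
  have h3 := HasFDerivAt.comp p.2 (f := fun y : E3 => (p.1, y)) h1 h2
  rw [show radialExt (lam p.1) = flatExt lam ∘ fun y : E3 => (p.1, y) from rfl, h3.fderiv]
  rfl

theorem fderiv_flatExt {lam : ℝ → S2 → ℝ} (h : SmoothHyp lam) {p : ℝ × E3}
    (hp : p ∈ flatDom) (v : ℝ × E3) :
    fderiv ℝ (flatExt lam) p v = v.1 * flatExt (dS lam) p
      + ∑ j, (‖p.2‖ ^ 2)⁻¹ * flatExt (fun s => rotD j (lam s)) p * inner ℝ (rotGen j p.2) v.2 := by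
  have : v = v.1 • ((1 : ℝ), (0 : E3)) + (0, v.2) := by ext <;> simp
  conv_lhs => rw [this]
  rw [map_add, map_smul, fderiv_flatExt_fst h hp, fderiv_flatExt_snd h hp,
    fderiv_radialExt hp.2 ((h.slice hp.1).differentiableAt hp.2)]
  rfl

theorem SmoothHyp.dS {lam : ℝ → S2 → ℝ} (h : SmoothHyp lam) : SmoothHyp (dS lam) := by
  rw [smoothHyp_iff]
  have h1 := (smoothHyp_iff.1 h).fderiv_of_isOpen (m := ∞) isOpen_flatDom (by simp)
  have h2 := h1.clm_apply (contDiffOn_const (c := ((1 : ℝ), (0 : E3))))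
  exact h2.congr fun p hp => (fderiv_flatExt_fst h hp).symm

theorem SmoothHyp.rotD {lam : ℝ → S2 → ℝ} (h : SmoothHyp lam) (j : Fin 3) :
    SmoothHyp fun s => rotD j (lam s) := by
  rw [smoothHyp_iff]
  have h1 := (smoothHyp_iff.1 h).fderiv_of_isOpen (m := ∞) isOpen_flatDom (by simp)
  have h3 : ContDiffOn ℝ ∞ (fun p : ℝ × E3 => ((0 : ℝ), rotGen j p.2)) flatDom :=
    (contDiff_const.prodMk ((contDiff_rotGen j).comp contDiff_snd)).contDiffOn
  refine (h1.clm_apply h3).congr fun p hp => ?_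
  rw [fderiv_flatExt_snd h hp, fderiv_radialExt_rotGen hp.2 ((h.slice hp.1).differentiableAt hp.2)]
  rfl

/-- `∂_s` and the rotational derivatives commute. -/
theorem dS_rotD {lam : ℝ → S2 → ℝ} (h : SmoothHyp lam) (j : Fin 3) {s : ℝ}
    (hs : s ∈ Ioo (-1 : ℝ) 1) (x : S2) :
    dS (fun s => rotD j (lam s)) s x = rotD j (dS lam s) x := by
  have hp := coe_mem_flatDom hs x
  -- Both sides are values of the second derivative of the extension on (1, 0) and (0, e_j × x), in
  -- the two orders. There are no first-order corrections: the first vector is constant and the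
  -- second does not depend on s.
  have hsymm := (h.contDiffAt hp).isSymmSndFDerivAt (by
    rw [minSmoothness_of_isRCLikeNormedField]; exact WithTop.coe_le_coe.2 le_top)
  obtain ⟨F, hF⟩ : ∃ F, F = fderiv ℝ (flatExt lam) := ⟨_, rfl⟩
  obtain ⟨D, hD⟩ : ∃ D, D = fderiv ℝ (fderiv ℝ (flatExt lam)) (s, (x : E3)) := ⟨_, rfl⟩
  have hd : HasFDerivAt F D (s, (x : E3)) := by
    rw [hF, hD]
    exact (((h.contDiffAt hp).fderiv_right (m := ∞) (by simp)).differentiableAt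
      (by simp)).hasFDerivAt
  have h1 : dS (fun s => rotD j (lam s)) s x = D (1, 0) (0, rotGen j x) := by
    have e1 : HasDerivAt (fun σ : ℝ => (σ, (x : E3))) ((1 : ℝ), (0 : E3)) s :=
      (hasDerivAt_id s).prodMk (hasDerivAt_const s (x : E3))
    have e2 : HasDerivAt (fun σ : ℝ => F (σ, (x : E3))) (D (1, 0)) s := hd.comp_hasDerivAt s e1
    have e3 : HasDerivAt (fun σ : ℝ => F (σ, (x : E3)) (0, rotGen j x))
        (D (1, 0) (0, rotGen j x)) s := by
      simpa using e2.clm_apply (hasDerivAt_const s ((0 : ℝ), rotGen j (x : E3)))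
    refine (e3.congr_of_eventuallyEq ?_).deriv
    filter_upwards [isOpen_Ioo.mem_nhds hs] with σ hσ
    rw [hF, fderiv_flatExt_snd h (coe_mem_flatDom hσ x)]
    rfl
  have h2 : rotD j (dS lam s) x = D (0, rotGen j x) (1, 0) := by
    have e1 : HasFDerivAt (fun y : E3 => (s, y)) (ContinuousLinearMap.inr ℝ ℝ E3) (x : E3) :=
      hasFDerivAt_prodMk_right s (x : E3)
    have e2 : HasFDerivAt (fun y : E3 => F (s, y)) (D.comp (ContinuousLinearMap.inr ℝ ℝ E3))
      (x : E3) := HasFDerivAt.comp (x : E3) hd e1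
    have e3 := e2.clm_apply (hasFDerivAt_const ((1 : ℝ), (0 : E3)) (x : E3))
    have e4 := e3.congr_of_eventuallyEq (f₁ := radialExt (dS lam s)) (by
      filter_upwards [isOpen_compl_singleton.mem_nhds (coe_ne_zero x)] with y hy
      rw [hF, fderiv_flatExt_fst h (p := (s, y)) ⟨hs, hy⟩]
      rfl)
    rw [rotD, e4.fderiv]
    simp
  rw [h1, h2, hD]
  exact hsymm _ _

/-! ### Algebra of the rotational derivatives -/

theorem rotD_congr {f g : S2 → ℝ} (h : ∀ x, f x = g x) (j : Fin 3) (x : S2) :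
    rotD j f x = rotD j g x := by rw [funext h]

/-- The differential of the normalization y ↦ y/‖y‖ at a point of the sphere fixes tangent vectors.
Hence any differentiable extension may replace the radial one when differentiating along rotations.
-/
theorem rotD_of_hasFDerivAt {f : S2 → ℝ} {G : E3 → ℝ} {G' : E3 →L[ℝ] ℝ}
    (hG : ∀ x : S2, f x = G x) (j : Fin 3) {x : S2} (hd : HasFDerivAt G G' (x : E3)) :
    rotD j f x = G' (rotGen j x) := by
  have hx := coe_ne_zero x
  have hn : HasFDerivAt (fun y : E3 => ‖y‖⁻¹ • y)
      (‖(x : E3)‖⁻¹ • ContinuousLinearMap.id ℝ E3 +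
        (fderiv ℝ (fun y : E3 => ‖y‖⁻¹) (x : E3)).smulRight (x : E3)) (x : E3) := by
    have := (((contDiffAt_norm ℝ hx).inv (norm_ne_zero_iff.2 hx)).differentiableAt
      (by simp : (1 : WithTop ℕ∞) ≠ 0)).hasFDerivAt.smul (hasFDerivAt_id (x : E3))
    exact this
  have h0 : fderiv ℝ (fun y : E3 => ‖y‖⁻¹) (x : E3) (rotGen j x) = 0 := by
    have e1 : HasFDerivAt (fun y : E3 => (‖y‖ ^ 2)) (2 • innerSL ℝ (x : E3)) (x : E3) :=
      (hasStrictFDerivAt_norm_sq (x : E3)).hasFDerivAt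
    have e2 := e1.sqrt (by simp)
    simp only [norm_nonneg, Real.sqrt_sq] at e2
    have e3 := (hasDerivAt_inv (norm_ne_zero_iff.2 hx)).comp_hasFDerivAt (x : E3) e2
    have e4 : (fun y : E3 => ‖y‖⁻¹) = (fun y => y⁻¹) ∘ norm := rfl
    rw [e4, e3.fderiv]
    simp [inner_rotGen_self]
  have hx1 : ‖(x : E3)‖⁻¹ • (x : E3) = x := by simp
  have h1 : HasFDerivAt (fun y : E3 => G (‖y‖⁻¹ • y)) _ (x : E3) :=
    HasFDerivAt.comp (x : E3) (g := G) (f := fun y : E3 => ‖y‖⁻¹ • y) (by rw [hx1]; exact hd) hn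
  have h2 := h1.congr_of_eventuallyEq (f₁ := radialExt f) (by
    filter_upwards [isOpen_compl_singleton.mem_nhds hx] with y hy
    rw [radialExt_eq _ hy, hG, proj_coe_eq hy])
  rw [rotD, h2.fderiv]
  simp [h0]

theorem rotD_add {f g : S2 → ℝ} (hf : SmoothS2 f) (hg : SmoothS2 g) (j : Fin 3) (x : S2) :
    rotD j (fun x => f x + g x) x = rotD j f x + rotD j g x := by
  have hx := coe_ne_zero x
  rw [rotD_of_hasFDerivAt (fun z => by rw [← radialExt_coe f, ← radialExt_coe g]; rfl) j
    ((hf.differentiableAt hx).hasFDerivAt.add (hg.differentiableAt hx).hasFDerivAt)]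
  rfl

theorem smoothS2_const (c : ℝ) : SmoothS2 fun _ => c := contMDiff_const

theorem rotD_mul {f g : S2 → ℝ} (hf : SmoothS2 f) (hg : SmoothS2 g) (j : Fin 3) (x : S2) :
    rotD j (fun x => f x * g x) x = f x * rotD j g x + g x * rotD j f x := by
  have hx := coe_ne_zero x
  rw [rotD_of_hasFDerivAt (fun z => by rw [← radialExt_coe f, ← radialExt_coe g]; rfl) j
    ((hf.differentiableAt hx).hasFDerivAt.mul (hg.differentiableAt hx).hasFDerivAt)]
  simp [rotD, radialExt_coe]

theorem rotD_const (c : ℝ) (j : Fin 3) (x : S2) : rotD j (fun _ => c) x = 0 := by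
  rw [rotD_of_hasFDerivAt (G := fun _ => c) (fun z => rfl) j
    (hasFDerivAt_const c (x : E3))]
  simp

theorem rotD_const_mul {f : S2 → ℝ} (hf : SmoothS2 f) (c : ℝ) (j : Fin 3) (x : S2) :
    rotD j (fun x => c * f x) x = c * rotD j f x := by
  rw [rotD_mul (smoothS2_const c) hf, rotD_const]; ring

theorem SmoothS2.const_mul {f : S2 → ℝ} (hf : SmoothS2 f) (c : ℝ) : SmoothS2 fun x => c * f x :=
  (smoothS2_const c).mul hf

theorem rotD_sq {f : S2 → ℝ} (hf : SmoothS2 f) (j : Fin 3) (x : S2) :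
    rotD j (fun x => f x ^ 2) x = 2 * f x * rotD j f x := by
  have : (fun x => f x ^ 2) = fun x => f x * f x := by funext x; ring
  rw [this, rotD_mul hf hf]; ring

theorem smoothS2_sum {ι : Type*} {t : Finset ι} {f : ι → S2 → ℝ} (h : ∀ i ∈ t, SmoothS2 (f i)) :
    SmoothS2 fun x => ∑ i ∈ t, f i x := by
  classical
  induction t using Finset.induction_on with
  | empty => simpa using smoothS2_const 0
  | insert a t ha ih =>
    simp only [Finset.sum_insert ha]
    exact (h a (by simp)).add (ih fun i hi => h i (by simp [hi]))

theorem rotD_sum {ι : Type*} {t : Finset ι} {f : ι → S2 → ℝ} (h : ∀ i ∈ t, SmoothS2 (f i))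
    (j : Fin 3) (x : S2) :
    rotD j (fun x => ∑ i ∈ t, f i x) x = ∑ i ∈ t, rotD j (f i) x := by
  classical
  induction t using Finset.induction_on with
  | empty => simpa using rotD_const 0 j x
  | insert a t ha ih =>
    simp only [Finset.sum_insert ha]
    rw [rotD_add (h a (by simp)) (smoothS2_sum fun i hi => h i (by simp [hi])),
      ih fun i hi => h i (by simp [hi])]

/-- A smooth function with vanishing rotational derivatives is constant. -/
theorem eq_of_rotD_eq_zero {f : S2 → ℝ} (hf : SmoothS2 f) (h : ∀ j x, rotD j f x = 0) (x y : S2) :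
    f x = f y := by
  have hU : IsOpen ({0}ᶜ : Set E3) := isOpen_compl_singleton
  have hconn : IsPreconnected ({0}ᶜ : Set E3) := by
    have : 1 < Module.rank ℝ E3 := by
      rw [← Module.finrank_eq_rank, finrank_euclideanSpace_fin]; norm_num
    exact (isConnected_compl_singleton_of_one_lt_rank this 0).isPreconnected
  have := hU.is_const_of_fderiv_eq_zero hconn (f := radialExt f)
    (fun y hy => (hf.differentiableAt hy).differentiableWithinAt) (fun y hy => by
      ext v
      rw [fderiv_radialExt hy (hf.differentiableAt hy)]
      simp [radialExt_eq _ hy, h]) (coe_ne_zero x) (coe_ne_zero y)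
  simpa [radialExt_coe] using this

/-! ### Spherical harmonics and the ladder relations -/

/-- `Re (x₁ + i x₂)^k`. -/
def cosPart (k : ℕ) (y : E3) : ℝ := (((y 0 : ℂ) + (y 1 : ℂ) * Complex.I) ^ k).re

/-- `Im (x₁ + i x₂)^k`. -/
def sinPart (k : ℕ) (y : E3) : ℝ := (((y 0 : ℂ) + (y 1 : ℂ) * Complex.I) ^ k).im

theorem cosPart_zero (y : E3) : cosPart 0 y = 1 := by simp [cosPart]
theorem sinPart_zero (y : E3) : sinPart 0 y = 0 := by simp [sinPart]

theorem cosPart_succ (k : ℕ) (y : E3) :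
    cosPart (k + 1) y = y 0 * cosPart k y - y 1 * sinPart k y := by
  simp [cosPart, sinPart, pow_succ]; ring

theorem sinPart_succ (k : ℕ) (y : E3) :
    sinPart (k + 1) y = y 0 * sinPart k y + y 1 * cosPart k y := by
  simp [cosPart, sinPart, pow_succ]; ring

theorem hasFDerivAt_coord (i : Fin 3) (y : E3) :
    HasFDerivAt (fun y : E3 => y i) (EuclideanSpace.proj i : E3 →L[ℝ] ℝ) y :=
  (EuclideanSpace.proj i : E3 →L[ℝ] ℝ).hasFDerivAt

theorem hasFDerivAt_cosPart_sinPart (k : ℕ) (y : E3) :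
    HasFDerivAt (cosPart (k + 1)) (((k : ℝ) + 1) • (cosPart k y • (EuclideanSpace.proj 0 : E3 →L[ℝ] ℝ)
        - sinPart k y • (EuclideanSpace.proj 1 : E3 →L[ℝ] ℝ))) y ∧
      HasFDerivAt (sinPart (k + 1)) (((k : ℝ) + 1) • (cosPart k y • (EuclideanSpace.proj 1 : E3 →L[ℝ] ℝ)
        + sinPart k y • (EuclideanSpace.proj 0 : E3 →L[ℝ] ℝ))) y := by
  induction k with
  | zero =>
    have h1 : cosPart 1 = fun y => y 0 := by
      funext y; rw [cosPart_succ, cosPart_zero, sinPart_zero]; ring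
    have h2 : sinPart 1 = fun y => y 1 := by
      funext y; rw [sinPart_succ, cosPart_zero, sinPart_zero]; ring
    simpa [h1, h2, cosPart_zero, sinPart_zero] using
      And.intro (hasFDerivAt_coord 0 y) (hasFDerivAt_coord 1 y)
  | succ k ih =>
    obtain ⟨h1, h2⟩ := ih
    have e1 : cosPart (k + 2) = fun y => y 0 * cosPart (k + 1) y - y 1 * sinPart (k + 1) y :=
      funext (cosPart_succ (k + 1))
    have e2 : sinPart (k + 2) = fun y => y 0 * sinPart (k + 1) y + y 1 * cosPart (k + 1) y :=
      funext (sinPart_succ (k + 1))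
    constructor
    · rw [e1]
      refine (((hasFDerivAt_coord 0 y).mul h1).sub ((hasFDerivAt_coord 1 y).mul h2)).congr_fderiv ?_
      ext v
      simp [cosPart_succ k, sinPart_succ k]
      ring
    · rw [e2]
      refine (((hasFDerivAt_coord 0 y).mul h2).add ((hasFDerivAt_coord 1 y).mul h1)).congr_fderiv ?_
      ext v
      simp [cosPart_succ k, sinPart_succ k]
      ring

theorem contDiff_coord (i : Fin 3) : ContDiff ℝ ∞ fun y : E3 => y i :=
  (EuclideanSpace.proj i : E3 →L[ℝ] ℝ).contDiff

theorem contDiff_cosPart_sinPart (k : ℕ) :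
    ContDiff ℝ ∞ (cosPart k) ∧ ContDiff ℝ ∞ (sinPart k) := by
  induction k with
  | zero =>
    rw [show cosPart 0 = fun _ => 1 from funext cosPart_zero,
      show sinPart 0 = fun _ => 0 from funext sinPart_zero]
    exact ⟨contDiff_const, contDiff_const⟩
  | succ k ih =>
    rw [show cosPart (k + 1) = _ from funext (cosPart_succ k),
      show sinPart (k + 1) = _ from funext (sinPart_succ k)]
    exact ⟨((contDiff_coord 0).mul ih.1).sub ((contDiff_coord 1).mul ih.2),
      ((contDiff_coord 0).mul ih.2).add ((contDiff_coord 1).mul ih.1)⟩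

theorem contDiff_polynomial_coord (p : Polynomial ℝ) : ContDiff ℝ ∞ fun y : E3 => p.eval (y 2) :=
  (contDiff_polynomial_eval p).comp (contDiff_coord 2)

theorem hasFDerivAt_polynomial_coord (p : Polynomial ℝ) (y : E3) :
    HasFDerivAt (fun y : E3 => p.eval (y 2))
      (p.derivative.eval (y 2) • (EuclideanSpace.proj 2 : E3 →L[ℝ] ℝ)) y :=
  HasDerivAt.comp_hasFDerivAt (f := fun y : E3 => y 2) y (p.hasDerivAt (y 2))
    (hasFDerivAt_coord 2 y)

theorem smoothS2_polyCos (p : Polynomial ℝ) (k : ℕ) :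
    SmoothS2 fun x => p.eval ((x : E3) 2) * cosPart k x :=
  smoothS2_of_contDiff (G := fun y => p.eval (y 2) * cosPart k y)
    ((contDiff_polynomial_coord p).mul (contDiff_cosPart_sinPart k).1)

theorem smoothS2_polySin (p : Polynomial ℝ) (k : ℕ) :
    SmoothS2 fun x => p.eval ((x : E3) 2) * sinPart k x :=
  smoothS2_of_contDiff (G := fun y => p.eval (y 2) * sinPart k y)
    ((contDiff_polynomial_coord p).mul (contDiff_cosPart_sinPart k).2)

theorem sphere_eq (x : S2) : (x : E3) 0 ^ 2 + (x : E3) 1 ^ 2 + (x : E3) 2 ^ 2 = 1 := by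
  rw [← norm_sq_E3, norm_coe]; norm_num

section
variable (p : Polynomial ℝ) (k : ℕ) (x : S2)

theorem rotD_polyCos_zero (j : Fin 3) :
    rotD j (fun x => p.eval ((x : E3) 2) * cosPart 0 x) x
      = p.derivative.eval ((x : E3) 2) * rotGen j x 2 := by
  rw [rotD_of_hasFDerivAt (G := fun y => p.eval (y 2)) (fun x => by simp [cosPart_zero]) j
    (hasFDerivAt_polynomial_coord p x)]
  simp

theorem rotD_polyCos_succ (j : Fin 3) :
    rotD j (fun x => p.eval ((x : E3) 2) * cosPart (k + 1) x) x
      = p.derivative.eval ((x : E3) 2) * rotGen j x 2 * cosPart (k + 1) x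
        + p.eval ((x : E3) 2) * ((k + 1) * (cosPart k x * rotGen j x 0 - sinPart k x * rotGen j x 1)) := by
  rw [rotD_of_hasFDerivAt (G := fun y => p.eval (y 2) * cosPart (k + 1) y) (fun x => rfl) j
    ((hasFDerivAt_polynomial_coord p x).mul (hasFDerivAt_cosPart_sinPart k x).1)]
  simp
  ring

theorem rotD_polySin_succ (j : Fin 3) :
    rotD j (fun x => p.eval ((x : E3) 2) * sinPart (k + 1) x) x
      = p.derivative.eval ((x : E3) 2) * rotGen j x 2 * sinPart (k + 1) x
        + p.eval ((x : E3) 2) * ((k + 1) * (cosPart k x * rotGen j x 1 + sinPart k x * rotGen j x 0)) := by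
  rw [rotD_of_hasFDerivAt (G := fun y => p.eval (y 2) * sinPart (k + 1) y) (fun x => rfl) j
    ((hasFDerivAt_polynomial_coord p x).mul (hasFDerivAt_cosPart_sinPart k x).2)]
  simp
  ring

/-- The factor produced by the lowering operators. -/
def lowerFactor (z : ℝ) : ℝ :=
  -(1 - z ^ 2) * p.derivative.eval z + 2 * (k + 1) * z * p.eval z

/-- With x₁² + x₂² = 1 - x₃² on the sphere, the derivative splits into a part raising the order with
p' and a part lowering it with `lowerFactor`. The three variants that follow use the same splitting.
-/
theorem rotD_one_polyCos_succ :
    rotD 1 (fun x => p.eval ((x : E3) 2) * cosPart (k + 1) x) x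
      = 1 / 2 * (-(p.derivative.eval ((x : E3) 2) * cosPart (k + 2) x)
        + lowerFactor p k ((x : E3) 2) * cosPart k x) := by
  have h := sphere_eq x
  rw [rotD_polyCos_succ, lowerFactor, cosPart_succ (k + 1), cosPart_succ k, sinPart_succ k]
  simp [rotGen_apply]
  linear_combination (-1 / 2 * cosPart k x * p.derivative.eval ((x : E3) 2)) * h

theorem rotD_one_polySin_succ :
    rotD 1 (fun x => p.eval ((x : E3) 2) * sinPart (k + 1) x) x
      = 1 / 2 * (-(p.derivative.eval ((x : E3) 2) * sinPart (k + 2) x)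
        + lowerFactor p k ((x : E3) 2) * sinPart k x) := by
  have h := sphere_eq x
  rw [rotD_polySin_succ, lowerFactor, sinPart_succ (k + 1), cosPart_succ k, sinPart_succ k]
  simp [rotGen_apply]
  linear_combination (-1 / 2 * sinPart k x * p.derivative.eval ((x : E3) 2)) * h

theorem rotD_zero_polyCos_succ :
    rotD 0 (fun x => p.eval ((x : E3) 2) * cosPart (k + 1) x) x
      = 1 / 2 * (p.derivative.eval ((x : E3) 2) * sinPart (k + 2) x
        + lowerFactor p k ((x : E3) 2) * sinPart k x) := by
  have h := sphere_eq x
  rw [rotD_polyCos_succ, lowerFactor, sinPart_succ (k + 1), cosPart_succ k, sinPart_succ k]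
  simp [rotGen_apply]
  linear_combination (-1 / 2 * sinPart k x * p.derivative.eval ((x : E3) 2)) * h

theorem rotD_zero_polySin_succ :
    rotD 0 (fun x => p.eval ((x : E3) 2) * sinPart (k + 1) x) x
      = -(1 / 2) * (p.derivative.eval ((x : E3) 2) * cosPart (k + 2) x
        + lowerFactor p k ((x : E3) 2) * cosPart k x) := by
  have h := sphere_eq x
  rw [rotD_polySin_succ, lowerFactor, cosPart_succ (k + 1), cosPart_succ k, sinPart_succ k]
  simp [rotGen_apply]
  linear_combination (1 / 2 * cosPart k x * p.derivative.eval ((x : E3) 2)) * h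

theorem rotD_two_polyCos_succ :
    rotD 2 (fun x => p.eval ((x : E3) 2) * cosPart (k + 1) x) x
      = -((k : ℝ) + 1) * (p.eval ((x : E3) 2) * sinPart (k + 1) x) := by
  rw [rotD_polyCos_succ, sinPart_succ k]
  simp [rotGen_apply]
  ring

theorem rotD_two_polySin_succ :
    rotD 2 (fun x => p.eval ((x : E3) 2) * sinPart (k + 1) x) x
      = ((k : ℝ) + 1) * (p.eval ((x : E3) 2) * cosPart (k + 1) x) := by
  rw [rotD_polySin_succ, cosPart_succ k]
  simp [rotGen_apply]
  ring

end

/-- The normalization of the spherical harmonics. -/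
def harmNorm (l k : ℕ) : ℝ :=
  Real.sqrt ((2 * (l : ℝ) + 1) / (4 * Real.pi)
      * (((l - k).factorial : ℝ) / ((l + k).factorial : ℝ)))

/-- The `k`-th derivative of `P_l`, normalized. -/
def harmPoly (l k : ℕ) : Polynomial ℝ :=
  Polynomial.C (harmNorm l k) * Polynomial.derivative^[k] (legendreP l)

/-- The ladder coefficient `√((l - k)(l + k + 1))`. -/
def ladder (l : ℕ) (k : ℤ) : ℝ := Real.sqrt (((l : ℝ) - k) * (l + k + 1))

theorem harmNorm_eq {l k : ℕ} (h : k < l) : harmNorm l k = ladder l k * harmNorm l (k + 1) := by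
  have hk : (k : ℝ) + 1 ≤ l := by exact_mod_cast h
  rw [harmNorm, harmNorm, ladder, ← Real.sqrt_mul]
  · congr 1
    obtain ⟨n, rfl⟩ : ∃ n, l = k + 1 + n := ⟨l - (k + 1), by omega⟩
    rw [show k + 1 + n - k = n + 1 by omega, show k + 1 + n - (k + 1) = n by omega,
      show k + 1 + n + (k + 1) = (k + 1 + n + k) + 1 by ring, Nat.factorial_succ, Nat.factorial_succ]
    have h1 : ((k + 1 + n + k).factorial : ℝ) ≠ 0 := Nat.cast_ne_zero.2 (Nat.factorial_ne_zero _)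
    have h2 : ((k : ℝ) + 1 + n + k + 1) ≠ 0 := by positivity
    push_cast
    field_simp
    ring
  · push_cast
    exact mul_nonneg (by linarith) (by positivity)

theorem ladder_sq {l k : ℕ} (h : k ≤ l) : ladder l k ^ 2 = ((l : ℝ) - k) * (l + k + 1) := by
  have hk : (k : ℝ) ≤ l := by exact_mod_cast h
  rw [ladder, Real.sq_sqrt]
  · push_cast; rfl
  · push_cast
    exact mul_nonneg (by linarith) (by positivity)

theorem ladder_self (l : ℕ) : ladder l l = 0 := by simp [ladder]

theorem harmPoly_eq_zero {l k : ℕ} (h : l < k) : harmPoly l k = 0 := by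
  rw [harmPoly, iterate_derivative_legendreP_eq_zero h, mul_zero]

theorem derivative_harmPoly (l k : ℕ) (z : ℝ) :
    (harmPoly l k).derivative.eval z = ladder l k * (harmPoly l (k + 1)).eval z := by
  rcases lt_or_ge k l with h | h
  · rw [harmPoly, harmPoly, Polynomial.derivative_C_mul, ← Function.iterate_succ_apply'
      Polynomial.derivative, harmNorm_eq h]
    simp only [Polynomial.eval_mul, Polynomial.eval_C]; ring
  · rw [harmPoly_eq_zero (show l < k + 1 by omega), harmPoly, Polynomial.derivative_C_mul,
      ← Function.iterate_succ_apply' Polynomial.derivative,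
      iterate_derivative_legendreP_eq_zero (show l < k.succ by omega)]
    simp

/-- The k-times differentiated Legendre equation says that lowering P_l^{(k+1)} returns (l-k)(l+k+1)
P_l^{(k)}. The normalization splits this factor symmetrically between raising and lowering, hence
the square root in `ladder`. -/
theorem lowerFactor_harmPoly (l k : ℕ) (z : ℝ) :
    lowerFactor (harmPoly l (k + 1)) k z = ladder l k * (harmPoly l k).eval z := by
  have h := congrArg (Polynomial.eval z) (legendreP_iterate_ode l k)
  simp only [Polynomial.eval_add, Polynomial.eval_sub, Polynomial.eval_mul, Polynomial.eval_pow,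
    Polynomial.eval_X, Polynomial.eval_one, Polynomial.eval_natCast, Polynomial.eval_zero,
    Polynomial.eval_ofNat] at h
  have h1 : lowerFactor (harmPoly l (k + 1)) k z = harmNorm l (k + 1) *
      (((l : ℝ) - k) * (l + k + 1) * (Polynomial.derivative^[k] (legendreP l)).eval z) := by
    rw [lowerFactor, harmPoly, Polynomial.derivative_C_mul,
      ← Function.iterate_succ_apply' Polynomial.derivative]
    simp only [Polynomial.eval_mul, Polynomial.eval_C]
    linear_combination -harmNorm l (k + 1) * h
  rw [h1, harmPoly, Polynomial.eval_mul, Polynomial.eval_C]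
  rcases lt_trichotomy k l with hk | rfl | hk
  · rw [harmNorm_eq hk, ← ladder_sq hk.le]; ring
  · rw [ladder_self]; ring
  · rw [iterate_derivative_legendreP_eq_zero hk]; simp

/-- Cosine-type harmonics, for nonnegative order. -/
def natC (l k : ℕ) (x : S2) : ℝ := (harmPoly l k).eval ((x : E3) 2) * cosPart k x

/-- Sine-type harmonics, for nonnegative order. -/
def natS (l k : ℕ) (x : S2) : ℝ := (harmPoly l k).eval ((x : E3) 2) * sinPart k x

theorem smoothS2_natC (l k : ℕ) : SmoothS2 (natC l k) := smoothS2_polyCos _ _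
theorem smoothS2_natS (l k : ℕ) : SmoothS2 (natS l k) := smoothS2_polySin _ _

theorem natS_zero (l : ℕ) (x : S2) : natS l 0 x = 0 := by simp [natS, sinPart_zero]

theorem natC_eq_zero {l k : ℕ} (h : l < k) (x : S2) : natC l k x = 0 := by
  simp [natC, harmPoly_eq_zero h]

theorem natS_eq_zero {l k : ℕ} (h : l < k) (x : S2) : natS l k x = 0 := by
  simp [natS, harmPoly_eq_zero h]

section
variable (l k : ℕ) (x : S2)

theorem rotD_one_natC_succ : rotD 1 (natC l (k + 1)) x
    = 1 / 2 * (-(ladder l (k + 1 : ℕ) * natC l (k + 2) x) + ladder l k * natC l k x) := by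
  rw [show natC l (k + 1) = fun x : S2 => _ from rfl]
  unfold natC
  rw [rotD_one_polyCos_succ, lowerFactor_harmPoly, derivative_harmPoly]; ring

theorem rotD_one_natS_succ : rotD 1 (natS l (k + 1)) x
    = 1 / 2 * (-(ladder l (k + 1 : ℕ) * natS l (k + 2) x) + ladder l k * natS l k x) := by
  unfold natS
  rw [rotD_one_polySin_succ, lowerFactor_harmPoly, derivative_harmPoly]; ring

theorem rotD_zero_natC_succ : rotD 0 (natC l (k + 1)) x
    = 1 / 2 * (ladder l (k + 1 : ℕ) * natS l (k + 2) x + ladder l k * natS l k x) := by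
  unfold natC natS
  rw [rotD_zero_polyCos_succ, lowerFactor_harmPoly, derivative_harmPoly]; ring

theorem rotD_zero_natS_succ : rotD 0 (natS l (k + 1)) x
    = -(1 / 2) * (ladder l (k + 1 : ℕ) * natC l (k + 2) x + ladder l k * natC l k x) := by
  unfold natC natS
  rw [rotD_zero_polySin_succ, lowerFactor_harmPoly, derivative_harmPoly]; ring

theorem rotD_one_natC_zero : rotD 1 (natC l 0) x = -(ladder l 0 * natC l 1 x) := by
  unfold natC
  rw [rotD_polyCos_zero, derivative_harmPoly, cosPart_succ, cosPart_zero, sinPart_zero]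
  simp [rotGen_apply]; ring

theorem rotD_zero_natC_zero : rotD 0 (natC l 0) x = ladder l 0 * natS l 1 x := by
  unfold natC natS
  rw [rotD_polyCos_zero, derivative_harmPoly, sinPart_succ, cosPart_zero, sinPart_zero]
  simp [rotGen_apply]; ring

theorem rotD_two_natC : rotD 2 (natC l k) x = -(k : ℝ) * natS l k x := by
  cases k with
  | zero =>
    unfold natC
    rw [rotD_polyCos_zero]; simp [rotGen_apply]
  | succ k => unfold natC natS; rw [rotD_two_polyCos_succ]; push_cast; rfl

theorem natS_zero_eq : natS l 0 = fun _ => 0 := funext (natS_zero l)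

theorem rotD_two_natS : rotD 2 (natS l k) x = (k : ℝ) * natC l k x := by
  cases k with
  | zero => rw [natS_zero_eq, rotD_const]; simp
  | succ k => unfold natC natS; rw [rotD_two_polySin_succ]; push_cast; rfl

end

/-- Cosine-type harmonics of any integral order, `C_{-k} = (-1)^k C_k`. -/
def harmC (l : ℕ) (k : ℤ) (x : S2) : ℝ :=
  if 0 ≤ k then natC l k.natAbs x else (-1) ^ k.natAbs * natC l k.natAbs x

/-- Sine-type harmonics of any integral order, `S_{-k} = -(-1)^k S_k`. -/
def harmS (l : ℕ) (k : ℤ) (x : S2) : ℝ :=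
  if 0 ≤ k then natS l k.natAbs x else -(-1) ^ k.natAbs * natS l k.natAbs x

theorem harmC_nat (l k : ℕ) : harmC l k = natC l k := by funext x; simp [harmC]
theorem harmS_nat (l k : ℕ) : harmS l k = natS l k := by funext x; simp [harmS]

theorem harmC_neg (l k : ℕ) : harmC l (-k) = fun x => (-1) ^ k * natC l k x := by
  funext x
  rcases Nat.eq_zero_or_pos k with rfl | h
  · simp [harmC]
  · simp [harmC, h.ne']

theorem harmS_neg (l k : ℕ) : harmS l (-k) = fun x => -(-1) ^ k * natS l k x := by
  funext x
  rcases Nat.eq_zero_or_pos k with rfl | h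
  · simp [harmS, natS_zero]
  · simp [harmS, h.ne']

theorem smoothS2_harmC (l : ℕ) (k : ℤ) : SmoothS2 (harmC l k) := by
  rcases Int.eq_nat_or_neg k with ⟨n, rfl | rfl⟩
  · rw [harmC_nat]; exact smoothS2_natC l n
  · rw [harmC_neg]; exact (smoothS2_natC l n).const_mul _

theorem smoothS2_harmS (l : ℕ) (k : ℤ) : SmoothS2 (harmS l k) := by
  rcases Int.eq_nat_or_neg k with ⟨n, rfl | rfl⟩
  · rw [harmS_nat]; exact smoothS2_natS l n
  · rw [harmS_neg]; exact (smoothS2_natS l n).const_mul _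

theorem ladder_symm (l : ℕ) (k : ℤ) : ladder l (-k - 1) = ladder l k := by
  rw [ladder, ladder]; congr 1; push_cast; ring

theorem int_cases_three {P : ℤ → Prop} (h0 : P 0) (h1 : ∀ n : ℕ, P (n + 1 : ℕ))
    (h2 : ∀ n : ℕ, P (-(n + 1 : ℕ))) (k : ℤ) : P k := by
  rcases Int.eq_nat_or_neg k with ⟨n, rfl | rfl⟩
  · cases n with
    | zero => exact h0
    | succ n => exact h1 n
  · cases n with
    | zero => exact h0
    | succ n => exact h2 n

section
variable (l : ℕ) (k : ℤ) (x : S2)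

/-- The signs attached to negative orders, together with the symmetry k ↦ -k - 1 of the ladder
coefficient, let one formula pass through order 0. -/
theorem rotD_one_harmC : rotD 1 (harmC l k) x
    = 1 / 2 * (-(ladder l k) * harmC l (k + 1) x + ladder l (k - 1) * harmC l (k - 1) x) := by
  have c0 := harmC_nat l
  have cn := harmC_neg l
  induction k using int_cases_three with
  | h0 =>
    have e1 : harmC l (0 + 1) = natC l 1 := c0 1
    have e2 : harmC l (0 - 1) = fun x => (-1) ^ 1 * natC l 1 x := cn 1
    have e3 : harmC l 0 = natC l 0 := c0 0
    have e4 : ladder l (0 - 1) = ladder l 0 := ladder_symm l 0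
    rw [e1, e2, e3, e4, rotD_one_natC_zero]; ring
  | h1 n =>
    have e1 : ((n + 1 : ℕ) : ℤ) + 1 = (n + 2 : ℕ) := by push_cast; ring
    have e2 : ((n + 1 : ℕ) : ℤ) - 1 = (n : ℕ) := by push_cast; ring
    rw [e1, e2, c0, c0, c0, rotD_one_natC_succ]; ring
  | h2 n =>
    have e1 : -((n + 1 : ℕ) : ℤ) + 1 = -(n : ℕ) := by push_cast; ring
    have e2 : -((n + 1 : ℕ) : ℤ) - 1 = -(n + 2 : ℕ) := by push_cast; ring
    have e3 : ladder l (-(n + 1 : ℕ)) = ladder l n := by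
      rw [← ladder_symm]; congr 1; push_cast; ring
    have e4 : ladder l (-(n + 2 : ℕ)) = ladder l (n + 1 : ℕ) := by
      rw [← ladder_symm]; congr 1; push_cast; ring
    rw [e1, e2, e3, e4, cn, cn, cn, rotD_const_mul (smoothS2_natC _ _), rotD_one_natC_succ]; ring

theorem rotD_one_harmS : rotD 1 (harmS l k) x
    = 1 / 2 * (-(ladder l k) * harmS l (k + 1) x + ladder l (k - 1) * harmS l (k - 1) x) := by
  have c0 := harmS_nat l
  have cn := harmS_neg l
  induction k using int_cases_three with
  | h0 =>
    have e1 : harmS l (0 + 1) = natS l 1 := c0 1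
    have e2 : harmS l (0 - 1) = fun x => -(-1) ^ 1 * natS l 1 x := cn 1
    have e3 : harmS l 0 = natS l 0 := c0 0
    have e4 : ladder l (0 - 1) = ladder l 0 := ladder_symm l 0
    rw [e1, e2, e3, e4, natS_zero_eq, rotD_const]; ring
  | h1 n =>
    have e1 : ((n + 1 : ℕ) : ℤ) + 1 = (n + 2 : ℕ) := by push_cast; ring
    have e2 : ((n + 1 : ℕ) : ℤ) - 1 = (n : ℕ) := by push_cast; ring
    rw [e1, e2, c0, c0, c0, rotD_one_natS_succ]; ring
  | h2 n =>
    have e1 : -((n + 1 : ℕ) : ℤ) + 1 = -(n : ℕ) := by push_cast; ring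
    have e2 : -((n + 1 : ℕ) : ℤ) - 1 = -(n + 2 : ℕ) := by push_cast; ring
    have e3 : ladder l (-(n + 1 : ℕ)) = ladder l n := by
      rw [← ladder_symm]; congr 1; push_cast; ring
    have e4 : ladder l (-(n + 2 : ℕ)) = ladder l (n + 1 : ℕ) := by
      rw [← ladder_symm]; congr 1; push_cast; ring
    rw [e1, e2, e3, e4, cn, cn, cn, rotD_const_mul (smoothS2_natS _ _), rotD_one_natS_succ]; ring

theorem rotD_zero_harmC : rotD 0 (harmC l k) x
    = 1 / 2 * (ladder l k * harmS l (k + 1) x + ladder l (k - 1) * harmS l (k - 1) x) := by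
  have c0 := harmC_nat l
  have cn := harmC_neg l
  have s0 := harmS_nat l
  have sn := harmS_neg l
  induction k using int_cases_three with
  | h0 =>
    have e1 : harmS l (0 + 1) = natS l 1 := s0 1
    have e2 : harmS l (0 - 1) = fun x => -(-1) ^ 1 * natS l 1 x := sn 1
    have e3 : harmC l 0 = natC l 0 := c0 0
    have e4 : ladder l (0 - 1) = ladder l 0 := ladder_symm l 0
    rw [e1, e2, e3, e4, rotD_zero_natC_zero]; ring
  | h1 n =>
    have e1 : ((n + 1 : ℕ) : ℤ) + 1 = (n + 2 : ℕ) := by push_cast; ring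
    have e2 : ((n + 1 : ℕ) : ℤ) - 1 = (n : ℕ) := by push_cast; ring
    rw [e1, e2, c0, s0, s0, rotD_zero_natC_succ]
  | h2 n =>
    have e1 : -((n + 1 : ℕ) : ℤ) + 1 = -(n : ℕ) := by push_cast; ring
    have e2 : -((n + 1 : ℕ) : ℤ) - 1 = -(n + 2 : ℕ) := by push_cast; ring
    have e3 : ladder l (-(n + 1 : ℕ)) = ladder l n := by
      rw [← ladder_symm]; congr 1; push_cast; ring
    have e4 : ladder l (-(n + 2 : ℕ)) = ladder l (n + 1 : ℕ) := by
      rw [← ladder_symm]; congr 1; push_cast; ring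
    rw [e1, e2, e3, e4, cn, sn, sn, rotD_const_mul (smoothS2_natC _ _), rotD_zero_natC_succ]; ring

theorem rotD_zero_harmS : rotD 0 (harmS l k) x
    = -(1 / 2) * (ladder l k * harmC l (k + 1) x + ladder l (k - 1) * harmC l (k - 1) x) := by
  have c0 := harmC_nat l
  have cn := harmC_neg l
  have s0 := harmS_nat l
  have sn := harmS_neg l
  induction k using int_cases_three with
  | h0 =>
    have e1 : harmC l (0 + 1) = natC l 1 := c0 1
    have e2 : harmC l (0 - 1) = fun x => (-1) ^ 1 * natC l 1 x := cn 1
    have e3 : harmS l 0 = natS l 0 := s0 0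
    have e4 : ladder l (0 - 1) = ladder l 0 := ladder_symm l 0
    rw [e1, e2, e3, e4, natS_zero_eq, rotD_const]; ring
  | h1 n =>
    have e1 : ((n + 1 : ℕ) : ℤ) + 1 = (n + 2 : ℕ) := by push_cast; ring
    have e2 : ((n + 1 : ℕ) : ℤ) - 1 = (n : ℕ) := by push_cast; ring
    rw [e1, e2, s0, c0, c0, rotD_zero_natS_succ]
  | h2 n =>
    have e1 : -((n + 1 : ℕ) : ℤ) + 1 = -(n : ℕ) := by push_cast; ring
    have e2 : -((n + 1 : ℕ) : ℤ) - 1 = -(n + 2 : ℕ) := by push_cast; ring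
    have e3 : ladder l (-(n + 1 : ℕ)) = ladder l n := by
      rw [← ladder_symm]; congr 1; push_cast; ring
    have e4 : ladder l (-(n + 2 : ℕ)) = ladder l (n + 1 : ℕ) := by
      rw [← ladder_symm]; congr 1; push_cast; ring
    rw [e1, e2, e3, e4, sn, cn, cn, rotD_const_mul (smoothS2_natS _ _), rotD_zero_natS_succ]; ring

theorem rotD_two_harmC : rotD 2 (harmC l k) x = -(k : ℝ) * harmS l k x := by
  rcases Int.eq_nat_or_neg k with ⟨n, rfl | rfl⟩
  · rw [harmC_nat, harmS_nat, rotD_two_natC]; simp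
  · rw [harmC_neg, harmS_neg, rotD_const_mul (smoothS2_natC _ _), rotD_two_natC]; simp; ring

theorem rotD_two_harmS : rotD 2 (harmS l k) x = (k : ℝ) * harmC l k x := by
  rcases Int.eq_nat_or_neg k with ⟨n, rfl | rfl⟩
  · rw [harmC_nat, harmS_nat, rotD_two_natS]; simp
  · rw [harmC_neg, harmS_neg, rotD_const_mul (smoothS2_natS _ _), rotD_two_natS]; simp; ring

end

theorem rotD_lin {f g : S2 → ℝ} (hf : SmoothS2 f) (hg : SmoothS2 g) (c a b : ℝ) (j : Fin 3)
    (x : S2) : rotD j (fun x => c * (a * f x + b * g x)) x = c * (a * rotD j f x + b * rotD j g x) := by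
  rw [rotD_const_mul ((hf.const_mul a).add (hg.const_mul b)),
    rotD_add (hf.const_mul a) (hg.const_mul b), rotD_const_mul hf, rotD_const_mul hg]

theorem ladder_sq_int {l : ℕ} {k : ℤ} (h1 : -(l : ℤ) - 1 ≤ k) (h2 : k ≤ l) :
    ladder l k ^ 2 = ((l : ℝ) - k) * (l + k + 1) := by
  have h1' : -(l : ℝ) - 1 ≤ k := by exact_mod_cast h1
  have h2' : (k : ℝ) ≤ l := by exact_mod_cast h2
  rw [ladder, Real.sq_sqrt (mul_nonneg (by linarith) (by linarith))]

/-- In L_0² + L_1² the terms of order k ± 2 cancel. The remaining squared ladder coefficients at k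
and k - 1 add up to 2(l(l+1) - k²), and L_2² supplies the missing -k². -/
theorem casimir_harmC {l : ℕ} {k : ℤ} (hk : |k| ≤ l) (x : S2) :
    ∑ j, rotD j (rotD j (harmC l k)) x = -((l : ℝ) * (l + 1)) * harmC l k x := by
  obtain ⟨h1, h2⟩ := abs_le.1 hk
  rw [Fin.sum_univ_three, rotD_congr (rotD_zero_harmC l k), rotD_congr (rotD_one_harmC l k),
    rotD_congr (rotD_two_harmC l k), rotD_const_mul (smoothS2_harmS l k),
    rotD_lin (smoothS2_harmS l _) (smoothS2_harmS l _),
    rotD_lin (smoothS2_harmC l _) (smoothS2_harmC l _),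
    rotD_zero_harmS, rotD_zero_harmS, rotD_one_harmC, rotD_one_harmC, rotD_two_harmS,
    add_sub_cancel_right, sub_add_cancel]
  have e1 := ladder_sq_int (l := l) (k := k) (by omega) h2
  have e2 := ladder_sq_int (l := l) (k := k - 1) (by omega) (by omega)
  push_cast at e2
  linear_combination (-1 / 2 * harmC l k x) * (e1 + e2)

theorem casimir_harmS {l : ℕ} {k : ℤ} (hk : |k| ≤ l) (x : S2) :
    ∑ j, rotD j (rotD j (harmS l k)) x = -((l : ℝ) * (l + 1)) * harmS l k x := by
  obtain ⟨h1, h2⟩ := abs_le.1 hk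
  rw [Fin.sum_univ_three, rotD_congr (rotD_zero_harmS l k), rotD_congr (rotD_one_harmS l k),
    rotD_congr (rotD_two_harmS l k), rotD_const_mul (smoothS2_harmC l k),
    rotD_lin (smoothS2_harmC l _) (smoothS2_harmC l _),
    rotD_lin (smoothS2_harmS l _) (smoothS2_harmS l _),
    rotD_zero_harmC, rotD_zero_harmC, rotD_one_harmS, rotD_one_harmS, rotD_two_harmC,
    add_sub_cancel_right, sub_add_cancel]
  have e1 := ladder_sq_int (l := l) (k := k) (by omega) h2
  have e2 := ladder_sq_int (l := l) (k := k - 1) (by omega) (by omega)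
  push_cast at e2
  linear_combination (-1 / 2 * harmS l k x) * (e1 + e2)

/-! ### The addition theorem on the diagonal -/

/-- The sum of the squares of the spherical harmonics of degree `l`. -/
def harmSum (l : ℕ) (x : S2) : ℝ :=
  natC l 0 x ^ 2 + 2 * ∑ k ∈ Finset.range l, (natC l (k + 1) x ^ 2 + natS l (k + 1) x ^ 2)

theorem SmoothS2.sq {f : S2 → ℝ} (hf : SmoothS2 f) : SmoothS2 fun x => f x ^ 2 := by
  simpa [pow_two] using hf.mul hf

theorem smoothS2_sq_add_sq (l k : ℕ) :
    SmoothS2 fun x => natC l k x ^ 2 + natS l k x ^ 2 :=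
  (smoothS2_natC l k).sq.add (smoothS2_natS l k).sq

theorem smoothS2_harmSum (l : ℕ) : SmoothS2 (harmSum l) :=
  (smoothS2_natC l 0).sq.add ((smoothS2_sum fun k _ => smoothS2_sq_add_sq l (k + 1)).const_mul 2)

theorem rotD_harmSum (l : ℕ) (j : Fin 3) (x : S2) : rotD j (harmSum l) x
    = 2 * natC l 0 x * rotD j (natC l 0) x
      + 4 * ∑ k ∈ Finset.range l, (natC l (k + 1) x * rotD j (natC l (k + 1)) x
        + natS l (k + 1) x * rotD j (natS l (k + 1)) x) := by
  have h : harmSum l = fun x => natC l 0 x ^ 2 +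
      2 * ∑ k ∈ Finset.range l, (natC l (k + 1) x ^ 2 + natS l (k + 1) x ^ 2) := rfl
  have hs : SmoothS2 fun x => ∑ k ∈ Finset.range l, (natC l (k + 1) x ^ 2 + natS l (k + 1) x ^ 2) :=
    smoothS2_sum fun k _ => smoothS2_sq_add_sq l (k + 1)
  rw [h, rotD_add (smoothS2_natC l 0).sq (hs.const_mul 2), rotD_const_mul hs,
    rotD_sum fun k _ => smoothS2_sq_add_sq l (k + 1), rotD_sq (smoothS2_natC l 0)]
  congr 1
  rw [Finset.mul_sum, Finset.mul_sum]
  refine Finset.sum_congr rfl fun k _ => ?_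
  rw [rotD_add (smoothS2_natC l (k + 1)).sq (smoothS2_natS l (k + 1)).sq,
    rotD_sq (smoothS2_natC l (k + 1)), rotD_sq (smoothS2_natS l (k + 1))]
  ring

/-- The sum of squares is rotation invariant: each L_j acts on the orthonormal system of degree l by
a skew matrix. -/
theorem rotD_harmSum_eq_zero (l : ℕ) (j : Fin 3) (x : S2) : rotD j (harmSum l) x = 0 := by
  rw [rotD_harmSum]
  fin_cases j
  -- `U k` couples the orders k and k + 1, and the derivative telescopes in k. It ends at k = l
  -- because the ladder coefficient vanishes there, and its value at k = 0 cancels the zonal term.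
  · set U : ℕ → ℝ := fun k => ladder l k * (natC l k x * natS l (k + 1) x - natS l k x * natC l (k + 1) x)
      with hU
    have h := Finset.sum_range_sub U l
    have e0 : U 0 = ladder l 0 * (natC l 0 x * natS l 1 x) := by simp [hU, natS_zero]
    have el : U l = 0 := by simp [hU, ladder_self]
    rw [e0, el] at h
    simp only [Fin.zero_eta]
    have h2 : ∑ k ∈ Finset.range l, (natC l (k + 1) x * rotD 0 (natC l (k + 1)) x
        + natS l (k + 1) x * rotD 0 (natS l (k + 1)) x)
        = 1 / 2 * ∑ k ∈ Finset.range l, (U (k + 1) - U k) := by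
      rw [Finset.mul_sum]
      refine Finset.sum_congr rfl fun k _ => ?_
      rw [rotD_zero_natC_succ, rotD_zero_natS_succ]
      simp only [hU]; ring
    rw [h2, h, rotD_zero_natC_zero]; ring
  · set U : ℕ → ℝ := fun k => ladder l k * (natC l k x * natC l (k + 1) x + natS l k x * natS l (k + 1) x)
      with hU
    have h := Finset.sum_range_sub U l
    have e0 : U 0 = ladder l 0 * (natC l 0 x * natC l 1 x) := by simp [hU, natS_zero]
    have el : U l = 0 := by simp [hU, ladder_self]
    rw [e0, el] at h
    simp only [Fin.mk_one]
    have h2 : ∑ k ∈ Finset.range l, (natC l (k + 1) x * rotD 1 (natC l (k + 1)) x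
        + natS l (k + 1) x * rotD 1 (natS l (k + 1)) x)
        = -(1 / 2) * ∑ k ∈ Finset.range l, (U (k + 1) - U k) := by
      rw [Finset.mul_sum]
      refine Finset.sum_congr rfl fun k _ => ?_
      rw [rotD_one_natC_succ, rotD_one_natS_succ]
      simp only [hU]; ring
    rw [h2, h, rotD_one_natC_zero]; ring
  · simp only [Fin.reduceFinMk, rotD_two_natC, rotD_two_natS]
    have : ∀ k ∈ Finset.range l, (natC l (k + 1) x * (-((k + 1 : ℕ) : ℝ) * natS l (k + 1) x)
        + natS l (k + 1) x * (((k + 1 : ℕ) : ℝ) * natC l (k + 1) x)) = 0 := fun k _ => by ring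
    rw [Finset.sum_eq_zero this]
    simp

/-- The sum is constant, so it may be evaluated at the north pole, where only the zonal harmonic is
nonzero and P_l(1) = 1. -/
theorem harmSum_eq (l : ℕ) (x : S2) : harmSum l x = (2 * l + 1) / (4 * Real.pi) := by
  let n : S2 := ⟨EuclideanSpace.single 2 1, by simp⟩
  rw [eq_of_rotD_eq_zero (smoothS2_harmSum l) (rotD_harmSum_eq_zero l) x n]
  have h0 : (n : E3) 0 = 0 := by simp [n]
  have h1 : (n : E3) 1 = 0 := by simp [n]
  have h2 : (n : E3) 2 = 1 := by simp [n]
  have hs : ∀ k ∈ Finset.range l, natC l (k + 1) n ^ 2 + natS l (k + 1) n ^ 2 = 0 := by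
    intro k _
    simp [natC, natS, cosPart_succ, sinPart_succ, h0, h1]
  rw [harmSum, Finset.sum_eq_zero hs, natC, h2, cosPart_zero, harmPoly]
  simp only [Function.iterate_zero, id, Polynomial.eval_mul, Polynomial.eval_C, legendreP_eval_one]
  rw [harmNorm, mul_zero, add_zero, mul_one, mul_one, Real.sq_sqrt]
  · have : (l.factorial : ℝ) ≠ 0 := Nat.cast_ne_zero.2 (Nat.factorial_ne_zero _)
    simp [this]
  · have := Real.pi_pos
    positivity

/-- Each harmonic is dominated by a known constant sum of squares; no estimate of associated
Legendre functions is needed. -/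
theorem natC_sq_add_natS_sq_le (l k : ℕ) (x : S2) :
    natC l k x ^ 2 + natS l k x ^ 2 ≤ ((l : ℝ) + 1) ^ 2 := by
  have hpi := Real.pi_gt_three
  have hb : (2 * (l : ℝ) + 1) / (4 * Real.pi) ≤ ((l : ℝ) + 1) ^ 2 := by
    rw [div_le_iff₀ (by positivity)]
    have : (0 : ℝ) ≤ l := by positivity
    nlinarith [sq_nonneg (l : ℝ)]
  have hs := harmSum_eq l x
  rw [harmSum] at hs
  have hn : ∀ k ∈ Finset.range l, 0 ≤ natC l (k + 1) x ^ 2 + natS l (k + 1) x ^ 2 :=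
    fun k _ => by positivity
  rcases lt_or_ge l k with h | h
  · rw [natC_eq_zero h, natS_eq_zero h]
    have := sq_nonneg ((l : ℝ) + 1)
    simpa using this
  · cases k with
    | zero =>
      rw [natS_zero]
      have := Finset.sum_nonneg hn
      nlinarith
    | succ k =>
      have := Finset.single_le_sum hn (Finset.mem_range.2 (show k < l by omega))
      nlinarith [sq_nonneg (natC l 0 x), sq_nonneg (natC l (k + 1) x), sq_nonneg (natS l (k + 1) x)]

theorem abs_harmC_le (l : ℕ) (k : ℤ) (x : S2) : |harmC l k x| ≤ (l : ℝ) + 1 := by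
  have h : |harmC l k x| = |natC l k.natAbs x| := by
    rw [harmC]; split_ifs <;> simp [abs_mul]
  rw [h]
  apply abs_le_of_sq_le_sq _ (by positivity)
  nlinarith [natC_sq_add_natS_sq_le l k.natAbs x, sq_nonneg (natS l k.natAbs x)]

theorem abs_harmS_le (l : ℕ) (k : ℤ) (x : S2) : |harmS l k x| ≤ (l : ℝ) + 1 := by
  have h : |harmS l k x| = |natS l k.natAbs x| := by
    rw [harmS]; split_ifs <;> simp [abs_mul]
  rw [h]
  apply abs_le_of_sq_le_sq _ (by positivity)
  nlinarith [natC_sq_add_natS_sq_le l k.natAbs x, sq_nonneg (natC l k.natAbs x)]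

/-! ### Iterated rotational derivatives -/

/-- Iterated rotational derivatives; the last entry acts first. -/
def rotWord (W : List (Fin 3)) (f : S2 → ℝ) : S2 → ℝ := W.foldr rotD f

theorem rotWord_cons (j : Fin 3) (W : List (Fin 3)) (f : S2 → ℝ) :
    rotWord (j :: W) f = rotD j (rotWord W f) := rfl

theorem rotWord_append_singleton (j : Fin 3) (W : List (Fin 3)) (f : S2 → ℝ) :
    rotWord (W ++ [j]) f = rotWord W (rotD j f) := by simp [rotWord]

theorem SmoothS2.rotWord {f : S2 → ℝ} (hf : SmoothS2 f) (W : List (Fin 3)) :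
    SmoothS2 (rotWord W f) := by
  induction W with
  | nil => exact hf
  | cons j W ih => exact ih.rotD j

theorem rotWord_lin {f g : S2 → ℝ} (hf : SmoothS2 f) (hg : SmoothS2 g) (c a b : ℝ)
    (W : List (Fin 3)) : rotWord W (fun x => c * (a * f x + b * g x))
      = fun x => c * (a * rotWord W f x + b * rotWord W g x) := by
  induction W with
  | nil => rfl
  | cons j W ih =>
    funext x
    rw [rotWord_cons, ih, rotD_lin (hf.rotWord W) (hg.rotWord W)]
    rfl

theorem rotWord_const_mul {f : S2 → ℝ} (hf : SmoothS2 f) (c : ℝ)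
    (W : List (Fin 3)) : rotWord W (fun x => c * f x) = fun x => c * rotWord W f x := by
  have := rotWord_lin hf hf c 1 0 W
  simpa using this

theorem ladder_le (l : ℕ) (k : ℤ) : ladder l k ≤ (l : ℝ) + 1 := by
  rw [ladder]
  apply Real.sqrt_le_iff.2 ⟨by positivity, ?_⟩
  have : (0 : ℝ) ≤ l := by positivity
  nlinarith [sq_nonneg ((k : ℝ) + 1 / 2)]

theorem ladder_nonneg (l : ℕ) (k : ℤ) : 0 ≤ ladder l k := Real.sqrt_nonneg _

theorem abs_half_ladder_le {B c u v : ℝ} (hc : |c| = 1 / 2) (l : ℕ) {k k' : ℤ} {σ : ℝ}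
    (hσ : |σ| = ladder l k) (hu : |u| ≤ B) (hv : |v| ≤ B) :
    |c * (σ * u + ladder l k' * v)| ≤ ((l : ℝ) + 1) * B := by
  have hB : 0 ≤ B := (abs_nonneg u).trans hu
  rw [abs_mul, hc]
  have h1 : |σ * u + ladder l k' * v| ≤ (l + 1) * B + (l + 1) * B := by
    refine (abs_add_le _ _).trans (add_le_add ?_ ?_)
    · rw [abs_mul, hσ]
      exact mul_le_mul (ladder_le l k) hu (abs_nonneg _) (by positivity)
    · rw [abs_mul, abs_of_nonneg (ladder_nonneg l k')]
      exact mul_le_mul (ladder_le l k') hv (abs_nonneg _) (by positivity)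
  linarith

theorem harmC_eq_zero {l : ℕ} {k : ℤ} (h : ¬|k| ≤ l) : harmC l k = fun _ => 0 := by
  have : l < k.natAbs := by rw [Int.abs_eq_natAbs] at h; omega
  funext x; simp [harmC, natC_eq_zero this]

theorem harmS_eq_zero {l : ℕ} {k : ℤ} (h : ¬|k| ≤ l) : harmS l k = fun _ => 0 := by
  have : l < k.natAbs := by rw [Int.abs_eq_natAbs] at h; omega
  funext x; simp [harmS, natS_eq_zero this]

/-- Each derivative costs one factor l + 1, because the ladder coefficients and the effective orders
are at most that large. The induction removes the letter acting first, which meets a harmonic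
directly; all integral orders are allowed since the ladders shift k. -/
theorem abs_rotWord_harm_le (l : ℕ) (W : List (Fin 3)) : ∀ (k : ℤ) (x : S2),
    |rotWord W (harmC l k) x| ≤ ((l : ℝ) + 1) ^ (W.length + 1) ∧
      |rotWord W (harmS l k) x| ≤ ((l : ℝ) + 1) ^ (W.length + 1) := by
  induction W using List.reverseRecOn with
  | nil =>
    intro k x
    simpa [rotWord] using And.intro (abs_harmC_le l k x) (abs_harmS_le l k x)
  | append_singleton W j ih =>
    intro k x
    simp only [rotWord_append_singleton, List.length_append, List.length_singleton]
    have hp : ((l : ℝ) + 1) ^ (W.length + 1 + 1) = (l + 1) * ((l : ℝ) + 1) ^ (W.length + 1) := by ring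
    have hL := abs_of_nonneg (ladder_nonneg l k)
    have hL' : |-(ladder l k)| = ladder l k := by rw [abs_neg, hL]
    have ha : |(1 / 2 : ℝ)| = 1 / 2 := by norm_num
    have ha' : |(-(1 / 2) : ℝ)| = 1 / 2 := by norm_num
    rw [hp]
    fin_cases j
    · simp only [Fin.zero_eta]
      rw [show rotD 0 (harmC l k) = _ from funext (rotD_zero_harmC l k),
        show rotD 0 (harmS l k) = _ from funext (rotD_zero_harmS l k),
        rotWord_lin (smoothS2_harmS l _) (smoothS2_harmS l _),
        rotWord_lin (smoothS2_harmC l _) (smoothS2_harmC l _)]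
      exact ⟨abs_half_ladder_le ha l hL (ih _ x).2 (ih _ x).2,
        abs_half_ladder_le ha' l hL (ih _ x).1 (ih _ x).1⟩
    · simp only [Fin.mk_one]
      rw [show rotD 1 (harmC l k) = _ from funext (rotD_one_harmC l k),
        show rotD 1 (harmS l k) = _ from funext (rotD_one_harmS l k),
        rotWord_lin (smoothS2_harmS l _) (smoothS2_harmS l _),
        rotWord_lin (smoothS2_harmC l _) (smoothS2_harmC l _)]
      exact ⟨abs_half_ladder_le ha l hL' (ih _ x).1 (ih _ x).1,
        abs_half_ladder_le ha l hL' (ih _ x).2 (ih _ x).2⟩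
    · simp only [Fin.reduceFinMk]
      rw [show rotD 2 (harmC l k) = _ from funext (rotD_two_harmC l k),
        show rotD 2 (harmS l k) = _ from funext (rotD_two_harmS l k),
        rotWord_const_mul (smoothS2_harmS l _), rotWord_const_mul (smoothS2_harmC l _)]
      -- The factor k is bounded by l only in the admissible range; outside it the harmonics vanish.
      by_cases hk : |k| ≤ l
      · have hk' : |(k : ℝ)| ≤ (l : ℝ) + 1 := by
          have : |(k : ℝ)| ≤ l := by exact_mod_cast hk
          linarith
        simp only [abs_mul, abs_neg]
        exact ⟨mul_le_mul hk' (ih _ x).2 (abs_nonneg _) (by positivity),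
          mul_le_mul hk' (ih _ x).1 (abs_nonneg _) (by positivity)⟩
      · have hz : rotWord W (fun _ => 0) = fun _ => 0 := by
          have := rotWord_const_mul (smoothS2_const 0) 0 W
          simpa using this
        rw [harmC_eq_zero hk, harmS_eq_zero hk, hz]
        simp only [mul_zero, abs_zero]
        exact ⟨by positivity, by positivity⟩

/-! ### The real spherical harmonics -/

theorem realY_eq (i : HarmonicIndex) :
    ∃ c : ℝ, |c| ≤ 2 ∧ c ≠ 0 ∧ ((realY i = fun x => c * harmC i.1 i.2.1 x) ∨
      (realY i = fun x => c * harmS i.1 i.2.1 x)) := by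
  obtain ⟨l, m, hm⟩ := i
  have h2 : Real.sqrt 2 ≤ 2 := by
    rw [Real.sqrt_le_left (by norm_num)]; norm_num
  have h2' : Real.sqrt 2 ≠ 0 := by positivity
  rcases lt_trichotomy m 0 with h | rfl | h
  · refine ⟨-(-1) ^ m.natAbs * Real.sqrt 2, ?_, ?_, Or.inr ?_⟩
    · rw [abs_mul, abs_neg, abs_pow, abs_neg, abs_one, one_pow, one_mul,
        abs_of_nonneg (Real.sqrt_nonneg _)]
      exact h2
    · simp
    · funext x
      have : ((-1 : ℝ) ^ m.natAbs) * (-1) ^ m.natAbs = 1 := by rw [← mul_pow]; simp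
      simp only [realY, azimuthal, h.ne, h.not_gt, if_false, harmS, h.not_ge, natS, harmPoly,
        sinPart, harmNorm, Polynomial.eval_mul, Polynomial.eval_C]
      rw [show ∀ a b c d e f : ℝ, -d * a * (-d * (b * c * e)) = (d * d) * (b * c * (a * e)) by
        intros; ring]
      · rw [this, one_mul]
      · exact 0
  · refine ⟨1, by norm_num, one_ne_zero, Or.inl ?_⟩
    funext x
    simp [realY, azimuthal, harmC, natC, harmPoly, cosPart, harmNorm]
  · refine ⟨Real.sqrt 2, ?_, h2', Or.inl ?_⟩
    · rw [abs_of_nonneg (Real.sqrt_nonneg _)]; exact h2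
    · funext x
      simp only [realY, azimuthal, h.ne', h, if_false, if_true, harmC, h.le, natC, harmPoly,
        cosPart, harmNorm, Polynomial.eval_mul, Polynomial.eval_C]
      ring

theorem smoothS2_realY (i : HarmonicIndex) : SmoothS2 (realY i) := by
  obtain ⟨c, -, -, h | h⟩ := realY_eq i
  · rw [h]; exact (smoothS2_harmC _ _).const_mul c
  · rw [h]; exact (smoothS2_harmS _ _).const_mul c

theorem abs_rotWord_realY_le (W : List (Fin 3)) (i : HarmonicIndex) (x : S2) :
    |rotWord W (realY i) x| ≤ 2 * ((i.1 : ℝ) + 1) ^ (W.length + 1) := by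
  obtain ⟨c, hc, -, h | h⟩ := realY_eq i
  · rw [h, rotWord_const_mul (smoothS2_harmC _ _), abs_mul]
    exact mul_le_mul hc (abs_rotWord_harm_le _ W _ x).1 (abs_nonneg _) (by norm_num)
  · rw [h, rotWord_const_mul (smoothS2_harmS _ _), abs_mul]
    exact mul_le_mul hc (abs_rotWord_harm_le _ W _ x).2 (abs_nonneg _) (by norm_num)

theorem abs_realY_le (i : HarmonicIndex) (x : S2) : |realY i x| ≤ 2 * ((i.1 : ℝ) + 1) := by
  simpa [rotWord] using abs_rotWord_realY_le [] i x

theorem casimir_realY (i : HarmonicIndex) (x : S2) :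
    ∑ j, rotD j (rotD j (realY i)) x = -((i.1 : ℝ) * (i.1 + 1)) * realY i x := by
  have key : ∀ (f : S2 → ℝ) (c : ℝ), SmoothS2 f → (realY i = fun x => c * f x) →
      ∑ j, rotD j (rotD j f) x = -((i.1 : ℝ) * (i.1 + 1)) * f x →
      ∑ j, rotD j (rotD j (realY i)) x = -((i.1 : ℝ) * (i.1 + 1)) * realY i x := by
    intro f c hf h h2
    rw [h]
    have : ∀ j, rotD j (rotD j fun x => c * f x) x = c * rotD j (rotD j f) x := fun j => by
      rw [rotD_congr (rotD_const_mul hf c j), rotD_const_mul (hf.rotD j)]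
    simp only [this]
    rw [← Finset.mul_sum, h2]; ring
  obtain ⟨c, -, -, h | h⟩ := realY_eq i
  · exact key _ c (smoothS2_harmC _ _) h (casimir_harmC i.2.2 x)
  · exact key _ c (smoothS2_harmS _ _) h (casimir_harmS i.2.2 x)

theorem cosPart_neg (k : ℕ) (y : E3) : cosPart k (-y) = (-1) ^ k * cosPart k y ∧
    sinPart k (-y) = (-1) ^ k * sinPart k y := by
  induction k with
  | zero => simp [cosPart_zero, sinPart_zero]
  | succ k ih =>
    rw [cosPart_succ, cosPart_succ, sinPart_succ, sinPart_succ, ih.1, ih.2]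
    simp only [PiLp.neg_apply]
    constructor <;> ring

theorem iterate_derivative_legendreP_neg (l k : ℕ) (s : ℝ) :
    (Polynomial.derivative^[k] (legendreP l)).eval (-s)
      = (-1) ^ (l + k) * (Polynomial.derivative^[k] (legendreP l)).eval s := by
  induction k generalizing s with
  | zero => simpa using legendreP_eval_neg l s
  | succ k ih =>
    rw [Function.iterate_succ_apply']
    set p := Polynomial.derivative^[k] (legendreP l)
    have h1 : HasDerivAt (fun s => p.eval (-s)) (-(p.derivative.eval (-s))) s := by
      simpa [Function.comp_def] using (p.hasDerivAt (-s)).comp s (hasDerivAt_neg s)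
    have h2 := (p.hasDerivAt s).const_mul ((-1 : ℝ) ^ (l + k))
    have h3 := h1.unique (h2.congr_of_eventuallyEq (Eventually.of_forall ih))
    rw [← add_assoc, pow_succ]
    linear_combination -h3

/-- The k-th derivative of P_l contributes (-1)^{l+k} and the azimuthal factor (-1)^k. -/
theorem realY_neg (i : HarmonicIndex) (x : S2) : realY i (-x) = (-1) ^ i.1 * realY i x := by
  have hC : ∀ k : ℕ, natC i.1 k (-x) = (-1) ^ i.1 * natC i.1 k x ∧
      natS i.1 k (-x) = (-1) ^ i.1 * natS i.1 k x := by
    intro k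
    have e : ((-1 : ℝ) ^ k) * (-1) ^ k = 1 := by rw [← mul_pow]; simp
    obtain ⟨h1, h2⟩ := cosPart_neg k (x : E3)
    have h3 := iterate_derivative_legendreP_neg i.1 k ((x : E3) 2)
    simp only [natC, natS, harmPoly, Polynomial.eval_mul, Polynomial.eval_C, coe_neg_sphere,
      PiLp.neg_apply, h1, h2, h3, pow_add]
    constructor
    · linear_combination (harmNorm i.1 k * (-1) ^ i.1 *
        (Polynomial.derivative^[k] (legendreP i.1)).eval ((x : E3) 2) * cosPart k x) * e
    · linear_combination (harmNorm i.1 k * (-1) ^ i.1 *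
        (Polynomial.derivative^[k] (legendreP i.1)).eval ((x : E3) 2) * sinPart k x) * e
  obtain ⟨c, -, -, h | h⟩ := realY_eq i
  · rw [h]; simp only [harmC, (hC _).1]; split_ifs <;> ring
  · rw [h]; simp only [harmS, (hC _).2]; split_ifs <;> ring

/-! ### Integration over the sphere -/

open MeasureTheory
open scoped Pointwise

/-- The rotation-invariant measure of the sphere. -/
def sphMeas : Measure S2 := (volume : Measure E3).toSphere

instance : IsFiniteMeasure sphMeas := by unfold sphMeas; infer_instance

instance : sphMeas.IsOpenPosMeasure := by unfold sphMeas; infer_instance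

theorem integrable_of_continuous {f : S2 → ℝ} (hf : Continuous f) : Integrable f sphMeas :=
  hf.integrable_of_hasCompactSupport (HasCompactSupport.of_compactSpace f)

theorem SmoothS2.integrable {f : S2 → ℝ} (hf : SmoothS2 f) : Integrable f sphMeas :=
  integrable_of_continuous hf.continuous

/-- The action of a linear isometry on the sphere. -/
def sphereMap (R : E3 ≃ₗᵢ[ℝ] E3) (x : S2) : S2 :=
  ⟨R x, by simp⟩

theorem continuous_sphereMap (R : E3 ≃ₗᵢ[ℝ] E3) : Continuous (sphereMap R) :=
  (R.continuous.comp continuous_subtype_val).subtype_mk _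

/-- The measure of a subset of the sphere is a multiple of the Lebesgue measure of the cone over it,
and an isometry carries cones to cones. -/
theorem measurePreserving_sphereMap (R : E3 ≃ₗᵢ[ℝ] E3) :
    MeasurePreserving (sphereMap R) sphMeas sphMeas := by
  refine ⟨(continuous_sphereMap R).measurable, ?_⟩
  ext s hs
  rw [Measure.map_apply (continuous_sphereMap R).measurable hs, sphMeas,
    Measure.toSphere_apply' _ ((continuous_sphereMap R).measurable hs),
    Measure.toSphere_apply' _ hs]
  congr 1
  rw [← R.measurePreserving.measure_preimage_emb R.toHomeomorph.measurableEmbedding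
    (Ioo (0 : ℝ) 1 • (Subtype.val '' s))]
  congr 1
  ext y
  simp only [Set.mem_smul, Set.mem_preimage, Set.mem_image]
  constructor
  · rintro ⟨r, hr, _, ⟨x, hx, rfl⟩, rfl⟩
    exact ⟨r, hr, _, ⟨sphereMap R x, hx, rfl⟩, by simp [sphereMap]⟩
  · rintro ⟨r, hr, _, ⟨x, hx, rfl⟩, h⟩
    refine ⟨r, hr, _, ⟨sphereMap R.symm x, ?_, rfl⟩, ?_⟩
    · have : sphereMap R (sphereMap R.symm x) = x := by
        apply Subtype.ext; simp [sphereMap]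
      rwa [this]
    · apply R.injective
      simp [sphereMap, h]

theorem integral_sphereMap (R : E3 ≃ₗᵢ[ℝ] E3) (f : S2 → ℝ) :
    ∫ x, f (sphereMap R x) ∂sphMeas = ∫ x, f x ∂sphMeas := by
  refine (measurePreserving_sphereMap R).integral_comp ?_ f
  have hinv : ∀ R : E3 ≃ₗᵢ[ℝ] E3, Function.LeftInverse (sphereMap R.symm) (sphereMap R) := by
    intro R x; apply Subtype.ext; simp [sphereMap]
  let e : S2 ≃ₜ S2 :=
    { toFun := sphereMap R, invFun := sphereMap R.symm, left_inv := hinv R,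
      right_inv := hinv R.symm, continuous_toFun := continuous_sphereMap R,
      continuous_invFun := continuous_sphereMap R.symm }
  exact e.measurableEmbedding

/-- The one-parameter group of rotations about the `j`-th axis, as a linear map. -/
def rotExp (j : Fin 3) (t : ℝ) : E3 →L[ℝ] E3 := NormedSpace.exp (t • rotGen j)

theorem hasDerivAt_rotExp (j : Fin 3) (y : E3) (t : ℝ) :
    HasDerivAt (fun t => rotExp j t y) (rotGen j (rotExp j t y)) t := by
  have := hasDerivAt_exp_smul_const' (𝕂 := ℝ) (rotGen j) t
  exact (this.clm_apply (hasDerivAt_const t y)).congr_deriv (by simp [rotExp])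

theorem rotExp_zero (j : Fin 3) (y : E3) : rotExp j 0 y = y := by
  have h : (0 : ℝ) • rotGen j = 0 :=
    ContinuousLinearMap.ext fun v => zero_smul ℝ (rotGen j v)
  have h2 : rotExp j 0 = 1 := (congrArg NormedSpace.exp h).trans NormedSpace.exp_zero
  rw [h2]; rfl

/-- The squared norm has derivative proportional to ⟨z, e_j × z⟩ = 0 along the flow. -/
theorem norm_rotExp (j : Fin 3) (t : ℝ) (y : E3) : ‖rotExp j t y‖ = ‖y‖ := by
  have h : ∀ t, HasDerivAt (fun t => ‖rotExp j t y‖ ^ 2) 0 t := fun t => by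
    refine (hasDerivAt_rotExp j y t).norm_sq.congr_deriv ?_
    rw [inner_rotGen_self]; simp
  have h2 := is_const_of_deriv_eq_zero (fun t => (h t).differentiableAt) (fun t => (h t).deriv) t 0
  rw [rotExp_zero] at h2
  exact (sq_eq_sq₀ (norm_nonneg _) (norm_nonneg _)).1 h2

/-- The one-parameter group of rotations about the `j`-th axis. -/
def rotFlow (j : Fin 3) (t : ℝ) : E3 ≃ₗᵢ[ℝ] E3 :=
  LinearIsometry.toLinearIsometryEquiv ⟨(rotExp j t).toLinearMap, norm_rotExp j t⟩ rfl

theorem exists_abs_le_of_continuous {f : S2 → ℝ} (hf : Continuous f) : ∃ C, ∀ x, |f x| ≤ C := by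
  obtain ⟨C, hC⟩ := isCompact_univ.exists_bound_of_continuousOn hf.continuousOn
  exact ⟨C, fun x => hC x (mem_univ x)⟩

/-- The integral of f composed with the rotation by t does not depend on t; it is differentiated
under the integral sign at t = 0. Integration by parts for L_j follows. -/
theorem integral_rotD {f : S2 → ℝ} (hf : SmoothS2 f) (j : Fin 3) :
    ∫ x, rotD j f x ∂sphMeas = 0 := by
  obtain ⟨C, hC⟩ := exists_abs_le_of_continuous (hf.rotD j).continuous
  have key := hasDerivAt_integral_of_dominated_loc_of_deriv_le (μ := sphMeas) (𝕜 := ℝ)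
    (F := fun t x => f (sphereMap (rotFlow j t) x))
    (F' := fun t x => rotD j f (sphereMap (rotFlow j t) x)) (x₀ := 0) (s := univ)
    (bound := fun _ => C) univ_mem
    (Eventually.of_forall fun t =>
      (hf.continuous.comp (continuous_sphereMap _)).aestronglyMeasurable)
    (integrable_of_continuous (hf.continuous.comp (continuous_sphereMap _)))
    ((hf.rotD j).continuous.comp (continuous_sphereMap _)).aestronglyMeasurable
    (Eventually.of_forall fun x t _ => hC _) (integrable_const C)
    (Eventually.of_forall fun x t _ => by
      have h1 := (hf.differentiableAt (coe_ne_zero (sphereMap (rotFlow j t) x))).hasFDerivAt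
      have h2 := HasFDerivAt.comp_hasDerivAt t h1 (hasDerivAt_rotExp j (x : E3) t)
      refine h2.congr_of_eventuallyEq (Eventually.of_forall fun u => ?_)
      exact (radialExt_coe f (sphereMap (rotFlow j u) x)).symm)
  have h0 : ∀ x, sphereMap (rotFlow j 0) x = x := fun x =>
    Subtype.ext (rotExp_zero j (x : E3))
  have h1 := key.2
  simp only [integral_sphereMap, h0] at h1
  exact h1.unique (hasDerivAt_const _ _)

theorem integral_mul_rotD {f g : S2 → ℝ} (hf : SmoothS2 f) (hg : SmoothS2 g) (j : Fin 3) :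
    ∫ x, f x * rotD j g x ∂sphMeas = -∫ x, g x * rotD j f x ∂sphMeas := by
  have h := integral_rotD (hf.mul hg) j
  simp only [rotD_mul hf hg] at h
  rw [integral_add (hf.mul (hg.rotD j)).integrable (hg.mul (hf.rotD j)).integrable] at h
  linarith

theorem integral_mul_rotD_rotD {f g : S2 → ℝ} (hf : SmoothS2 f) (hg : SmoothS2 g) (j : Fin 3) :
    ∫ x, f x * rotD j (rotD j g) x ∂sphMeas = ∫ x, g x * rotD j (rotD j f) x ∂sphMeas := by
  rw [integral_mul_rotD hf (hg.rotD j), integral_mul_rotD hg (hf.rotD j)]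
  simp only [mul_comm]

/-- The Laplacian as a sum of squares of rotational derivatives. -/
def lap (f : S2 → ℝ) (x : S2) : ℝ := ∑ j, rotD j (rotD j f) x

theorem SmoothS2.lap {f : S2 → ℝ} (hf : SmoothS2 f) : SmoothS2 (lap f) :=
  smoothS2_sum fun j _ => (hf.rotD j).rotD j

theorem integral_mul_lap {f g : S2 → ℝ} (hf : SmoothS2 f) (hg : SmoothS2 g) :
    ∫ x, f x * lap g x ∂sphMeas = ∫ x, g x * lap f x ∂sphMeas := by
  simp only [lap, Finset.mul_sum]
  rw [integral_finsetSum _ fun j _ => (hf.mul ((hg.rotD j).rotD j)).integrable,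
    integral_finsetSum _ fun j _ => (hg.mul ((hf.rotD j).rotD j)).integrable]
  exact Finset.sum_congr rfl fun j _ => integral_mul_rotD_rotD hf hg j

theorem lap_realY (i : HarmonicIndex) (x : S2) :
    lap (realY i) x = -((i.1 : ℝ) * (i.1 + 1)) * realY i x := casimir_realY i x

/-! ### Orthogonality -/

theorem integral_eigen_eq_zero {f g : S2 → ℝ} {a b : ℝ} (hab : a ≠ b)
    {T : (S2 → ℝ) → S2 → ℝ} (hT : ∫ x, f x * T g x ∂sphMeas = ∫ x, g x * T f x ∂sphMeas)
    (h1 : ∀ x, T f x = a * f x) (h2 : ∀ x, T g x = b * g x) :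
    ∫ x, f x * g x ∂sphMeas = 0 := by
  have e1 : ∀ x, f x * (b * g x) = b * (f x * g x) := fun x => by ring
  have e2 : ∀ x, g x * (a * f x) = a * (f x * g x) := fun x => by ring
  simp only [h1, h2, e1, e2, integral_const_mul] at hT
  have : (b - a) * ∫ x, f x * g x ∂sphMeas = 0 := by linarith
  exact (mul_eq_zero.1 this).resolve_left (sub_ne_zero.2 hab.symm)

theorem rotD_two_two_natC (l k : ℕ) (x : S2) :
    rotD 2 (rotD 2 (natC l k)) x = -(k : ℝ) ^ 2 * natC l k x := by
  rw [rotD_congr (rotD_two_natC l k), rotD_const_mul (smoothS2_natS l k), rotD_two_natS]; ring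

theorem rotD_two_two_natS (l k : ℕ) (x : S2) :
    rotD 2 (rotD 2 (natS l k)) x = -(k : ℝ) ^ 2 * natS l k x := by
  rw [rotD_congr (rotD_two_natS l k), rotD_const_mul (smoothS2_natC l k), rotD_two_natC]; ring

theorem neg_sq_ne {k k' : ℕ} (h : k ≠ k') : -(k : ℝ) ^ 2 ≠ -(k' : ℝ) ^ 2 := fun he => h (by
  have := neg_inj.1 he
  rw [sq_eq_sq₀ (by positivity) (by positivity)] at this
  exact_mod_cast this)

theorem integral_natC_mul_natC (l : ℕ) {k k' : ℕ} (h : k ≠ k') :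
    ∫ x, natC l k x * natC l k' x ∂sphMeas = 0 :=
  integral_eigen_eq_zero (T := fun f => rotD 2 (rotD 2 f)) (neg_sq_ne h)
    (integral_mul_rotD_rotD (smoothS2_natC _ _) (smoothS2_natC _ _) 2) (rotD_two_two_natC l k)
    (rotD_two_two_natC l k')

/-- L_2 maps the cosine harmonic to a multiple of the sine harmonic and is skew, so its diagonal
matrix element vanishes. -/
theorem integral_natC_mul_natS (l k : ℕ) :
    ∫ x, natC l k x * natS l k x ∂sphMeas = 0 := by
  rcases Nat.eq_zero_or_pos k with rfl | hk
  · simp [natS_zero]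
  · have h := integral_mul_rotD (smoothS2_natC l k) (smoothS2_natC l k) 2
    have e : ∀ x, natC l k x * (-(k : ℝ) * natS l k x) = -(k : ℝ) * (natC l k x * natS l k x) :=
      fun x => by ring
    simp only [rotD_two_natC, e, integral_const_mul] at h
    have hk' : (k : ℝ) ≠ 0 := by positivity
    have : (k : ℝ) * ∫ x, natC l k x * natS l k x ∂sphMeas = 0 := by linarith
    exact (mul_eq_zero.1 this).resolve_left hk'

theorem integral_natS_sq (l : ℕ) {k : ℕ} (hk : k ≠ 0) :
    ∫ x, natS l k x * natS l k x ∂sphMeas = ∫ x, natC l k x * natC l k x ∂sphMeas := by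
  have h := integral_mul_rotD (smoothS2_natC l k) (smoothS2_natS l k) 2
  have e : ∀ x, natC l k x * ((k : ℝ) * natC l k x) = (k : ℝ) * (natC l k x * natC l k x) :=
    fun x => by ring
  have e' : ∀ x, natS l k x * (-(k : ℝ) * natS l k x) = -((k : ℝ) * (natS l k x * natS l k x)) :=
    fun x => by ring
  simp only [rotD_two_natC, rotD_two_natS, e, e', integral_const_mul, integral_neg, neg_neg] at h
  exact (mul_left_cancel₀ (Nat.cast_ne_zero.2 hk) h).symm

theorem ladder_ne_zero {l k : ℕ} (h : k < l) : ladder l k ≠ 0 := by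
  have hk : (k : ℝ) < l := by exact_mod_cast h
  intro h0
  have := ladder_sq h.le
  rw [h0] at this
  have h1 : 0 < ((l : ℝ) - k) * (l + k + 1) := mul_pos (by linarith) (by positivity)
  simp at this
  rcases this with h | h <;> nlinarith

/-- Moving L_1 from one of two neighbouring orders to the other meets the same ladder coefficient on
both sides; orthogonality removes the terms two orders apart. -/
theorem integral_natC_sq_succ (l : ℕ) {k : ℕ} (hk : k + 1 < l) :
    ∫ x, natC l (k + 2) x * natC l (k + 2) x ∂sphMeas
      = ∫ x, natC l (k + 1) x * natC l (k + 1) x ∂sphMeas := by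
  have h := integral_mul_rotD (smoothS2_natC l (k + 2)) (smoothS2_natC l (k + 1)) 1
  have e1 : ∀ x, natC l (k + 2) x * rotD 1 (natC l (k + 1)) x
      = -(ladder l (k + 1 : ℕ) / 2) * (natC l (k + 2) x * natC l (k + 2) x)
        + ladder l k / 2 * (natC l (k + 2) x * natC l k x) := fun x => by
    rw [rotD_one_natC_succ]; ring
  have e2 : ∀ x, natC l (k + 1) x * rotD 1 (natC l (k + 2)) x
      = -(ladder l (k + 2 : ℕ) / 2) * (natC l (k + 1) x * natC l (k + 3) x)
        + ladder l (k + 1 : ℕ) / 2 * (natC l (k + 1) x * natC l (k + 1) x) := fun x => by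
    rw [rotD_one_natC_succ]; ring
  have hI := fun a b => ((smoothS2_natC l a).mul (smoothS2_natC l b)).integrable
  simp only [e1, e2] at h
  rw [integral_add ((hI _ _).const_mul _) ((hI _ _).const_mul _),
    integral_add ((hI _ _).const_mul _) ((hI _ _).const_mul _)] at h
  simp only [integral_const_mul] at h
  rw [integral_natC_mul_natC l (show k + 2 ≠ k by omega),
    integral_natC_mul_natC l (show k + 1 ≠ k + 3 by omega)] at h
  apply mul_left_cancel₀ (ladder_ne_zero hk)
  linarith

/-- At order 0 raising and lowering lead to the same harmonic, so L_1 has no factor ½ there. This is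
where the 2 comes from, and why √2 appears in the harmonics of nonzero order. -/
theorem integral_natC_sq_one {l : ℕ} (hl : 0 < l) :
    ∫ x, natC l 0 x * natC l 0 x ∂sphMeas = 2 * ∫ x, natC l 1 x * natC l 1 x ∂sphMeas := by
  have h := integral_mul_rotD (smoothS2_natC l 1) (smoothS2_natC l 0) 1
  have e1 : ∀ x, natC l 1 x * rotD 1 (natC l 0) x
      = -(ladder l 0) * (natC l 1 x * natC l 1 x) := fun x => by
    rw [rotD_one_natC_zero]; ring
  have e2 : ∀ x, natC l 0 x * rotD 1 (natC l 1) x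
      = -(ladder l (1 : ℕ) / 2) * (natC l 0 x * natC l 2 x)
        + ladder l 0 / 2 * (natC l 0 x * natC l 0 x) := fun x => by
    have := rotD_one_natC_succ l 0 x
    simp only [zero_add] at this
    rw [this]; push_cast; ring
  have hI := fun a b => ((smoothS2_natC l a).mul (smoothS2_natC l b)).integrable
  simp only [e1, e2] at h
  rw [integral_add ((hI _ _).const_mul _) ((hI _ _).const_mul _)] at h
  simp only [integral_const_mul] at h
  rw [integral_natC_mul_natC l (show 0 ≠ 2 by omega)] at h
  have h0 := ladder_ne_zero hl
  rw [Nat.cast_zero] at h0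
  apply mul_left_cancel₀ h0
  linarith

/-- The squared norm of the spherical harmonics for `sphMeas`. -/
def harmNormSq : ℝ := 1 / (4 * Real.pi) * sphMeas.real univ

theorem sphMeas_pos : 0 < sphMeas.real univ := by
  rw [Measure.real, ENNReal.toReal_pos_iff]
  refine ⟨isOpen_univ.measure_pos _ ⟨⟨EuclideanSpace.single 0 1, by simp⟩, mem_univ _⟩,
    measure_lt_top _ _⟩

theorem harmNormSq_pos : 0 < harmNormSq := by
  have := sphMeas_pos
  have := Real.pi_pos
  unfold harmNormSq; positivity

/-- The norms of all orders are tied together, and their sum is the integral of the constant in the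
addition theorem. No Legendre function is integrated and the mass of the sphere is not computed. -/
theorem integral_natC_sq (l : ℕ) : ∫ x, natC l 0 x * natC l 0 x ∂sphMeas = harmNormSq ∧
    ∀ k, k < l → 2 * ∫ x, natC l (k + 1) x * natC l (k + 1) x ∂sphMeas = harmNormSq := by
  set q := ∫ x, natC l 0 x * natC l 0 x ∂sphMeas with hq
  have h1 : ∀ k, k < l → 2 * ∫ x, natC l (k + 1) x * natC l (k + 1) x ∂sphMeas = q := by
    intro k
    induction k with
    | zero => intro hk; rw [zero_add, ← integral_natC_sq_one hk]
    | succ k ih => intro hk; rw [integral_natC_sq_succ l hk, ih (by omega)]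
  suffices q = harmNormSq by rw [← this]; exact ⟨rfl, h1⟩
  have hI := fun k => ((smoothS2_natC l k).mul (smoothS2_natC l k)).integrable
  have hI' := fun k => ((smoothS2_natS l k).mul (smoothS2_natS l k)).integrable
  have hs : ∫ x, harmSum l x ∂sphMeas = (2 * l + 1) * q := by
    simp only [harmSum, pow_two]
    have hk : ∀ k, Integrable (fun x => natC l (k + 1) x * natC l (k + 1) x
        + natS l (k + 1) x * natS l (k + 1) x) sphMeas := fun k => (hI (k + 1)).add (hI' (k + 1))
    rw [integral_add (hI 0) ((integrable_finsetSum _ fun k _ => hk k).const_mul 2),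
      integral_const_mul, integral_finsetSum _ fun k _ => hk k]
    have : ∀ k ∈ Finset.range l, ∫ x, (natC l (k + 1) x * natC l (k + 1) x
        + natS l (k + 1) x * natS l (k + 1) x) ∂sphMeas = q := by
      intro k hk
      rw [integral_add (hI (k + 1)) (hI' (k + 1)), integral_natS_sq l (Nat.succ_ne_zero k),
        ← h1 k (Finset.mem_range.1 hk)]
      ring
    rw [Finset.sum_congr rfl this]
    simp
    ring
  simp only [harmSum_eq, integral_const, smul_eq_mul] at hs
  have hl : (2 * (l : ℝ) + 1) ≠ 0 := by positivity
  have hpi := Real.pi_pos.ne'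
  apply mul_left_cancel₀ hl
  rw [← hs, harmNormSq]
  field_simp

theorem realY_of_neg {l : ℕ} {m : ℤ} (hm : |m| ≤ l) (h : m < 0) :
    realY ⟨l, m, hm⟩ = fun x => Real.sqrt 2 * natS l m.natAbs x := by
  funext x
  simp only [realY, azimuthal, h.ne, h.not_gt, if_false, natS, harmPoly,
    sinPart, harmNorm, Polynomial.eval_mul, Polynomial.eval_C]
  ring

theorem realY_of_zero {l : ℕ} (hm : |(0 : ℤ)| ≤ l) : realY ⟨l, 0, hm⟩ = natC l 0 := by
  funext x
  simp [realY, azimuthal, natC, harmPoly, cosPart, harmNorm]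

theorem realY_of_pos {l : ℕ} {m : ℤ} (hm : |m| ≤ l) (h : 0 < m) :
    realY ⟨l, m, hm⟩ = fun x => Real.sqrt 2 * natC l m.natAbs x := by
  funext x
  simp only [realY, azimuthal, h.ne', h, if_false, if_true, natC, harmPoly,
    cosPart, harmNorm, Polynomial.eval_mul, Polynomial.eval_C]
  ring

theorem integral_realY_sq (i : HarmonicIndex) :
    ∫ x, realY i x * realY i x ∂sphMeas = harmNormSq := by
  obtain ⟨l, m, hm⟩ := i
  have e : ∀ a : ℝ, Real.sqrt 2 * a * (Real.sqrt 2 * a) = 2 * (a * a) := fun a => by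
    have := Real.mul_self_sqrt (show (0 : ℝ) ≤ 2 by norm_num)
    linear_combination a * a * this
  have hml : m ≠ 0 → ∃ k, m.natAbs = k + 1 ∧ k < l := fun h => by
    rw [Int.abs_eq_natAbs] at hm
    exact ⟨m.natAbs - 1, by omega, by omega⟩
  rcases lt_trichotomy m 0 with h | rfl | h
  · obtain ⟨k, hk, hkl⟩ := hml h.ne
    rw [realY_of_neg hm h]
    simp only [e, integral_const_mul]
    rw [integral_natS_sq l (by omega), hk, (integral_natC_sq l).2 k hkl]
  · rw [realY_of_zero]; exact (integral_natC_sq l).1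
  · obtain ⟨k, hk, hkl⟩ := hml h.ne'
    rw [realY_of_pos hm h]
    simp only [e, integral_const_mul]
    rw [hk, (integral_natC_sq l).2 k hkl]

theorem rotD_two_two_realY (i : HarmonicIndex) (x : S2) :
    rotD 2 (rotD 2 (realY i)) x = -(i.2.1.natAbs : ℝ) ^ 2 * realY i x := by
  obtain ⟨l, m, hm⟩ := i
  rcases lt_trichotomy m 0 with h | rfl | h
  · rw [realY_of_neg hm h, rotD_congr (rotD_const_mul (smoothS2_natS _ _) _ 2),
      rotD_const_mul ((smoothS2_natS _ _).rotD 2), rotD_two_two_natS]; ring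
  · rw [realY_of_zero, rotD_two_two_natC]; simp
  · rw [realY_of_pos hm h, rotD_congr (rotD_const_mul (smoothS2_natC _ _) _ 2),
      rotD_const_mul ((smoothS2_natC _ _).rotD 2), rotD_two_two_natC]; ring

/-- Different degrees are separated by Δ, different |m| by L_2², and the pair m, -m by skewness of
L_2. -/
theorem integral_realY_mul_realY {i j : HarmonicIndex} (hij : i ≠ j) :
    ∫ x, realY i x * realY j x ∂sphMeas = 0 := by
  by_cases hl : i.1 = j.1
  · by_cases hm : i.2.1.natAbs = j.2.1.natAbs
    · obtain ⟨l, m, hm1⟩ := i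
      obtain ⟨l', m', hm2⟩ := j
      obtain rfl : l = l' := hl
      have hne : m ≠ m' := fun h => hij (by subst h; rfl)
      simp only at hm
      have e : ∀ a b : ℝ, Real.sqrt 2 * a * (Real.sqrt 2 * b) = 2 * (a * b) := fun a b => by
        have := Real.mul_self_sqrt (show (0 : ℝ) ≤ 2 by norm_num)
        linear_combination a * b * this
      have h0 := integral_natC_mul_natS l m'.natAbs
      rcases lt_trichotomy m 0 with h | rfl | h
      · have h' : 0 < m' := by omega
        rw [realY_of_neg hm1 h, realY_of_pos hm2 h', hm]
        simp only [e, integral_const_mul]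
        simp only [mul_comm (natS l _ _), h0, mul_zero]
      · omega
      · have h' : m' < 0 := by omega
        rw [realY_of_pos hm1 h, realY_of_neg hm2 h', hm]
        simp only [e, integral_const_mul, h0, mul_zero]
    · exact integral_eigen_eq_zero (T := fun f => rotD 2 (rotD 2 f)) (neg_sq_ne hm)
        (integral_mul_rotD_rotD (smoothS2_realY _) (smoothS2_realY _) 2) (rotD_two_two_realY i)
        (rotD_two_two_realY j)
  · refine integral_eigen_eq_zero (T := lap) ?_
      (integral_mul_lap (smoothS2_realY i) (smoothS2_realY j)) (lap_realY i) (lap_realY j)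
    intro h
    apply hl
    have h1 : (0 : ℝ) ≤ i.1 := by positivity
    have h2 : (0 : ℝ) ≤ j.1 := by positivity
    have h3 : ((i.1 : ℝ) - j.1) * (i.1 + j.1 + 1) = 0 := by linarith
    rcases mul_eq_zero.1 h3 with h4 | h4
    · exact_mod_cast sub_eq_zero.1 h4
    · linarith

/-! ### Completeness of the spherical harmonics -/

open MeasureTheory

theorem integrable_mul {f g : S2 → ℝ} (hf : Continuous f) (hg : Continuous g) :
    Integrable (fun x => f x * g x) sphMeas := integrable_of_continuous (hf.mul hg)

/-- `g` is orthogonal to all products `p(x₃) Re (x₁ + i x₂)^k` and `p(x₃) Im (x₁ + i x₂)^k`. -/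
def PerpHarmonics (g : S2 → ℝ) : Prop := ∀ (p : Polynomial ℝ) (k : ℕ),
  ∫ x, g x * (p.eval ((x : E3) 2) * cosPart k x) ∂sphMeas = 0 ∧
  ∫ x, g x * (p.eval ((x : E3) 2) * sinPart k x) ∂sphMeas = 0

theorem coeff_iterate_derivative_legendreP_pos (n k : ℕ) :
    0 < (Polynomial.derivative^[k] (legendreP (n + k))).coeff n := by
  rw [Polynomial.coeff_iterate_derivative, nsmul_eq_mul]
  exact mul_pos (by exact_mod_cast (Nat.descFactorial_pos.2 (Nat.le_add_left k n)))
    (natDegree_legendreP_le_and_coeff_pos (n + k)).2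

theorem coeff_iterate_derivative_legendreP_eq_zero {n k m : ℕ} (h : n < m) :
    (Polynomial.derivative^[k] (legendreP (n + k))).coeff m = 0 := by
  rw [Polynomial.coeff_iterate_derivative, Polynomial.coeff_eq_zero_of_natDegree_lt, nsmul_zero]
  have := (natDegree_legendreP_le_and_coeff_pos (n + k)).1
  omega

theorem harmNorm_pos (l k : ℕ) : 0 < harmNorm l k := by
  have := Real.pi_pos
  unfold harmNorm; positivity

theorem integral_mul_natC_natS_eq_zero {g : S2 → ℝ}
    (h : ∀ i, ∫ x, g x * realY i x ∂sphMeas = 0) {l k : ℕ} (hk : k ≤ l) :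
    ∫ x, g x * natC l k x ∂sphMeas = 0 ∧ ∫ x, g x * natS l k x ∂sphMeas = 0 := by
  rcases Nat.eq_zero_or_pos k with rfl | hk0
  · have h0 := h ⟨l, 0, by simp⟩
    rw [realY_of_zero] at h0
    exact ⟨h0, by simp [natS_zero]⟩
  · have e : ∀ a b : ℝ, a * (Real.sqrt 2 * b) = Real.sqrt 2 * (a * b) := fun a b => by ring
    have h2 : Real.sqrt 2 ≠ 0 := by positivity
    have hp := h ⟨l, (k : ℤ), by rw [Nat.abs_cast]; exact_mod_cast hk⟩
    have hn := h ⟨l, -(k : ℤ), by rw [abs_neg, Nat.abs_cast]; exact_mod_cast hk⟩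
    rw [realY_of_pos _ (by exact_mod_cast hk0)] at hp
    rw [realY_of_neg _ (by simpa using hk0)] at hn
    simp only [e, integral_const_mul, Int.natAbs_neg, Int.natAbs_natCast] at hp hn
    exact ⟨(mul_eq_zero.1 hp).resolve_left h2, (mul_eq_zero.1 hn).resolve_left h2⟩

/-- For fixed k the k-th derivative of P_{n+k} has exact degree n, so subtracting a multiple of it
lowers the degree of p. The induction is on a strict bound for the degree. -/
theorem perpHarmonics_of_realY {g : S2 → ℝ} (hg : Continuous g)
    (h : ∀ i, ∫ x, g x * realY i x ∂sphMeas = 0) : PerpHarmonics g := by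
  suffices H : ∀ n : ℕ, ∀ (p : Polynomial ℝ), p.degree < n → ∀ k : ℕ,
      ∫ x, g x * (p.eval ((x : E3) 2) * cosPart k x) ∂sphMeas = 0 ∧
      ∫ x, g x * (p.eval ((x : E3) 2) * sinPart k x) ∂sphMeas = 0 by
    intro p k
    exact H (p.natDegree + 1) p (lt_of_le_of_lt Polynomial.degree_le_natDegree
      (by exact_mod_cast Nat.lt_succ_self _)) k
  intro n
  induction n with
  | zero =>
    intro p hp k
    have : p = 0 := by
      rw [← Polynomial.degree_eq_bot]; simpa using hp
    simp [this]
  | succ n ih =>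
    intro p hp k
    set q := harmPoly (n + k) k with hq
    have hqn : q.coeff n ≠ 0 := by
      rw [hq, harmPoly, Polynomial.coeff_C_mul]
      exact (mul_pos (harmNorm_pos (n + k) k)
        (coeff_iterate_derivative_legendreP_pos n k)).ne'
    set a := p.coeff n / q.coeff n
    have hr : (p - Polynomial.C a * q).degree < n := by
      rw [Polynomial.degree_lt_iff_coeff_zero] at hp ⊢
      intro m hm
      rw [Polynomial.coeff_sub, Polynomial.coeff_C_mul]
      rcases hm.eq_or_lt with rfl | hm
      · simp [a, div_mul_cancel₀ _ hqn]
      · rw [hp m hm, hq, harmPoly, Polynomial.coeff_C_mul,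
          coeff_iterate_derivative_legendreP_eq_zero hm]
        simp
    have e : ∀ x : E3, p.eval (x 2) = (p - Polynomial.C a * q).eval (x 2) + a * q.eval (x 2) :=
      fun x => by simp
    obtain ⟨h1, h2⟩ := ih _ hr k
    obtain ⟨h3, h4⟩ := integral_mul_natC_natS_eq_zero h (Nat.le_add_left k n)
    have I1 := integrable_mul hg
      (smoothS2_polyCos (p - Polynomial.C a * q) k).continuous
    have I2 := integrable_mul hg
      (smoothS2_polySin (p - Polynomial.C a * q) k).continuous
    have I3 := integrable_mul hg (smoothS2_natC (n + k) k).continuous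
    have I4 := integrable_mul hg (smoothS2_natS (n + k) k).continuous
    have e1 : ∀ x : S2, g x * (p.eval ((x : E3) 2) * cosPart k x)
        = g x * ((p - Polynomial.C a * q).eval ((x : E3) 2) * cosPart k x)
          + a * (g x * natC (n + k) k x) := fun x => by
      rw [e, natC]; ring
    have e2 : ∀ x : S2, g x * (p.eval ((x : E3) 2) * sinPart k x)
        = g x * ((p - Polynomial.C a * q).eval ((x : E3) 2) * sinPart k x)
          + a * (g x * natS (n + k) k x) := fun x => by
      rw [e, natS]; ring
    constructor
    · simp only [e1]
      rw [integral_add I1 (I3.const_mul a), integral_const_mul, h1, h3]; simp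
    · simp only [e2]
      rw [integral_add I2 (I4.const_mul a), integral_const_mul, h2, h4]; simp

theorem sphere_cosPart_sinPart (k : ℕ) (x : S2) :
    2 * ((x : E3) 0 * cosPart (k + 1) x) = cosPart (k + 2) x + (1 - (x : E3) 2 ^ 2) * cosPart k x ∧
    2 * ((x : E3) 0 * sinPart (k + 1) x) = sinPart (k + 2) x + (1 - (x : E3) 2 ^ 2) * sinPart k x ∧
    2 * ((x : E3) 1 * cosPart (k + 1) x) = sinPart (k + 2) x - (1 - (x : E3) 2 ^ 2) * sinPart k x ∧
    2 * ((x : E3) 1 * sinPart (k + 1) x)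
      = (1 - (x : E3) 2 ^ 2) * cosPart k x - cosPart (k + 2) x := by
  have h := sphere_eq x
  have h' : 1 - (x : E3) 2 ^ 2 = (x : E3) 0 ^ 2 + (x : E3) 1 ^ 2 := by linarith
  rw [h', cosPart_succ (k + 1), sinPart_succ (k + 1), cosPart_succ k, sinPart_succ k]
  refine ⟨?_, ?_, ?_, ?_⟩ <;> ring

theorem integral_half_combination {f u v : S2 → ℝ} {g : S2 → ℝ} (σ : ℝ)
    (hu : Continuous fun x => g x * u x) (hv : Continuous fun x => g x * v x)
    (hf : ∀ x, 2 * f x = u x + σ * v x) (h1 : ∫ x, g x * u x ∂sphMeas = 0)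
    (h2 : ∫ x, g x * v x ∂sphMeas = 0) : ∫ x, g x * f x ∂sphMeas = 0 := by
  have e : ∀ x, g x * f x = 1 / 2 * (g x * u x) + σ / 2 * (g x * v x) := fun x => by
    linear_combination g x / 2 * hf x
  simp only [e]
  rw [integral_add ((integrable_of_continuous hu).const_mul _)
    ((integrable_of_continuous hv).const_mul _), integral_const_mul, integral_const_mul, h1, h2]
  simp

/-- On the sphere the products p(x₃) Re (x₁ + i x₂)^k and p(x₃) Im (x₁ + i x₂)^k span a space stable
under multiplication by coordinates; the factor x_i is moved onto the test function. -/
theorem PerpHarmonics.coord_mul {g : S2 → ℝ} (hg : Continuous g) (h : PerpHarmonics g)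
    (i : Fin 3) : PerpHarmonics fun x => (x : E3) i * g x := by
  have cC := fun p k => hg.mul (smoothS2_polyCos p k).continuous
  have cS := fun p k => hg.mul (smoothS2_polySin p k).continuous
  have ew : ∀ (p : Polynomial ℝ) (z : ℝ), (p * (1 - Polynomial.X ^ 2)).eval z
      = p.eval z * (1 - z ^ 2) := fun p z => by simp
  intro p k
  fin_cases i
  · have e : ∀ x : S2, ∀ a : ℝ, (x : E3) 0 * g x * a = g x * ((x : E3) 0 * a) := fun x a => by ring
    simp only [Fin.zero_eta, e]
    rcases k with _ | k
    · have h1 := (h p 1).1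
      simp only [cosPart_zero, sinPart_zero, mul_zero, integral_zero, and_true]
      refine Eq.trans (integral_congr_ae (Eventually.of_forall fun x => ?_)) h1
      simp only [cosPart_succ 0, cosPart_zero, sinPart_zero]; ring
    · constructor
      · refine integral_half_combination 1 (cC p (k + 2)) (cC (p * (1 - Polynomial.X ^ 2)) k)
          (fun x => ?_) (h _ _).1 (h _ _).1
        rw [ew]; linear_combination p.eval ((x : E3) 2) * (sphere_cosPart_sinPart k x).1
      · refine integral_half_combination 1 (cS p (k + 2)) (cS (p * (1 - Polynomial.X ^ 2)) k)
          (fun x => ?_) (h _ _).2 (h _ _).2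
        rw [ew]; linear_combination p.eval ((x : E3) 2) * (sphere_cosPart_sinPart k x).2.1
  · have e : ∀ x : S2, ∀ a : ℝ, (x : E3) 1 * g x * a = g x * ((x : E3) 1 * a) := fun x a => by ring
    simp only [Fin.mk_one, e]
    rcases k with _ | k
    · have h1 := (h p 1).2
      simp only [cosPart_zero, sinPart_zero, mul_zero, integral_zero, and_true]
      refine Eq.trans (integral_congr_ae (Eventually.of_forall fun x => ?_)) h1
      simp only [sinPart_succ 0, cosPart_zero, sinPart_zero]; ring
    · constructor
      · refine integral_half_combination (-1) (cS p (k + 2)) (cS (p * (1 - Polynomial.X ^ 2)) k)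
          (fun x => ?_) (h _ _).2 (h _ _).2
        rw [ew]; linear_combination p.eval ((x : E3) 2) * (sphere_cosPart_sinPart k x).2.2.1
      · refine integral_half_combination (-1) (cC (p * (1 - Polynomial.X ^ 2)) k) (cC p (k + 2))
          (fun x => ?_) (h _ _).1 (h _ _).1
        rw [ew]; linear_combination p.eval ((x : E3) 2) * (sphere_cosPart_sinPart k x).2.2.2
  · have h1 := h (p * Polynomial.X) k
    have e : ∀ x : S2, ∀ a : ℝ, (x : E3) 2 * g x * (p.eval ((x : E3) 2) * a)
        = g x * ((p * Polynomial.X).eval ((x : E3) 2) * a) := fun x a => by simp; ring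
    simp only [Fin.reduceFinMk, e]
    exact h1

/-- The coordinate functions of the sphere. -/
def coordMap (i : Fin 3) : C(S2, ℝ) :=
  ⟨fun x => (x : E3) i, ((contDiff_coord i).continuous).comp continuous_subtype_val⟩

theorem separatesPoints_coordMap :
    (Algebra.adjoin ℝ (range coordMap)).SeparatesPoints := by
  intro x y hxy
  have : ∃ i, (x : E3) i ≠ (y : E3) i := by
    by_contra! h
    exact hxy (Subtype.ext (PiLp.ext h))
  obtain ⟨i, hi⟩ := this
  exact ⟨coordMap i, ⟨coordMap i, Algebra.subset_adjoin ⟨i, rfl⟩, rfl⟩, hi⟩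

/-- The functions orthogonal to all harmonics form a module over the polynomial functions. -/
theorem PerpHarmonics.mul {h : C(S2, ℝ)} (hh : h ∈ Algebra.adjoin ℝ (range coordMap)) :
    ∀ g : C(S2, ℝ), PerpHarmonics g → PerpHarmonics (h * g : C(S2, ℝ)) := by
  induction hh using Algebra.adjoin_induction with
  | mem _ hx =>
    obtain ⟨i, rfl⟩ := hx
    exact fun g hg => hg.coord_mul g.continuous i
  | algebraMap r =>
    intro g hg p k
    have e : ∀ (x : S2) (a : ℝ), (algebraMap ℝ C(S2, ℝ) r * g) x * a = r * (g x * a) :=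
      fun x a => by simp [mul_assoc]
    simp only [e, integral_const_mul, (hg p k).1, (hg p k).2, mul_zero, and_self]
  | add a b _ _ ha hb =>
    intro g hg p k
    have e : ∀ (x : S2) (t : ℝ), ((a + b) * g) x * t = (a * g) x * t + (b * g) x * t :=
      fun x t => by simp [add_mul]
    have c := fun (f : C(S2, ℝ)) =>
      integrable_mul f.continuous (smoothS2_polyCos p k).continuous
    have s := fun (f : C(S2, ℝ)) =>
      integrable_mul f.continuous (smoothS2_polySin p k).continuous
    simp only [e]
    rw [integral_add (c _) (c _), integral_add (s _) (s _)]
    have h1 := ha g hg p k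
    have h2 := hb g hg p k
    rw [h1.1, h1.2, h2.1, h2.2]; simp
  | mul a b _ _ ha hb =>
    intro g hg
    rw [mul_assoc]
    exact ha _ (hb g hg)

/-- A continuous function that is orthogonal to all spherical harmonics vanishes. -/
theorem eq_zero_of_integral_mul_realY {g : S2 → ℝ} (hg : Continuous g)
    (h : ∀ i, ∫ x, g x * realY i x ∂sphMeas = 0) (x : S2) : g x = 0 := by
  have hp := perpHarmonics_of_realY hg h
  obtain ⟨C, hC⟩ := exists_abs_le_of_continuous hg
  have hC0 : 0 ≤ C := (abs_nonneg _).trans (hC x)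
  have hi2 : Integrable (fun x => g x * g x) sphMeas := integrable_of_continuous (hg.mul hg)
  have hle : ∀ ε > 0, ∫ x, g x * g x ∂sphMeas ≤ (C * sphMeas.real univ) * ε := by
    intro ε hε
    -- Stone-Weierstrass: a polynomial `u` lies within ε of `g`. As `u g` is again orthogonal to the
    -- harmonics, in particular to 1, the integral of g² is that of g (g - u), which is of order ε.
    obtain ⟨u, hu⟩ := ContinuousMap.exists_mem_subalgebra_near_continuous_of_separatesPoints
      (Algebra.adjoin ℝ (range coordMap)) separatesPoints_coordMap g hg ε hε
    have h1 := (PerpHarmonics.mul u.2 ⟨g, hg⟩ hp 1 0).1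
    have h2 : ∫ x, (u : C(S2, ℝ)) x * g x ∂sphMeas = 0 := by
      simpa [cosPart_zero] using h1
    have hiu : Integrable (fun x => (u : C(S2, ℝ)) x * g x) sphMeas :=
      integrable_of_continuous ((u : C(S2, ℝ)).continuous.mul hg)
    have h3 : ∫ x, g x * g x ∂sphMeas = ∫ x, (g x * g x - (u : C(S2, ℝ)) x * g x) ∂sphMeas := by
      rw [integral_sub hi2 hiu, h2, sub_zero]
    rw [h3]
    calc _ ≤ ∫ _, C * ε ∂sphMeas := by
          refine integral_mono (hi2.sub hiu) (integrable_const _) fun x => ?_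
          have := hu x
          rw [Real.norm_eq_abs] at this
          calc g x * g x - (u : C(S2, ℝ)) x * g x = g x * -((u : C(S2, ℝ)) x - g x) := by ring
            _ ≤ |g x * -((u : C(S2, ℝ)) x - g x)| := le_abs_self _
            _ ≤ C * ε := by
              rw [abs_mul, abs_neg]
              exact mul_le_mul (hC x) this.le (abs_nonneg _) hC0
      _ = _ := by rw [integral_const, smul_eq_mul]; ring
  have h0 : ∫ x, g x * g x ∂sphMeas ≤ 0 := by
    have ht : Tendsto (fun ε : ℝ => (C * sphMeas.real univ) * ε) (𝓝[>] 0)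
        (𝓝 ((C * sphMeas.real univ) * 0)) :=
      ((continuous_const.mul continuous_id).tendsto 0).mono_left nhdsWithin_le_nhds
    rw [mul_zero] at ht
    exact ge_of_tendsto ht (eventually_mem_nhdsWithin.mono hle)
  by_contra hx
  have := (hg.mul hg).integral_pos_of_hasCompactSupport_nonneg_nonzero (μ := sphMeas) (x := x)
    (HasCompactSupport.of_compactSpace _) (fun x => mul_self_nonneg _) (mul_ne_zero hx hx)
  exact absurd this (not_lt.2 h0)

/-! ### Rapidly decreasing coefficients -/

/-- Because |m| ≤ l, the exponent 4 splits into a summable square in l and a summable square in m.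
-/
theorem summable_harmonicIndex : Summable fun i : HarmonicIndex => (((i.1 : ℝ) + 1) ^ 4)⁻¹ := by
  have h1 : Summable fun n : ℕ => (((n : ℝ) + 1) ^ 2)⁻¹ := by
    have := (summable_nat_add_iff 1).2 (Real.summable_nat_pow_inv.2 (le_refl 2 : 1 < 2))
    exact_mod_cast this
  have h2 : Summable fun m : ℤ => (((m.natAbs : ℝ) + 1) ^ 2)⁻¹ := by
    refine Summable.of_nat_of_neg ?_ ?_ <;> simpa using h1
  have h3 := h1.mul_of_nonneg h2 (fun n => by positivity) (fun m => by positivity)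
  have hinj : Function.Injective fun i : HarmonicIndex => (i.1, i.2.1) := by
    rintro ⟨l, m, hm⟩ ⟨l', m', hm'⟩ h
    simp only [Prod.mk.injEq] at h
    obtain ⟨rfl, rfl⟩ := h
    rfl
  refine Summable.of_nonneg_of_le (fun i => by positivity) (fun i => ?_) (h3.comp_injective hinj)
  have hm : (i.2.1.natAbs : ℝ) ≤ i.1 := by
    have := i.2.2
    rw [Int.abs_eq_natAbs] at this
    exact_mod_cast this
  simp only [Function.comp_apply]
  rw [← mul_inv]
  apply inv_anti₀ (by positivity)
  calc ((i.1 : ℝ) + 1) ^ 2 * ((i.2.1.natAbs : ℝ) + 1) ^ 2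
      ≤ ((i.1 : ℝ) + 1) ^ 2 * ((i.1 : ℝ) + 1) ^ 2 := by gcongr
    _ = _ := by ring

theorem RapidlyDecreasing.summable {c : HarmonicIndex → ℝ} (hc : RapidlyDecreasing c) (n : ℕ) :
    Summable fun i => |c i| * ((i.1 : ℝ) + 1) ^ n := by
  obtain ⟨C, hC⟩ := hc (n + 4)
  refine Summable.of_nonneg_of_le (fun i => by positivity) (fun i => ?_)
    (summable_harmonicIndex.mul_left C)
  rw [← div_eq_mul_inv, le_div_iff₀ (by positivity)]
  calc _ = ((i.1 : ℝ) + 1) ^ (n + 4) * |c i| := by ring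
    _ ≤ C := hC i

theorem RapidlyDecreasing.of_le {c d : HarmonicIndex → ℝ} (hc : RapidlyDecreasing c) {B : ℝ}
    {n : ℕ} (h : ∀ i, |d i| ≤ B * ((i.1 : ℝ) + 1) ^ n * |c i|) : RapidlyDecreasing d := by
  intro k
  obtain ⟨C, hC⟩ := hc (k + n)
  refine ⟨|B| * C, fun i => ?_⟩
  calc ((i.1 : ℝ) + 1) ^ k * |d i|
      ≤ ((i.1 : ℝ) + 1) ^ k * (B * ((i.1 : ℝ) + 1) ^ n * |c i|) := by gcongr; exact h i
    _ = B * (((i.1 : ℝ) + 1) ^ (k + n) * |c i|) := by ring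
    _ ≤ |B| * (((i.1 : ℝ) + 1) ^ (k + n) * |c i|) := by gcongr; exact le_abs_self B
    _ ≤ |B| * C := by gcongr; exact hC i

/-! ### Sums over modes -/

/-- Families of functions of `s` that are bounded by powers of `l`, locally uniformly in `s`. -/
def ModeBounded (f : ℕ → ℝ → ℝ) : Prop :=
  ∀ r < 1, ∃ (n : ℕ) (C : ℝ), ∀ l s, |s| ≤ r → |f l s| ≤ C * ((l : ℝ) + 1) ^ n

/-- The sum `∑ c_{l,m} f_l(s) (L_W Y_{l,m})(x)`, where `L_W` is a product of rotational
derivatives. -/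
def modeSum (f : ℕ → ℝ → ℝ) (W : List (Fin 3)) (c : HarmonicIndex → ℝ) (s : ℝ) (x : S2) : ℝ :=
  ∑' i, c i * f i.1 s * rotWord W (realY i) x

theorem abs_modeTerm_le {C : ℝ} {n l : ℕ} {a : ℝ} (c : ℝ) (ha : |a| ≤ C * ((l : ℝ) + 1) ^ n)
    (W : List (Fin 3)) {i : HarmonicIndex} (hi : i.1 = l) (x : S2) :
    |c * a * rotWord W (realY i) x|
      ≤ 2 * C * (|c| * ((i.1 : ℝ) + 1) ^ (n + (W.length + 1))) := by
  have h := abs_rotWord_realY_le W i x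
  subst hi
  have h0 := (abs_nonneg a).trans ha
  rw [abs_mul, abs_mul]
  calc _ ≤ |c| * (C * ((i.1 : ℝ) + 1) ^ n) * (2 * ((i.1 : ℝ) + 1) ^ (W.length + 1)) := by
        gcongr
    _ = _ := by ring

theorem summable_modeTerm {f : ℕ → ℝ → ℝ} (hf : ModeBounded f) (W : List (Fin 3))
    {c : HarmonicIndex → ℝ} (hc : RapidlyDecreasing c) {s : ℝ} (hs : s ∈ Ioo (-1 : ℝ) 1) (x : S2) :
    Summable fun i => c i * f i.1 s * rotWord W (realY i) x := by
  obtain ⟨n, C, hC⟩ := hf |s| (abs_lt.2 hs)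
  refine Summable.of_norm_bounded ((hc.summable (n + (W.length + 1))).mul_left (2 * C))
    fun i => ?_
  exact abs_modeTerm_le _ (hC _ _ le_rfl) W rfl x

/-- The linear form on `ℝ × E3` with time component `a` and rotational components `b`. -/
def gradForm (y : E3) (a : ℝ) (b : Fin 3 → ℝ) : ℝ × E3 →L[ℝ] ℝ :=
  a • ContinuousLinearMap.fst ℝ ℝ E3 + ∑ j, ((‖y‖ ^ 2)⁻¹ * b j) •
    (innerSL ℝ (rotGen j y)).comp (ContinuousLinearMap.snd ℝ ℝ E3)

theorem gradForm_apply (y : E3) (a : ℝ) (b : Fin 3 → ℝ) (v : ℝ × E3) :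
    gradForm y a b v = v.1 * a + ∑ j, (‖y‖ ^ 2)⁻¹ * b j * inner ℝ (rotGen j y) v.2 := by
  simp [gradForm, mul_comm]

theorem norm_gradForm_le (y : E3) (a : ℝ) (b : Fin 3 → ℝ) :
    ‖gradForm y a b‖ ≤ |a| + ∑ j, (‖y‖ ^ 2)⁻¹ * (‖rotGen j‖ * ‖y‖) * |b j| := by
  refine ContinuousLinearMap.opNorm_le_bound _ (by positivity) fun v => ?_
  rw [gradForm_apply, add_mul, Finset.sum_mul, Real.norm_eq_abs]
  refine (abs_add_le _ _).trans (add_le_add ?_ ((Finset.abs_sum_le_sum_abs _ _).trans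
    (Finset.sum_le_sum fun j _ => ?_)))
  · rw [abs_mul, mul_comm]
    exact mul_le_mul_of_nonneg_left (norm_fst_le v) (abs_nonneg a)
  · have h1 : |inner ℝ (rotGen j y) v.2| ≤ ‖rotGen j‖ * ‖y‖ * ‖v‖ :=
      (abs_real_inner_le_norm _ _).trans (mul_le_mul ((rotGen j).le_opNorm y) (norm_snd_le v)
        (norm_nonneg _) (by positivity))
    have h2 : |(‖y‖ ^ 2)⁻¹| = (‖y‖ ^ 2)⁻¹ := abs_of_nonneg (by positivity)
    rw [abs_mul, abs_mul, h2]
    calc _ ≤ (‖y‖ ^ 2)⁻¹ * |b j| * (‖rotGen j‖ * ‖y‖ * ‖v‖) := by gcongr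
      _ = _ := by ring

theorem hasFDerivAt_mul_radialExt {a : ℝ → ℝ} {a' : ℝ} {g : S2 → ℝ} (hg : SmoothS2 g) {p : ℝ × E3}
    (hp : p.2 ≠ 0) (ha : HasDerivAt a a' p.1) :
    HasFDerivAt (fun q : ℝ × E3 => a q.1 * radialExt g q.2)
      (gradForm p.2 (a' * radialExt g p.2) fun j => a p.1 * radialExt (rotD j g) p.2) p := by
  have h1 : HasFDerivAt (fun q : ℝ × E3 => a q.1) (a' • ContinuousLinearMap.fst ℝ ℝ E3) p :=
    ha.comp_hasFDerivAt p (hasFDerivAt_fst (p := p))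
  have hd := hg.differentiableAt hp
  have h2 : HasFDerivAt (fun q : ℝ × E3 => radialExt g q.2)
      ((fderiv ℝ (radialExt g) p.2).comp (ContinuousLinearMap.snd ℝ ℝ E3)) p :=
    hd.hasFDerivAt.comp p (hasFDerivAt_snd (p := p))
  refine (h1.mul h2).congr_fderiv ?_
  refine ContinuousLinearMap.ext fun v => ?_
  rw [gradForm_apply]
  simp only [add_apply, smul_apply, smul_eq_mul,
    ContinuousLinearMap.comp_apply, ContinuousLinearMap.coe_fst', ContinuousLinearMap.coe_snd']
  rw [fderiv_radialExt hp hd, Finset.mul_sum, add_comm]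
  congr 1
  · ring
  · exact Finset.sum_congr rfl fun j _ => by ring

theorem flatExt_modeSum (f : ℕ → ℝ → ℝ) (W : List (Fin 3)) (c : HarmonicIndex → ℝ) {p : ℝ × E3}
    (hp : p.2 ≠ 0) : flatExt (modeSum f W c) p
      = ∑' i, c i * f i.1 p.1 * radialExt (rotWord W (realY i)) p.2 := by
  rw [flatExt_eq _ hp, modeSum]
  exact tsum_congr fun i => by rw [radialExt_eq _ hp]

/-- Termwise differentiation. The total derivative is expressed through the s-derivative and the
three rotational derivatives, each of which is again a mode sum, so the class is closed under
differentiation. -/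
theorem hasFDerivAt_modeSum {f f' : ℕ → ℝ → ℝ} (hf : ModeBounded f) (hf' : ModeBounded f')
    (hd : ∀ l, ∀ s ∈ Ioo (-1 : ℝ) 1, HasDerivAt (f l) (f' l s) s) (W : List (Fin 3))
    {c : HarmonicIndex → ℝ} (hc : RapidlyDecreasing c) {p : ℝ × E3} (hp : p ∈ flatDom) :
    HasFDerivAt (flatExt (modeSum f W c))
      (gradForm p.2 (flatExt (modeSum f' W c) p) fun j => flatExt (modeSum f (j :: W) c) p) p := by
  obtain ⟨⟨hp1, hp2⟩, hp0 : p.2 ≠ 0⟩ := hp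
  have hn : 0 < ‖p.2‖ := norm_pos_iff.2 hp0
  -- The midpoint between |s| and 1: the mode bounds hold on |s| ≤ r.
  set r : ℝ := (1 + |p.1|) / 2 with hr
  have habs : |p.1| < 1 := abs_lt.2 ⟨hp1, hp2⟩
  obtain ⟨n, C, hC⟩ := hf r (by rw [hr]; linarith)
  obtain ⟨n', C', hC'⟩ := hf' r (by rw [hr]; linarith)
  -- A ball that stays within |s| ≤ r and keeps ‖y‖ between half and twice its value at p, so that
  -- `u` is a common summable majorant.
  set δ : ℝ := min ((1 - |p.1|) / 2) (‖p.2‖ / 2) with hδ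
  have hδ0 : 0 < δ := lt_min (by linarith) (by linarith)
  have hball : ∀ q ∈ Metric.ball p δ, |q.1| ≤ r ∧ ‖p.2‖ / 2 ≤ ‖q.2‖ ∧ ‖q.2‖ ≤ 2 * ‖p.2‖ := by
    intro q hq
    rw [Metric.mem_ball, dist_eq_norm] at hq
    have h1 := (norm_fst_le (q - p)).trans_lt hq
    have h2 := (norm_snd_le (q - p)).trans_lt hq
    rw [Prod.fst_sub, Real.norm_eq_abs] at h1
    rw [Prod.snd_sub] at h2
    have h1' := h1.trans_le (min_le_left _ _)
    have h2' := h2.trans_le (min_le_right _ _)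
    have h3 := abs_sub_abs_le_abs_sub q.1 p.1
    have h4 := abs_norm_sub_norm_le q.2 p.2
    have h5 := abs_le.1 h4
    exact ⟨by rw [hr]; linarith, by linarith, by linarith⟩
  have hsub : ∀ q ∈ Metric.ball p δ, q.1 ∈ Ioo (-1 : ℝ) 1 ∧ q.2 ≠ 0 := by
    intro q hq
    obtain ⟨h1, h2, -⟩ := hball q hq
    exact ⟨abs_lt.1 (by linarith), norm_pos_iff.1 (by linarith)⟩
  set T : HarmonicIndex → ℝ × E3 → ℝ := fun i q =>
    c i * f i.1 q.1 * radialExt (rotWord W (realY i)) q.2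
  set T' : HarmonicIndex → ℝ × E3 → (ℝ × E3 →L[ℝ] ℝ) := fun i q =>
    gradForm q.2 (c i * f' i.1 q.1 * radialExt (rotWord W (realY i)) q.2)
      fun j => c i * f i.1 q.1 * radialExt (rotWord (j :: W) (realY i)) q.2
  set u : HarmonicIndex → ℝ := fun i =>
    2 * C' * (|c i| * ((i.1 : ℝ) + 1) ^ (n' + (W.length + 1)))
      + ∑ j : Fin 3, ((‖p.2‖ / 2) ^ 2)⁻¹ * (‖rotGen j‖ * (2 * ‖p.2‖)) *
        (2 * C * (|c i| * ((i.1 : ℝ) + 1) ^ (n + ((W.length + 1) + 1))))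
  have hu : Summable u := by
    refine ((hc.summable _).mul_left _).add (summable_sum fun j _ => ?_)
    exact ((hc.summable _).mul_left _).mul_left _
  have hT : ∀ i, ∀ q ∈ Metric.ball p δ, HasFDerivAt (T i) (T' i q) q := by
    intro i q hq
    obtain ⟨h1, h2⟩ := hsub q hq
    exact hasFDerivAt_mul_radialExt ((smoothS2_realY i).rotWord W) h2
      ((hd i.1 q.1 h1).const_mul (c i))
  have hT' : ∀ i, ∀ q ∈ Metric.ball p δ, ‖T' i q‖ ≤ u i := by
    intro i q hq
    obtain ⟨h1, h2, h3⟩ := hball q hq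
    have hq2 := (hsub q hq).2
    refine (norm_gradForm_le _ _ _).trans (add_le_add ?_ (Finset.sum_le_sum fun j _ => ?_))
    · rw [radialExt_eq _ hq2]
      exact abs_modeTerm_le _ (hC' _ _ h1) W rfl _
    · have := abs_modeTerm_le (c i) (hC i.1 _ h1) (j :: W) rfl (proj q.2)
      rw [radialExt_eq _ hq2]
      rw [List.length_cons] at this
      gcongr
  have hsum : ∀ q ∈ Metric.ball p δ, Summable fun i => T i q := by
    intro q hq
    obtain ⟨h1, h2⟩ := hsub q hq
    simp only [T, radialExt_eq _ h2]
    exact summable_modeTerm hf W hc h1 _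
  have hpb : p ∈ Metric.ball p δ := Metric.mem_ball_self hδ0
  have key := hasFDerivAt_tsum_of_isPreconnected hu Metric.isOpen_ball
    (convex_ball p δ).isPreconnected hT hT' hpb (hsum p hpb) hpb
  have key2 := key.congr_of_eventuallyEq (f₁ := flatExt (modeSum f W c)) (by
    filter_upwards [Metric.ball_mem_nhds p hδ0] with q hq
    exact flatExt_modeSum f W c (hsub q hq).2)
  refine key2.congr_fderiv (ContinuousLinearMap.ext fun v => ?_)
  have hT's : Summable fun i => T' i p :=
    Summable.of_norm_bounded hu fun i => hT' i p hpb
  have hs' := summable_modeTerm hf' W hc ⟨hp1, hp2⟩ (proj p.2)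
  have hsj := fun j => summable_modeTerm hf (j :: W) hc ⟨hp1, hp2⟩ (proj p.2)
  have e1 : (∑' i, T' i p) v = ∑' i, T' i p v :=
    (ContinuousLinearMap.apply ℝ ℝ v).map_tsum hT's
  rw [e1, gradForm_apply]
  simp only [T', gradForm_apply, flatExt_modeSum _ _ _ hp0, radialExt_eq _ hp0]
  rw [Summable.tsum_add (hs'.mul_left v.1) (summable_sum fun j _ =>
    ((hsj j).mul_left _).mul_right _), tsum_mul_left, Summable.tsum_finsetSum fun j _ =>
    ((hsj j).mul_left _).mul_right _]
  simp only [tsum_mul_right, tsum_mul_left]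

/-- A pair of families with `a_l' = b_l` and `b_l' = κ_l w a_l`. -/
structure RadialPair (a b : ℕ → ℝ → ℝ) (κ : ℕ → ℝ) (w : ℝ → ℝ) : Prop where
  bounded_fst : ModeBounded a
  bounded_snd : ModeBounded b
  bounded_coeff : ∃ (n : ℕ) (C : ℝ), ∀ l, |κ l| ≤ C * ((l : ℝ) + 1) ^ n
  smooth : ContDiffOn ℝ ∞ w (Ioo (-1 : ℝ) 1)
  deriv_fst : ∀ l, ∀ s ∈ Ioo (-1 : ℝ) 1, HasDerivAt (a l) (b l s) s
  deriv_snd : ∀ l, ∀ s ∈ Ioo (-1 : ℝ) 1, HasDerivAt (b l) (κ l * w s * a l s) s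

theorem RadialPair.rapidlyDecreasing {a b : ℕ → ℝ → ℝ} {κ : ℕ → ℝ} {w : ℝ → ℝ}
    (h : RadialPair a b κ w) {c : HarmonicIndex → ℝ} (hc : RapidlyDecreasing c) :
    RapidlyDecreasing fun i => κ i.1 * c i := by
  obtain ⟨n, C, hC⟩ := h.bounded_coeff
  refine hc.of_le (B := C) (n := n) fun i => ?_
  rw [abs_mul]
  exact mul_le_mul_of_nonneg_right (hC _) (abs_nonneg _)

theorem RadialPair.bounded_deriv {a b : ℕ → ℝ → ℝ} {κ : ℕ → ℝ} {w : ℝ → ℝ}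
    (h : RadialPair a b κ w) : ModeBounded fun l s => κ l * w s * a l s := by
  intro r hr
  obtain ⟨n, C, hC⟩ := h.bounded_coeff
  obtain ⟨m, D, hD⟩ := h.bounded_fst r hr
  have hsub : Icc (-r) r ⊆ Ioo (-1 : ℝ) 1 := Icc_subset_Ioo (by linarith) hr
  obtain ⟨B, hB⟩ := isCompact_Icc.exists_bound_of_continuousOn (h.smooth.continuousOn.mono hsub)
  refine ⟨n + m, C * B * D, fun l s hs => ?_⟩
  have h1 := hC l
  have h2 := hB s (abs_le.1 hs)
  have h3 := hD l s hs
  rw [Real.norm_eq_abs] at h2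
  rw [abs_mul, abs_mul]
  have h1' := (abs_nonneg _).trans h1
  calc _ ≤ (C * ((l : ℝ) + 1) ^ n) * B * (D * ((l : ℝ) + 1) ^ m) :=
        mul_le_mul (mul_le_mul h1 h2 (abs_nonneg _) h1') h3 (abs_nonneg _)
          (mul_nonneg h1' ((abs_nonneg _).trans h2))
    _ = _ := by ring

theorem modeSum_coeff_mul (κ : ℕ → ℝ) (w : ℝ → ℝ) (a : ℕ → ℝ → ℝ) (W : List (Fin 3))
    (c : HarmonicIndex → ℝ) (s : ℝ) (x : S2) :
    modeSum (fun l s => κ l * w s * a l s) W c s x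
      = w s * modeSum a W (fun i => κ i.1 * c i) s x := by
  rw [modeSum, modeSum, ← tsum_mul_left]
  exact tsum_congr fun i => by ring

theorem contDiff_gradForm_comp {n : WithTop ℕ∞} {u : ℝ × E3 → ℝ} {v : Fin 3 → ℝ × E3 → ℝ}
    (hu : ContDiffOn ℝ n u flatDom) (hv : ∀ j, ContDiffOn ℝ n (v j) flatDom) :
    ContDiffOn ℝ n (fun p : ℝ × E3 => gradForm p.2 (u p) fun j => v j p) flatDom := by
  unfold gradForm
  refine (hu.smul contDiffOn_const).add (ContDiffOn.sum fun j _ => ?_)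
  have h1 : ContDiffOn ℝ n (fun p : ℝ × E3 => (‖p.2‖ ^ 2)⁻¹ * v j p) flatDom := by
    refine ContDiffOn.mul ?_ (hv j)
    refine ContDiffOn.inv ((contDiff_norm_sq ℝ).comp contDiff_snd).contDiffOn fun p hp => ?_
    exact pow_ne_zero 2 (norm_ne_zero_iff.2 hp.2)
  have h2 : ContDiff ℝ n fun p : ℝ × E3 => innerSL ℝ (rotGen j p.2) :=
    (innerSL ℝ).contDiff.comp ((rotGen j).contDiff.comp contDiff_snd)
  exact h1.smul (h2.clm_comp contDiff_const).contDiffOn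

/-- Bootstrap: the derivative of an a-sum involves a b-sum and longer words, and that of a b-sum
involves w times an a-sum with coefficients κ c, still rapidly decreasing. Both sums, all words and
all coefficients must therefore be carried through the induction together. -/
theorem RadialPair.contDiffOn {a b : ℕ → ℝ → ℝ} {κ : ℕ → ℝ} {w : ℝ → ℝ}
    (h : RadialPair a b κ w) (n : ℕ) : ∀ (W : List (Fin 3)) {c : HarmonicIndex → ℝ},
    RapidlyDecreasing c → ContDiffOn ℝ n (flatExt (modeSum a W c)) flatDom ∧
      ContDiffOn ℝ n (flatExt (modeSum b W c)) flatDom := by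
  induction n with
  | zero =>
    intro W c hc
    simp only [Nat.cast_zero, contDiffOn_zero]
    exact ⟨fun p hp => (hasFDerivAt_modeSum h.bounded_fst h.bounded_snd h.deriv_fst W hc
        hp).continuousAt.continuousWithinAt,
      fun p hp => (hasFDerivAt_modeSum h.bounded_snd h.bounded_deriv h.deriv_snd W hc
        hp).continuousAt.continuousWithinAt⟩
  | succ n ih =>
    intro W c hc
    have h1 := fun p hp => hasFDerivAt_modeSum h.bounded_fst h.bounded_snd h.deriv_fst W hc
      (p := p) hp
    have h2 := fun p hp => hasFDerivAt_modeSum h.bounded_snd h.bounded_deriv h.deriv_snd W hc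
      (p := p) hp
    have hw : ContDiffOn ℝ n (fun p : ℝ × E3 => w p.1) flatDom :=
      (h.smooth.of_le (by exact_mod_cast le_top)).comp contDiff_fst.contDiffOn fun p hp => hp.1
    simp only [Nat.cast_succ]
    rw [contDiffOn_succ_iff_fderiv_of_isOpen isOpen_flatDom,
      contDiffOn_succ_iff_fderiv_of_isOpen isOpen_flatDom]
    refine ⟨⟨fun p hp => (h1 p hp).differentiableAt.differentiableWithinAt, by simp, ?_⟩,
      ⟨fun p hp => (h2 p hp).differentiableAt.differentiableWithinAt, by simp, ?_⟩⟩
    · refine (contDiff_gradForm_comp (ih W hc).2 fun j => (ih (j :: W) hc).1).congr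
        fun p hp => (h1 p hp).fderiv
    · refine (contDiff_gradForm_comp (u := fun p => w p.1 *
        flatExt (modeSum a W fun i => κ i.1 * c i) p)
        (hw.mul (ih W (h.rapidlyDecreasing hc)).1) fun j => (ih (j :: W) hc).2).congr
        fun p hp => ?_
      rw [(h2 p hp).fderiv, flatExt_eq _ hp.2, modeSum_coeff_mul, flatExt_eq _ hp.2]

theorem RadialPair.smoothHyp {a b : ℕ → ℝ → ℝ} {κ : ℕ → ℝ} {w : ℝ → ℝ}
    (h : RadialPair a b κ w) (W : List (Fin 3)) {c : HarmonicIndex → ℝ}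
    (hc : RapidlyDecreasing c) : SmoothHyp (modeSum a W c) ∧ SmoothHyp (modeSum b W c) := by
  simp only [smoothHyp_iff]
  exact ⟨contDiffOn_infty.2 fun n => (h.contDiffOn n W hc).1,
    contDiffOn_infty.2 fun n => (h.contDiffOn n W hc).2⟩

/-- Pairing the total derivative with e_j × x and exchanging the finite and infinite sums
reassembles, for each harmonic separately, its derivative along e_j × x. -/
theorem rotD_modeSum {f f' : ℕ → ℝ → ℝ} (hf : ModeBounded f) (hf' : ModeBounded f')
    (hd : ∀ l, ∀ s ∈ Ioo (-1 : ℝ) 1, HasDerivAt (f l) (f' l s) s) (W : List (Fin 3))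
    {c : HarmonicIndex → ℝ} (hc : RapidlyDecreasing c) {s : ℝ} (hs : s ∈ Ioo (-1 : ℝ) 1)
    (j : Fin 3) (x : S2) : rotD j (modeSum f W c s) x = modeSum f (j :: W) c s x := by
  have h1 := hasFDerivAt_modeSum hf hf' hd W hc (coe_mem_flatDom hs x)
  have h2 : HasFDerivAt (radialExt (modeSum f W c s)) _ (x : E3) :=
    HasFDerivAt.comp (x : E3) (f := fun y : E3 => (s, y)) h1 (hasFDerivAt_prodMk_right s (x : E3))
  rw [rotD, h2.fderiv, ContinuousLinearMap.comp_apply, ContinuousLinearMap.inr_apply,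
    gradForm_apply]
  have h3 : ∑ k, inner ℝ (rotGen k (x : E3)) (rotGen j x) * modeSum f (k :: W) c s x
      = ∑' i, ∑ k, inner ℝ (rotGen k (x : E3)) (rotGen j x) *
        (c i * f i.1 s * rotWord (k :: W) (realY i) x) := by
    rw [Summable.tsum_finsetSum fun k _ => (summable_modeTerm hf (k :: W) hc hs x).mul_left _]
    exact Finset.sum_congr rfl fun k _ => by rw [tsum_mul_left]; rfl
  simp only [flatExt_coe, norm_coe, one_pow, inv_one, one_mul, zero_mul, zero_add]
  rw [Finset.sum_congr rfl fun k _ => mul_comm _ _, h3, modeSum]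
  refine tsum_congr fun i => ?_
  have h4 := fderiv_radialExt (coe_ne_zero x)
    (((smoothS2_realY i).rotWord W).differentiableAt (coe_ne_zero x)) (rotGen j x)
  rw [rotWord_cons, rotD, h4, Finset.mul_sum]
  exact Finset.sum_congr rfl fun k _ => by
    rw [radialExt_coe, norm_coe, rotWord_cons]; ring

theorem hasDerivAt_modeSum {f f' : ℕ → ℝ → ℝ} (hf : ModeBounded f) (hf' : ModeBounded f')
    (hd : ∀ l, ∀ s ∈ Ioo (-1 : ℝ) 1, HasDerivAt (f l) (f' l s) s) (W : List (Fin 3))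
    {c : HarmonicIndex → ℝ} (hc : RapidlyDecreasing c) {s : ℝ} (hs : s ∈ Ioo (-1 : ℝ) 1)
    (x : S2) : HasDerivAt (fun σ => modeSum f W c σ x) (modeSum f' W c s x) s := by
  have h1 := hasFDerivAt_modeSum hf hf' hd W hc (coe_mem_flatDom hs x)
  have h2 : HasDerivAt (fun σ : ℝ => (σ, (x : E3))) ((1 : ℝ), (0 : E3)) s :=
    (hasDerivAt_id s).prodMk (hasDerivAt_const s (x : E3))
  have h3 := h1.comp_hasDerivAt s h2
  simp only [Function.comp_def, flatExt_coe] at h3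
  exact h3.congr_deriv (by rw [gradForm_apply]; simp)

/-! ### Harmonic expansions on the sphere -/

open MeasureTheory

/-- With radial functions equal to 1, series of harmonics on the sphere become mode sums independent
of s and inherit their smoothness. -/
theorem radialPair_one : RadialPair (fun _ _ => 1) (fun _ _ => 0) (fun _ => 0) (fun _ => 0) where
  bounded_fst _ _ := ⟨0, 1, fun l s _ => by simp⟩
  bounded_snd _ _ := ⟨0, 0, fun l s _ => by simp⟩
  bounded_coeff := ⟨0, 0, fun l => by simp⟩
  smooth := contDiffOn_const
  deriv_fst _ s _ := hasDerivAt_const s _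
  deriv_snd _ s _ := by simpa using hasDerivAt_const s (0 : ℝ)

/-- The sum of the harmonic series with coefficients `c`. -/
def harmSeries (c : HarmonicIndex → ℝ) (x : S2) : ℝ := ∑' i, c i * realY i x

theorem modeSum_one_nil (c : HarmonicIndex → ℝ) (s : ℝ) :
    modeSum (fun _ _ => 1) [] c s = harmSeries c := by
  funext x
  simp [modeSum, harmSeries, rotWord]

theorem summable_harmSeries {c : HarmonicIndex → ℝ} (hc : RapidlyDecreasing c) (x : S2) :
    Summable fun i => c i * realY i x := by
  have := summable_modeTerm radialPair_one.bounded_fst [] hc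
    (show (0 : ℝ) ∈ Ioo (-1 : ℝ) 1 by norm_num) x
  simpa [rotWord] using this

theorem hasHarmonicExpansion_harmSeries {c : HarmonicIndex → ℝ} (hc : RapidlyDecreasing c) :
    HasHarmonicExpansion (harmSeries c) c := ⟨hc, fun x => (summable_harmSeries hc x).hasSum⟩

theorem HasHarmonicExpansion.eq_harmSeries {f : S2 → ℝ} {c : HarmonicIndex → ℝ}
    (h : HasHarmonicExpansion f c) : f = harmSeries c := funext fun x => (h.2 x).tsum_eq.symm

theorem smoothS2_harmSeries {c : HarmonicIndex → ℝ} (hc : RapidlyDecreasing c) :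
    SmoothS2 (harmSeries c) := by
  have := (radialPair_one.smoothHyp [] hc).1.slice (show (0 : ℝ) ∈ Ioo (-1 : ℝ) 1 by norm_num)
  rwa [modeSum_one_nil] at this

theorem HasHarmonicExpansion.smoothS2 {f : S2 → ℝ} {c : HarmonicIndex → ℝ}
    (h : HasHarmonicExpansion f c) : SmoothS2 f := by
  rw [h.eq_harmSeries]; exact smoothS2_harmSeries h.1

/-- The harmonic coefficients of a function. -/
def harmCoeff (f : S2 → ℝ) (i : HarmonicIndex) : ℝ :=
  harmNormSq⁻¹ * ∫ x, f x * realY i x ∂sphMeas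

/-- The linear growth of the harmonics in l lets sum and integral be exchanged; orthogonality leaves
one term. -/
theorem integral_harmSeries_mul {c : HarmonicIndex → ℝ} (hc : RapidlyDecreasing c)
    (j : HarmonicIndex) : ∫ x, harmSeries c x * realY j x ∂sphMeas = c j * harmNormSq := by
  have hI : ∀ i, Integrable (fun x => c i * realY i x * realY j x) sphMeas := fun i =>
    integrable_mul ((smoothS2_realY i).const_mul (c i)).continuous (smoothS2_realY j).continuous
  have hle : ∀ i x, ‖c i * realY i x * realY j x‖
      ≤ 4 * ((j.1 : ℝ) + 1) * (|c i| * ((i.1 : ℝ) + 1) ^ 1) := fun i x => by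
    have h1 := abs_realY_le i x
    have h2 := abs_realY_le j x
    rw [Real.norm_eq_abs, abs_mul, abs_mul]
    calc _ ≤ |c i| * (2 * ((i.1 : ℝ) + 1)) * (2 * ((j.1 : ℝ) + 1)) := by gcongr
      _ = _ := by ring
  have hS : Summable fun i => ∫ x, ‖c i * realY i x * realY j x‖ ∂sphMeas := by
    refine Summable.of_nonneg_of_le (fun i => integral_nonneg fun x => norm_nonneg _) (fun i => ?_)
      ((((hc.summable 1).mul_left (4 * ((j.1 : ℝ) + 1)))).mul_left (sphMeas.real univ))
    calc _ ≤ ∫ _, 4 * ((j.1 : ℝ) + 1) * (|c i| * ((i.1 : ℝ) + 1) ^ 1) ∂sphMeas :=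
          integral_mono (hI i).norm (integrable_const _) (hle i)
      _ = _ := by rw [integral_const, smul_eq_mul]
  have h := (hasSum_integral_of_summable_integral_norm hI hS).tsum_eq
  have e : ∀ x, ∑' i, c i * realY i x * realY j x = harmSeries c x * realY j x := fun x =>
    tsum_mul_right
  simp only [e] at h
  rw [← h, tsum_eq_single j]
  · simp only [mul_assoc, integral_const_mul, integral_realY_sq]
  · intro i hi
    simp only [mul_assoc, integral_const_mul, integral_realY_mul_realY hi, mul_zero]

theorem HasHarmonicExpansion.eq_harmCoeff {f : S2 → ℝ} {c : HarmonicIndex → ℝ}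
    (h : HasHarmonicExpansion f c) : c = harmCoeff f := by
  funext i
  rw [harmCoeff, h.eq_harmSeries, integral_harmSeries_mul h.1, mul_comm (c i), ← mul_assoc,
    inv_mul_cancel₀ harmNormSq_pos.ne', one_mul]

theorem integral_lap_mul_realY {f : S2 → ℝ} (hf : SmoothS2 f) (i : HarmonicIndex) :
    ∫ x, lap f x * realY i x ∂sphMeas
      = -((i.1 : ℝ) * (i.1 + 1)) * ∫ x, f x * realY i x ∂sphMeas := by
  have h := integral_mul_lap (smoothS2_realY i) hf
  have e : ∀ x, f x * (-((i.1 : ℝ) * (i.1 + 1)) * realY i x)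
      = -((i.1 : ℝ) * (i.1 + 1)) * (f x * realY i x) := fun x => by ring
  simp only [lap_realY, e, integral_const_mul] at h
  rw [← h]
  simp only [mul_comm]

/-- The function is (1 - Δ)^k f: each factor is moved onto the harmonic, where it acts as l(l+1) +
1. -/
theorem exists_smooth_integral_eq {f : S2 → ℝ} (hf : SmoothS2 f) (k : ℕ) : ∃ g, SmoothS2 g ∧
    ∀ i, ∫ x, g x * realY i x ∂sphMeas
      = ((i.1 : ℝ) * (i.1 + 1) + 1) ^ k * ∫ x, f x * realY i x ∂sphMeas := by
  induction k with
  | zero => exact ⟨f, hf, by simp⟩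
  | succ k ih =>
    obtain ⟨g, hg, h⟩ := ih
    refine ⟨fun x => g x + (-1) * lap g x, hg.add (hg.lap.const_mul _), fun i => ?_⟩
    have e : ∀ x, (g x + (-1) * lap g x) * realY i x
        = g x * realY i x + (-1) * (lap g x * realY i x) := fun x => by ring
    simp only [e]
    rw [integral_add (hg.mul (smoothS2_realY i)).integrable
      ((hg.lap.mul (smoothS2_realY i)).integrable.const_mul _), integral_const_mul,
      integral_lap_mul_realY hg, h]
    ring

theorem rapidlyDecreasing_harmCoeff {f : S2 → ℝ} (hf : SmoothS2 f) :
    RapidlyDecreasing (harmCoeff f) := by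
  intro k
  -- One power of 1 - Δ more than k, to pay for the growth l + 1 of the harmonics.
  obtain ⟨g, hg, h⟩ := exists_smooth_integral_eq hf (k + 1)
  obtain ⟨C, hC⟩ := exists_abs_le_of_continuous hg.continuous
  have hN := harmNormSq_pos
  refine ⟨harmNormSq⁻¹ * 2 ^ (k + 1) * (sphMeas.real univ * (2 * C)), fun i => ?_⟩
  set t : ℝ := (i.1 : ℝ) + 1 with ht
  have ht1 : 1 ≤ t := by rw [ht]; linarith [(Nat.cast_nonneg i.1 : (0 : ℝ) ≤ i.1)]
  have h1 : |∫ x, g x * realY i x ∂sphMeas| ≤ sphMeas.real univ * (2 * C) * t := by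
    refine (abs_integral_le_integral_abs).trans ?_
    calc _ ≤ ∫ _, C * (2 * t) ∂sphMeas := by
          refine integral_mono (hg.mul (smoothS2_realY i)).integrable.abs (integrable_const _)
            fun x => ?_
          simp only [abs_mul]
          exact mul_le_mul (hC x) (abs_realY_le i x) (abs_nonneg _) ((abs_nonneg _).trans (hC x))
      _ = _ := by rw [integral_const, smul_eq_mul]; ring
  have h2 : t ^ (2 * (k + 1)) ≤ 2 ^ (k + 1) * ((i.1 : ℝ) * (i.1 + 1) + 1) ^ (k + 1) := by
    rw [pow_mul, ← mul_pow]
    gcongr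
    rw [ht]; nlinarith [sq_nonneg (i.1 : ℝ)]
  rw [h, abs_mul, abs_of_nonneg (show (0 : ℝ) ≤ ((i.1 : ℝ) * (i.1 + 1) + 1) ^ (k + 1) by
    positivity)] at h1
  set I := |∫ x, f x * realY i x ∂sphMeas|
  have h3 : t ^ (2 * k + 1) * I * t ≤ 2 ^ (k + 1) * (sphMeas.real univ * (2 * C)) * t := by
    calc t ^ (2 * k + 1) * I * t = t ^ (2 * (k + 1)) * I := by ring
      _ ≤ 2 ^ (k + 1) * ((i.1 : ℝ) * (i.1 + 1) + 1) ^ (k + 1) * I := by gcongr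
      _ = 2 ^ (k + 1) * (((i.1 : ℝ) * (i.1 + 1) + 1) ^ (k + 1) * I) := by ring
      _ ≤ 2 ^ (k + 1) * (sphMeas.real univ * (2 * C) * t) := by gcongr
      _ = _ := by ring
  have h4 := le_of_mul_le_mul_right h3 (by linarith)
  rw [harmCoeff, abs_mul, abs_of_pos (inv_pos.2 hN)]
  calc t ^ k * (harmNormSq⁻¹ * I) ≤ t ^ (2 * k + 1) * (harmNormSq⁻¹ * I) := by
        gcongr
        omega
    _ = harmNormSq⁻¹ * (t ^ (2 * k + 1) * I) := by ring
    _ ≤ harmNormSq⁻¹ * (2 ^ (k + 1) * (sphMeas.real univ * (2 * C))) := by gcongr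
    _ = _ := by ring

/-- The difference of f and its harmonic series is continuous and orthogonal to every harmonic, so
completeness applies. -/
theorem SmoothS2.hasHarmonicExpansion {f : S2 → ℝ} (hf : SmoothS2 f) :
    HasHarmonicExpansion f (harmCoeff f) := by
  have hc := rapidlyDecreasing_harmCoeff hf
  have h := hasHarmonicExpansion_harmSeries hc
  have hsm := smoothS2_harmSeries hc
  suffices H : ∀ x, f x = harmSeries (harmCoeff f) x from ⟨hc, fun x => H x ▸ h.2 x⟩
  intro x
  have := eq_zero_of_integral_mul_realY (g := fun x => f x - harmSeries (harmCoeff f) x)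
    (hf.continuous.sub hsm.continuous) (fun i => by
      simp only [sub_mul]
      rw [integral_sub (hf.mul (smoothS2_realY i)).integrable
        (hsm.mul (smoothS2_realY i)).integrable, integral_harmSeries_mul hc, harmCoeff]
      have := harmNormSq_pos.ne'
      field_simp
      ring) x
  linarith

theorem smoothS2_iff_existsUnique (f : S2 → ℝ) :
    SmoothS2 f ↔ ∃! c, HasHarmonicExpansion f c :=
  ⟨fun hf => ⟨harmCoeff f, hf.hasHarmonicExpansion, fun _ h => h.eq_harmCoeff⟩,
    fun ⟨_, h, _⟩ => h.smoothS2⟩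

/-- The antipodal map preserves the integral. -/
theorem integral_neg_sphere (f : S2 → ℝ) : ∫ x, f (-x) ∂sphMeas = ∫ x, f x ∂sphMeas := by
  have h : ∀ x, sphereMap (LinearIsometryEquiv.neg ℝ) x = -x := fun x => rfl
  rw [← integral_sphereMap (LinearIsometryEquiv.neg ℝ) f]
  simp only [h]

theorem integral_mul_realY_neg (f : S2 → ℝ) (i : HarmonicIndex) :
    ∫ x, f (-x) * realY i x ∂sphMeas = (-1) ^ i.1 * ∫ x, f x * realY i x ∂sphMeas := by
  rw [← integral_neg_sphere, ← integral_const_mul]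
  congr 1
  funext x
  rw [neg_neg, realY_neg]; ring

theorem harmCoeff_neg (f : S2 → ℝ) (i : HarmonicIndex) :
    harmCoeff (fun x => f (-x)) i = (-1) ^ i.1 * harmCoeff f i := by
  rw [harmCoeff, integral_mul_realY_neg, harmCoeff]; ring

/-! ### The wave equation on the hyperboloid -/

open MeasureTheory

theorem hvol_eq {s : ℝ} (hs : s ∈ Ioo (-1 : ℝ) 1) : hvol s = 1 / (1 - s ^ 2) ^ 2 := by
  have h := one_sub_sq_pos hs
  have : |hss s * hsph s ^ 2| = (1 / (1 - s ^ 2) ^ 2) ^ 2 := by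
    rw [show hss s * hsph s ^ 2 = -(1 / (1 - s ^ 2) ^ 2) ^ 2 by rw [hss, hsph]; field_simp, abs_neg,
      abs_of_nonneg (sq_nonneg _)]
  rw [hvol, this, Real.sqrt_sq (by positivity)]

/-- The density times h^{ss} is identically -1, so no first-order term in ∂_s arises. -/
theorem hypBox_eq {lam : ℝ → S2 → ℝ} (h : SmoothHyp lam) {s : ℝ} (hs : s ∈ Ioo (-1 : ℝ) 1)
    (x : S2) : hypBox lam s x
      = -(1 - s ^ 2) ^ 2 * dS (dS lam) s x + (1 - s ^ 2) * lap (lam s) x := by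
  have h0 := one_sub_sq_pos hs
  have h1 : deriv (fun σ => hvol σ * (hss σ)⁻¹ * deriv (fun τ => lam τ x) σ) s
      = -dS (dS lam) s x := by
    have e : (fun σ => hvol σ * (hss σ)⁻¹ * deriv (fun τ => lam τ x) σ)
        =ᶠ[𝓝 s] fun σ => -dS lam σ x := by
      filter_upwards [isOpen_Ioo.mem_nhds hs] with σ hσ
      have := one_sub_sq_pos hσ
      rw [hvol_eq hσ, hss, dS]; field_simp
    rw [e.deriv_eq]
    exact (hasDerivAt_of_smoothHyp h.dS hs x).neg.deriv
  rw [hypBox, h1, hvol_eq hs, hsph, sphereLaplacian_eq (h.slice hs), lap]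
  field_simp

theorem IsEvenSolution.wave_eq {lam : ℝ → S2 → ℝ} (h : IsEvenSolution lam) {s : ℝ}
    (hs : s ∈ Ioo (-1 : ℝ) 1) (x : S2) : (1 - s ^ 2) * dS (dS lam) s x = lap (lam s) x := by
  have h1 := h.wave s hs x
  rw [hypBox_eq h.smooth hs] at h1
  apply mul_left_cancel₀ (one_sub_sq_pos hs).ne'
  linear_combination -h1

theorem isEvenSolution_of_wave_eq {lam : ℝ → S2 → ℝ} (h : SmoothHyp lam)
    (hw : ∀ s ∈ Ioo (-1 : ℝ) 1, ∀ x, (1 - s ^ 2) * dS (dS lam) s x = lap (lam s) x)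
    (he : ∀ s ∈ Ioo (-1 : ℝ) 1, ∀ x, lam (-s) (-x) = lam s x) : IsEvenSolution lam :=
  ⟨h, fun s hs x => by rw [hypBox_eq h hs, ← hw s hs x]; ring, he⟩

theorem dS_congr {lam lam' : ℝ → S2 → ℝ} (h : ∀ s ∈ Ioo (-1 : ℝ) 1, ∀ x, lam s x = lam' s x)
    {s : ℝ} (hs : s ∈ Ioo (-1 : ℝ) 1) (x : S2) : dS lam s x = dS lam' s x := by
  have : (fun σ => lam σ x) =ᶠ[𝓝 s] fun σ => lam' σ x := by
    filter_upwards [isOpen_Ioo.mem_nhds hs] with σ hσ using h σ hσ x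
  exact this.deriv_eq

theorem IsEvenSolution.congr {lam lam' : ℝ → S2 → ℝ} (h : IsEvenSolution lam)
    (heq : ∀ s ∈ Ioo (-1 : ℝ) 1, ∀ x, lam' s x = lam s x) : IsEvenSolution lam' := by
  refine isEvenSolution_of_wave_eq (h.smooth.congr heq) (fun s hs x => ?_) fun s hs x => ?_
  · rw [dS_congr (fun s hs x => dS_congr heq hs x) hs, h.wave_eq hs, funext (heq s hs)]
  · rw [heq _ (neg_mem_Ioo' hs), heq s hs, h.even s hs]

/-! ### The sums of the modes `α_l Y_{l,m}` -/

theorem radialPair_alpha : RadialPair alpha (fun l => deriv (alpha l))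
    (fun l => (l : ℝ) * (l + 1)) (fun s => -1 / (1 - s ^ 2)) where
  bounded_fst r hr := ⟨1, 1, fun l s hs => by
    simpa using abs_alpha_le l (abs_lt.1 (hs.trans_lt hr))⟩
  bounded_snd r hr := by
    -- The energy bounds √(1 - s²) |α_l'|, and the weight is smallest at |s| = r.
    refine ⟨2, (Real.sqrt (1 - r ^ 2))⁻¹, fun l s hs => ?_⟩
    have hr0 : 0 ≤ r := (abs_nonneg s).trans hs
    have h1 : 0 < Real.sqrt (1 - r ^ 2) := Real.sqrt_pos.2 (by nlinarith)
    have h2 : Real.sqrt (1 - r ^ 2) ≤ Real.sqrt (1 - s ^ 2) := by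
      apply Real.sqrt_le_sqrt
      have := sq_le_sq' (by linarith [(abs_le.1 hs).1]) (abs_le.1 hs).2
      linarith
    rw [← div_eq_inv_mul, le_div_iff₀' h1]
    exact (mul_le_mul_of_nonneg_right h2 (abs_nonneg _)).trans
      (sqrt_mul_abs_deriv_alpha_le l (abs_lt.1 (hs.trans_lt hr)))
  bounded_coeff := ⟨2, 1, fun l => by
    rw [abs_of_nonneg (by positivity)]; nlinarith [(Nat.cast_nonneg l : (0 : ℝ) ≤ l)]⟩
  smooth := contDiffOn_const.div (contDiff_const.sub (contDiff_id.pow 2)).contDiffOn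
    fun s hs => (one_sub_sq_pos hs).ne'
  deriv_fst l s hs := (hasDerivAt_alpha l hs).differentiableAt.hasDerivAt
  deriv_snd l s hs := hasDerivAt_deriv_alpha l hs

/-- The sum of the modes `c_{l,m} α_l Y_{l,m}`. -/
def modeSeries (c : HarmonicIndex → ℝ) : ℝ → S2 → ℝ := modeSum alpha [] c

theorem hasModeExpansion_modeSeries {c : HarmonicIndex → ℝ} (hc : RapidlyDecreasing c) :
    HasModeExpansion (modeSeries c) c :=
  ⟨hc, fun _ hs x => (summable_modeTerm radialPair_alpha.bounded_fst [] hc hs x).hasSum⟩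

theorem HasModeExpansion.eq_modeSeries {lam : ℝ → S2 → ℝ} {c : HarmonicIndex → ℝ}
    (h : HasModeExpansion lam c) {s : ℝ} (hs : s ∈ Ioo (-1 : ℝ) 1) (x : S2) :
    lam s x = modeSeries c s x := (h.2 s hs x).tsum_eq.symm

theorem sum_rotWord_realY (i : HarmonicIndex) (x : S2) :
    ∑ j, rotWord [j, j] (realY i) x = -((i.1 : ℝ) * (i.1 + 1)) * realY i x :=
  casimir_realY i x

theorem dS_modeSeries {c : HarmonicIndex → ℝ} (hc : RapidlyDecreasing c) {s : ℝ}
    (hs : s ∈ Ioo (-1 : ℝ) 1) (x : S2) :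
    dS (modeSeries c) s x = modeSum (fun l => deriv (alpha l)) [] c s x :=
  (hasDerivAt_modeSum radialPair_alpha.bounded_fst radialPair_alpha.bounded_snd
    radialPair_alpha.deriv_fst [] hc hs x).deriv

/-- Two s-derivatives and the Laplacian may be taken term by term, where the radial and the angular
eigenvalues agree; the signs (-1)^l of α_l and Y_{l,m} cancel. -/
theorem isEvenSolution_modeSeries {c : HarmonicIndex → ℝ} (hc : RapidlyDecreasing c) :
    IsEvenSolution (modeSeries c) := by
  have hP := radialPair_alpha
  refine isEvenSolution_of_wave_eq (hP.smoothHyp [] hc).1 (fun s hs x => ?_) fun s hs x => ?_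
  · have h0 := (one_sub_sq_pos hs).ne'
    have h1 : dS (dS (modeSeries c)) s x
        = -1 / (1 - s ^ 2) * modeSum alpha [] (fun i => (i.1 : ℝ) * (i.1 + 1) * c i) s x := by
      rw [dS_congr (fun s hs x => dS_modeSeries hc hs x) hs, dS,
        (hasDerivAt_modeSum hP.bounded_snd hP.bounded_deriv hP.deriv_snd [] hc hs x).deriv,
        modeSum_coeff_mul]
    have h2 : ∀ j x, rotD j (modeSeries c s) x = modeSum alpha [j] c s x := fun j x =>
      rotD_modeSum hP.bounded_fst hP.bounded_snd hP.deriv_fst [] hc hs j x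
    have h3 : ∀ j x, rotD j (rotD j (modeSeries c s)) x = modeSum alpha [j, j] c s x := by
      intro j x
      rw [rotD_congr (h2 j), rotD_modeSum hP.bounded_fst hP.bounded_snd hP.deriv_fst [j] hc hs j x]
    have h4 : lap (modeSeries c s) x
        = ∑' i, -(((i.1 : ℝ) * (i.1 + 1) * c i) * alpha i.1 s * realY i x) := by
      simp only [lap, h3, modeSum]
      rw [← Summable.tsum_finsetSum fun j _ => summable_modeTerm hP.bounded_fst [j, j] hc hs x]
      refine tsum_congr fun i => ?_
      rw [← Finset.mul_sum, sum_rotWord_realY]; ring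
    rw [h1, h4, tsum_neg]
    simp only [modeSum, rotWord, List.foldr_nil]
    field_simp
  · rw [modeSeries, modeSum, modeSum]
    refine tsum_congr fun i => ?_
    have h2 : ((-1 : ℝ) ^ i.1) * (-1) ^ i.1 = 1 := by rw [← mul_pow]; simp
    simp only [rotWord, List.foldr_nil]
    rw [alpha_neg _ hs, realY_neg]
    linear_combination (c i * alpha i.1 s * realY i x) * h2

theorem HasModeExpansion.isEvenSolution {lam : ℝ → S2 → ℝ} {c : HarmonicIndex → ℝ}
    (h : HasModeExpansion lam c) : IsEvenSolution lam :=
  (isEvenSolution_modeSeries h.1).congr fun _ hs x => h.eq_modeSeries hs x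

/-! ### Expansion of even solutions -/

theorem SmoothHyp.continuousOn {lam : ℝ → S2 → ℝ} (h : SmoothHyp lam) :
    ContinuousOn (Function.uncurry lam) (Ioo (-1 : ℝ) 1 ×ˢ univ) := ContMDiffOn.continuousOn h

theorem hasDerivAt_integral_mul_realY {lam : ℝ → S2 → ℝ} (h : SmoothHyp lam) (i : HarmonicIndex)
    {s : ℝ} (hs : s ∈ Ioo (-1 : ℝ) 1) :
    HasDerivAt (fun s => ∫ x, lam s x * realY i x ∂sphMeas)
      (∫ x, dS lam s x * realY i x ∂sphMeas) s := by
  obtain ⟨δ, hδ, hsub⟩ := Metric.isOpen_iff.1 isOpen_Ioo s hs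
  have hsub2 : Metric.closedBall s (δ / 2) ⊆ Ioo (-1 : ℝ) 1 :=
    (Metric.closedBall_subset_ball (by linarith)).trans hsub
  obtain ⟨C, hC⟩ := ((isCompact_closedBall s (δ / 2)).prod
    (isCompact_univ (X := S2))).exists_bound_of_continuousOn
    (h.dS.continuousOn.mono (prod_mono hsub2 le_rfl))
  have hb : ∀ σ ∈ Metric.ball s (δ / 2), σ ∈ Ioo (-1 : ℝ) 1 := fun σ hσ =>
    hsub2 (Metric.ball_subset_closedBall hσ)
  refine (hasDerivAt_integral_of_dominated_loc_of_deriv_le (μ := sphMeas) (𝕜 := ℝ)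
    (F := fun s x => lam s x * realY i x) (F' := fun s x => dS lam s x * realY i x) (x₀ := s)
    (s := Metric.ball s (δ / 2)) (bound := fun x => C * |realY i x|)
    (Metric.ball_mem_nhds s (by linarith)) ?_
    ((h.slice hs).mul (smoothS2_realY i)).integrable
    ((h.dS.slice hs).mul (smoothS2_realY i)).continuous.aestronglyMeasurable ?_
    ((integrable_of_continuous (smoothS2_realY i).continuous.abs).const_mul C) ?_).2
  · filter_upwards [isOpen_Ioo.mem_nhds hs] with σ hσ
    exact ((h.slice hσ).mul (smoothS2_realY i)).continuous.aestronglyMeasurable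
  · refine Eventually.of_forall fun x σ hσ => ?_
    rw [norm_mul]
    exact mul_le_mul_of_nonneg_right (hC (σ, x) ⟨Metric.ball_subset_closedBall hσ, mem_univ _⟩)
      (norm_nonneg _)
  · exact Eventually.of_forall fun x σ hσ =>
      (hasDerivAt_of_smoothHyp h (hb σ hσ) x).mul_const _

/-- A solution of the radial equation of definite parity that has vanishing data vanishes. -/
theorem radial_eq_zero {L : ℝ} (hL : 0 ≤ L) {f f' : ℝ → ℝ}
    (hf : ∀ s ∈ Ioo (-1 : ℝ) 1, HasDerivAt f (f' s) s)
    (hf' : ∀ s ∈ Ioo (-1 : ℝ) 1, HasDerivAt f' (L * (-1 / (1 - s ^ 2)) * f s) s)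
    {σ : ℝ} (hp : ∀ s ∈ Ioo (-1 : ℝ) 1, f (-s) = σ * f s) (h0 : f 0 = 0) (h1 : f' 0 = 0)
    {s : ℝ} (hs : s ∈ Ioo (-1 : ℝ) 1) : f s = 0 := by
  have key : ∀ t ∈ Ico (0 : ℝ) 1, f t = 0 := by
    -- Zero initial energy forces both nonnegative terms to vanish. Only f' is used, since L may be
    -- 0; f is then constant.
    have hd : ∀ t ∈ Ico (0 : ℝ) 1, f' t = 0 := by
      intro t ht
      have h := energy_le hf hf' ht
      have hpos := one_sub_sq_pos (s := t) ⟨by linarith [ht.1], ht.2⟩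
      rw [h0, h1] at h
      have h2 : 0 ≤ L * f t ^ 2 := mul_nonneg hL (sq_nonneg _)
      have h3 : (1 - t ^ 2) * f' t ^ 2 = 0 :=
        le_antisymm (by linarith) (mul_nonneg hpos.le (sq_nonneg _))
      simpa [hpos.ne'] using h3
    intro t ht
    have hsub : ∀ u ∈ Icc 0 t, u ∈ Ioo (-1 : ℝ) 1 := fun u hu =>
      ⟨by linarith [hu.1], hu.2.trans_lt ht.2⟩
    have := constant_of_has_deriv_right_zero (f := f) (a := 0) (b := t)
      (fun u hu => (hf u (hsub u hu)).continuousAt.continuousWithinAt)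
      (fun u hu => by
        have h := hf u (hsub u ⟨hu.1, hu.2.le⟩)
        rw [hd u ⟨hu.1, hu.2.trans ht.2⟩] at h
        exact h.hasDerivWithinAt)
    rw [this t ⟨ht.1, le_rfl⟩, h0]
  rcases le_or_gt 0 s with h | h
  · exact key s ⟨h, hs.2⟩
  · have h2 := hp (-s) (neg_mem_Ioo' hs)
    rw [neg_neg, key (-s) ⟨by linarith, by linarith [hs.1]⟩, mul_zero] at h2
    exact h2

theorem IsEvenSolution.integral_parity {lam : ℝ → S2 → ℝ} (h : IsEvenSolution lam)
    (i : HarmonicIndex) {s : ℝ} (hs : s ∈ Ioo (-1 : ℝ) 1) :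
    ∫ x, lam (-s) x * realY i x ∂sphMeas
      = (-1) ^ i.1 * ∫ x, lam s x * realY i x ∂sphMeas := by
  rw [← integral_mul_realY_neg]
  congr 1
  funext x
  rw [← h.even s hs, neg_neg]

theorem IsEvenSolution.dS_neg {lam : ℝ → S2 → ℝ} (h : IsEvenSolution lam) {s : ℝ}
    (hs : s ∈ Ioo (-1 : ℝ) 1) (x : S2) : dS lam (-s) (-x) = -dS lam s x := by
  have h1 := hasDerivAt_of_smoothHyp h.smooth (neg_mem_Ioo' hs) (-x)
  have h2 := (h1.scomp s (hasDerivAt_neg s)).congr_of_eventuallyEq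
    (f₁ := fun σ => lam σ x) (by
      filter_upwards [isOpen_Ioo.mem_nhds hs] with σ hσ using (h.even σ hσ x).symm)
  have h3 := h2.unique (hasDerivAt_of_smoothHyp h.smooth hs x)
  rw [← h3]; simp

theorem IsEvenSolution.hasDerivAt_integral_dS {lam : ℝ → S2 → ℝ} (h : IsEvenSolution lam)
    (i : HarmonicIndex) {s : ℝ} (hs : s ∈ Ioo (-1 : ℝ) 1) :
    HasDerivAt (fun s => ∫ x, dS lam s x * realY i x ∂sphMeas)
      ((i.1 : ℝ) * (i.1 + 1) * (-1 / (1 - s ^ 2)) * ∫ x, lam s x * realY i x ∂sphMeas) s := by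
  refine (hasDerivAt_integral_mul_realY h.smooth.dS i hs).congr_deriv ?_
  have h0 := (one_sub_sq_pos hs).ne'
  have h1 := integral_lap_mul_realY (h.smooth.slice hs) i
  have e : ∀ x, lap (lam s) x * realY i x
      = (1 - s ^ 2) * (dS (dS lam) s x * realY i x) := fun x => by
    rw [← h.wave_eq hs]; ring
  simp only [e, integral_const_mul] at h1
  rw [eq_comm, ← mul_right_inj' h0, h1]
  field_simp

/-- The mode coefficients of an even solution, from its Cauchy data. -/
def modeCoeff (e u : HarmonicIndex → ℝ) (i : HarmonicIndex) : ℝ :=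
  if Even i.1 then e i / alpha i.1 0 else u i / deriv (alpha i.1) 0

/-- The denominators have absolute value at least 1. -/
theorem abs_modeCoeff_le (e u : HarmonicIndex → ℝ) (i : HarmonicIndex) :
    |modeCoeff e u i| ≤ |e i| + |u i| := by
  rw [modeCoeff]
  split_ifs with hl
  · obtain ⟨k, hk⟩ := hl
    have := (abs_alpha_even_zero k).1
    rw [show i.1 = 2 * k by omega, abs_div]
    linarith [div_le_self (abs_nonneg (e i)) this, abs_nonneg (u i)]
  · obtain ⟨k, hk⟩ := Nat.not_even_iff_odd.1 hl
    have := (abs_deriv_alpha_odd_zero k).1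
    rw [hk, abs_div]
    linarith [div_le_self (abs_nonneg (u i)) this, abs_nonneg (e i)]

theorem rapidlyDecreasing_modeCoeff {e u : HarmonicIndex → ℝ} (he : RapidlyDecreasing e)
    (hu : RapidlyDecreasing u) : RapidlyDecreasing (modeCoeff e u) := by
  intro k
  obtain ⟨C, hC⟩ := he k
  obtain ⟨D, hD⟩ := hu k
  refine ⟨C + D, fun i => ?_⟩
  calc _ ≤ ((i.1 : ℝ) + 1) ^ k * (|e i| + |u i|) := by gcongr; exact abs_modeCoeff_le e u i
    _ = ((i.1 : ℝ) + 1) ^ k * |e i| + ((i.1 : ℝ) + 1) ^ k * |u i| := by ring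
    _ ≤ C + D := add_le_add (hC i) (hD i)

/-- The coefficient solves the radial equation with parity (-1)^l, so one of its two data at s = 0
vanishes. The other is matched by the chosen multiple of α_l, and the difference has zero data. -/
theorem IsEvenSolution.harmCoeff_eq {lam : ℝ → S2 → ℝ} (h : IsEvenSolution lam)
    (i : HarmonicIndex) {s : ℝ} (hs : s ∈ Ioo (-1 : ℝ) 1) :
    harmCoeff (lam s) i
      = modeCoeff (harmCoeff (lam 0)) (harmCoeff (dS lam 0)) i * alpha i.1 s := by
  set C := modeCoeff (harmCoeff (lam 0)) (harmCoeff (dS lam 0)) i with hC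
  have hm : ∀ s ∈ Ioo (-1 : ℝ) 1, HasDerivAt (fun s => harmCoeff (lam s) i - C * alpha i.1 s)
      (harmCoeff (dS lam s) i - C * deriv (alpha i.1) s) s := fun s hs =>
    ((hasDerivAt_integral_mul_realY h.smooth i hs).const_mul _).sub
      ((radialPair_alpha.deriv_fst i.1 s hs).const_mul C)
  have hm' : ∀ s ∈ Ioo (-1 : ℝ) 1, HasDerivAt
      (fun s => harmCoeff (dS lam s) i - C * deriv (alpha i.1) s)
      ((i.1 : ℝ) * (i.1 + 1) * (-1 / (1 - s ^ 2)) *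
        (harmCoeff (lam s) i - C * alpha i.1 s)) s := fun s hs =>
    (((h.hasDerivAt_integral_dS i hs).const_mul _).sub
      ((radialPair_alpha.deriv_snd i.1 s hs).const_mul C)).congr_deriv (by rw [harmCoeff]; ring)
  have hpar : ∀ s ∈ Ioo (-1 : ℝ) 1, harmCoeff (lam (-s)) i - C * alpha i.1 (-s)
      = (-1) ^ i.1 * (harmCoeff (lam s) i - C * alpha i.1 s) := fun s hs => by
    rw [harmCoeff, h.integral_parity i hs, alpha_neg i.1 hs, harmCoeff]; ring
  have hp0 := h.integral_parity i zero_mem_Ioo'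
  have hp1 : ∫ x, dS lam 0 x * realY i x ∂sphMeas
      = -(-1) ^ i.1 * ∫ x, dS lam 0 x * realY i x ∂sphMeas := by
    rw [neg_mul, ← integral_mul_realY_neg, ← integral_neg]
    congr 1
    funext x
    have := h.dS_neg zero_mem_Ioo' x
    rw [neg_zero] at this
    rw [this]; ring
  rw [neg_zero] at hp0
  have hz : harmCoeff (lam 0) i - C * alpha i.1 0 = 0 ∧
      harmCoeff (dS lam 0) i - C * deriv (alpha i.1) 0 = 0 := by
    rcases Nat.even_or_odd i.1 with he | ho
    · rw [he.neg_one_pow] at hp1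
      have h1 : harmCoeff (dS lam 0) i = 0 := by
        rw [harmCoeff, show ∫ x, dS lam 0 x * realY i x ∂sphMeas = 0 by linarith, mul_zero]
      rw [hC, modeCoeff, if_pos he, h1]
      obtain ⟨k, hk⟩ := he
      rw [show i.1 = 2 * k by omega, deriv_alpha_even_zero,
        div_mul_cancel₀ _ (alpha_even_zero_ne k)]
      simp
    · rw [ho.neg_one_pow] at hp0
      have h1 : harmCoeff (lam 0) i = 0 := by
        rw [harmCoeff, show ∫ x, lam 0 x * realY i x ∂sphMeas = 0 by linarith, mul_zero]
      rw [hC, modeCoeff, if_neg (Nat.not_even_iff_odd.2 ho), h1]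
      obtain ⟨k, hk⟩ := ho
      rw [hk, alpha_odd_zero, div_mul_cancel₀ _ (deriv_alpha_odd_zero_ne k)]
      simp
  have := radial_eq_zero (by positivity) hm hm' hpar hz.1 hz.2 hs
  linarith

theorem IsEvenSolution.hasModeExpansion {lam : ℝ → S2 → ℝ} (h : IsEvenSolution lam) :
    HasModeExpansion lam (modeCoeff (harmCoeff (lam 0)) (harmCoeff (dS lam 0))) := by
  refine ⟨rapidlyDecreasing_modeCoeff (rapidlyDecreasing_harmCoeff (h.smooth.slice zero_mem_Ioo'))
    (rapidlyDecreasing_harmCoeff (h.smooth.dS.slice zero_mem_Ioo')), fun s hs x => ?_⟩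
  simp only [← h.harmCoeff_eq _ hs]
  exact (h.smooth.slice hs).hasHarmonicExpansion.2 x

theorem rapidlyDecreasing_mul {c : HarmonicIndex → ℝ} (hc : RapidlyDecreasing c)
    {f : ℕ → ℝ → ℝ} (hf : ModeBounded f) {s : ℝ} (hs : s ∈ Ioo (-1 : ℝ) 1) :
    RapidlyDecreasing fun i => c i * f i.1 s := by
  obtain ⟨n, C, hC⟩ := hf |s| (abs_lt.2 hs)
  refine hc.of_le (B := C) (n := n) fun i => ?_
  rw [abs_mul, mul_comm]
  exact mul_le_mul_of_nonneg_right (hC _ _ le_rfl) (abs_nonneg _)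

theorem HasModeExpansion.slice {lam : ℝ → S2 → ℝ} {c : HarmonicIndex → ℝ}
    (h : HasModeExpansion lam c) {s : ℝ} (hs : s ∈ Ioo (-1 : ℝ) 1) :
    HasHarmonicExpansion (lam s) fun i => c i * alpha i.1 s :=
  ⟨rapidlyDecreasing_mul h.1 radialPair_alpha.bounded_fst hs, h.2 s hs⟩

theorem HasModeExpansion.slice_dS {lam : ℝ → S2 → ℝ} {c : HarmonicIndex → ℝ}
    (h : HasModeExpansion lam c) {s : ℝ} (hs : s ∈ Ioo (-1 : ℝ) 1) :
    HasHarmonicExpansion (dS lam s) fun i => c i * deriv (alpha i.1) s := by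
  refine ⟨rapidlyDecreasing_mul h.1 radialPair_alpha.bounded_snd hs, fun x => ?_⟩
  rw [dS_congr (fun s hs x => h.eq_modeSeries hs x) hs, dS_modeSeries h.1 hs]
  exact (summable_modeTerm radialPair_alpha.bounded_snd [] h.1 hs x).hasSum

theorem HasHarmonicExpansion.unique {f : S2 → ℝ} {c c' : HarmonicIndex → ℝ}
    (h : HasHarmonicExpansion f c) (h' : HasHarmonicExpansion f c') : c = c' :=
  h.eq_harmCoeff.trans h'.eq_harmCoeff.symm

/-- For each index a slice near s = 1 is used, where α_l is close to 1 and can be divided out;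
interior slices such as s = 0 may meet zeros of α_l. -/
theorem HasModeExpansion.unique {lam : ℝ → S2 → ℝ} {c c' : HarmonicIndex → ℝ}
    (h : HasModeExpansion lam c) (h' : HasModeExpansion lam c') : c = c' := by
  funext i
  have h1 : ∀ᶠ s in 𝓝[<] (1 : ℝ), alpha i.1 s ≠ 0 :=
    (alpha_boundary i.1).1.eventually_ne one_ne_zero
  have h2 : ∀ᶠ s in 𝓝[<] (1 : ℝ), s ∈ Ioo (-1 : ℝ) 1 := Ioo_mem_nhdsLT (by norm_num)
  obtain ⟨s, hs1, hs2⟩ := (h1.and h2).exists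
  exact mul_right_cancel₀ hs1 (congrFun ((h.slice hs2).unique (h'.slice hs2)) i)

theorem isEvenSolution_iff_existsUnique (lam : ℝ → S2 → ℝ) :
    IsEvenSolution lam ↔ ∃! c, HasModeExpansion lam c :=
  ⟨fun h => ⟨_, h.hasModeExpansion, fun _ h' => h'.unique h.hasModeExpansion⟩,
    fun ⟨_, h, _⟩ => h.isEvenSolution⟩

/-! ### Limits at the two ends of the hyperboloid -/

theorem ioo_mem_future : Ioo (-1 : ℝ) 1 ∈ 𝓝[<] (1 : ℝ) := Ioo_mem_nhdsLT (by norm_num)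

theorem ioo_mem_past : Ioo (-1 : ℝ) 1 ∈ 𝓝[>] (-1 : ℝ) := Ioo_mem_nhdsGT (by norm_num)

theorem tendsto_neg_past : Tendsto (fun s : ℝ => -s) (𝓝[>] (-1)) (𝓝[<] 1) := by
  have := tendsto_neg_nhdsGT_neg (a := (1 : ℝ))
  exact this

/-- The limit `s → 1` of a sum over modes may be taken term by term. -/
theorem tendsto_modeSum {f : ℕ → ℝ → ℝ} {n : ℕ} {C : ℝ}
    (hf : ∀ l, ∀ s ∈ Ioo (-1 : ℝ) 1, |f l s| ≤ C * ((l : ℝ) + 1) ^ n) {t : ℕ → ℝ}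
    (ht : ∀ l, Tendsto (f l) (𝓝[<] 1) (𝓝 (t l))) (W : List (Fin 3)) {c : HarmonicIndex → ℝ}
    (hc : RapidlyDecreasing c) (x : S2) :
    Tendsto (fun s => modeSum f W c s x) (𝓝[<] 1)
      (𝓝 (modeSum (fun l _ => t l) W c 0 x)) := by
  refine tendsto_tsum_of_dominated_convergence
    ((hc.summable (n + (W.length + 1))).mul_left (2 * C))
    (fun i => ((ht i.1).const_mul (c i)).mul_const _) ?_
  filter_upwards [ioo_mem_future] with s hs i
  exact abs_modeTerm_le _ (hf _ _ hs) W rfl x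

theorem HasModeExpansion.futureLimit {lam : ℝ → S2 → ℝ} {c : HarmonicIndex → ℝ}
    (h : HasModeExpansion lam c) : FutureLimit lam (harmSeries c) := by
  intro x
  have h1 := tendsto_modeSum (n := 1) (C := 1)
    (fun l s hs => by simpa using abs_alpha_le l hs) (fun l => (alpha_boundary l).1) [] h.1 x
  rw [modeSum_one_nil] at h1
  refine h1.congr' ?_
  filter_upwards [ioo_mem_future] with s hs using (h.eq_modeSeries hs x).symm

theorem IsEvenSolution.pastLimit {lam : ℝ → S2 → ℝ} (h : IsEvenSolution lam) {f : S2 → ℝ}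
    (hf : FutureLimit lam f) : PastLimit lam fun x => f (-x) := by
  intro x
  refine ((hf (-x)).comp tendsto_neg_past).congr' ?_
  filter_upwards [ioo_mem_past] with s hs using h.even s hs x

theorem FutureLimit.unique {lam : ℝ → S2 → ℝ} {f g : S2 → ℝ} (hf : FutureLimit lam f)
    (hg : FutureLimit lam g) : f = g := funext fun x => tendsto_nhds_unique (hf x) (hg x)

theorem PastLimit.unique {lam : ℝ → S2 → ℝ} {f g : S2 → ℝ} (hf : PastLimit lam f)
    (hg : PastLimit lam g) : f = g := funext fun x => tendsto_nhds_unique (hf x) (hg x)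

/-- Pointwise convergence of λ alone would not control the Lorentz action, which differentiates. The
bound on α_l is uniform up to s = 1, so dominated convergence also applies to the differentiated
series. -/
theorem HasModeExpansion.rotD_futureLimit {lam : ℝ → S2 → ℝ} {c : HarmonicIndex → ℝ}
    (h : HasModeExpansion lam c) (j : Fin 3) (x : S2) :
    Tendsto (fun s => rotD j (lam s) x) (𝓝[<] 1) (𝓝 (rotD j (harmSeries c) x)) := by
  have h1 := tendsto_modeSum (n := 1) (C := 1)
    (fun l s hs => by simpa using abs_alpha_le l hs) (fun l => (alpha_boundary l).1) [j] h.1 x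
  have hO := radialPair_one
  rw [← rotD_modeSum hO.bounded_fst hO.bounded_snd hO.deriv_fst [] h.1 zero_mem_Ioo',
    modeSum_one_nil] at h1
  refine h1.congr' ?_
  filter_upwards [ioo_mem_future] with s hs
  have hA := radialPair_alpha
  rw [rotD_congr (h.eq_modeSeries hs), modeSeries,
    rotD_modeSum hA.bounded_fst hA.bounded_snd hA.deriv_fst [] h.1 hs]

theorem HasModeExpansion.dS_futureLimit {lam : ℝ → S2 → ℝ} {c : HarmonicIndex → ℝ}
    (h : HasModeExpansion lam c) (x : S2) :
    Tendsto (fun s => (1 - s ^ 2) * dS lam s x) (𝓝[<] 1) (𝓝 0) := by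
  -- Of the weight 1 - s², one square root is spent on the energy bound and the other is at most 1;
  -- this gives a majorant (l + 1)² uniform in s.
  have h1 := tendsto_modeSum (f := fun l s => (1 - s ^ 2) * deriv (alpha l) s) (n := 2) (C := 1)
    (fun l s hs => by
      have h0 := one_sub_sq_pos hs
      have h2 : Real.sqrt (1 - s ^ 2) ≤ 1 := Real.sqrt_le_one.2 (by nlinarith [sq_nonneg s])
      have h3 := sqrt_mul_abs_deriv_alpha_le l hs
      rw [abs_mul, abs_of_pos h0]
      calc (1 - s ^ 2) * |deriv (alpha l) s|
          = Real.sqrt (1 - s ^ 2) * (Real.sqrt (1 - s ^ 2) * |deriv (alpha l) s|) := by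
            rw [← mul_assoc, Real.mul_self_sqrt h0.le]
        _ ≤ 1 * ((l : ℝ) + 1) ^ 2 := mul_le_mul h2 h3 (by positivity) zero_le_one)
    (fun l => (deriv_alpha_boundary l).1) [] h.1 x
  have h2 : modeSum (fun _ _ => (0 : ℝ)) [] c 0 x = 0 := by simp [modeSum]
  rw [h2] at h1
  refine h1.congr' ?_
  filter_upwards [ioo_mem_future] with s hs
  rw [dS_congr (fun s hs x => h.eq_modeSeries hs x) hs, dS_modeSeries h.1 hs, modeSum, modeSum,
    ← tsum_mul_left]
  exact tsum_congr fun i => by ring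

/-! ### The two parametrizations of the even solutions -/

theorem HasModeExpansion.futureLimit_iff {lam : ℝ → S2 → ℝ} {c : HarmonicIndex → ℝ}
    (hc : HasModeExpansion lam c) {f : S2 → ℝ} :
    FutureLimit lam f ↔ HasHarmonicExpansion f c := by
  constructor
  · intro h
    rw [h.unique hc.futureLimit]
    exact hasHarmonicExpansion_harmSeries hc.1
  · intro h
    rw [h.eq_harmSeries]
    exact hc.futureLimit

theorem eq_of_hasModeExpansion {lam lam' : ℝ → S2 → ℝ} {c : HarmonicIndex → ℝ}
    (h : HasModeExpansion lam c) (h' : HasModeExpansion lam' c) :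
    ∀ s ∈ Ioo (-1 : ℝ) 1, ∀ x, lam' s x = lam s x := fun _ hs x =>
  (h'.eq_modeSeries hs x).trans (h.eq_modeSeries hs x).symm

/-- Because α_l → 1, the harmonic coefficients of the limit are the mode coefficients themselves. -/
theorem exists_of_scriParams {f : S2 → ℝ} (hf : f ∈ scriParams) :
    ∃ lam, IsEvenSolution lam ∧ FutureLimit lam f ∧
      ∀ lam', IsEvenSolution lam' → FutureLimit lam' f →
        ∀ s ∈ Ioo (-1 : ℝ) 1, ∀ x, lam' s x = lam s x := by
  have he := SmoothS2.hasHarmonicExpansion hf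
  have hm := hasModeExpansion_modeSeries he.1
  refine ⟨_, hm.isEvenSolution, (HasModeExpansion.futureLimit_iff hm).2 he, fun lam' h' hf' => ?_⟩
  have hm' := h'.hasModeExpansion
  have := ((HasModeExpansion.futureLimit_iff hm').1 hf').unique he
  rw [this] at hm'
  exact eq_of_hasModeExpansion hm hm'

theorem cauchyData_self (lam : ℝ → S2 → ℝ) : CauchyData lam (lam 0, dS lam 0) := fun _ => ⟨rfl, rfl⟩

theorem CauchyData.eq {lam : ℝ → S2 → ℝ} {p : (S2 → ℝ) × (S2 → ℝ)} (h : CauchyData lam p) :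
    p = (lam 0, dS lam 0) :=
  Prod.ext (funext fun x => (h x).1.symm) (funext fun x => (h x).2.symm)

theorem IsEvenSolution.mem_hamParams {lam : ℝ → S2 → ℝ} (h : IsEvenSolution lam) :
    (lam 0, dS lam 0) ∈ hamParams := by
  refine ⟨h.smooth.slice zero_mem_Ioo', h.smooth.dS.slice zero_mem_Ioo', fun x => ?_, fun x => ?_⟩
  · have := h.even 0 zero_mem_Ioo' x
    rwa [neg_zero] at this
  · have := h.dS_neg zero_mem_Ioo' x
    rwa [neg_zero] at this

theorem harmCoeff_eq_zero_of_even {f : S2 → ℝ} (hf : ∀ x, f (-x) = f x) {i : HarmonicIndex}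
    (hi : Odd i.1) : harmCoeff f i = 0 := by
  have h := harmCoeff_neg f i
  rw [funext hf, hi.neg_one_pow] at h
  linarith

theorem harmCoeff_eq_zero_of_odd {f : S2 → ℝ} (hf : ∀ x, f (-x) = -f x) {i : HarmonicIndex}
    (hi : Even i.1) : harmCoeff f i = 0 := by
  have h := harmCoeff_neg f i
  have h2 : harmCoeff (fun x => -f x) i = -harmCoeff f i := by
    simp [harmCoeff, MeasureTheory.integral_neg]
  rw [funext hf, h2, hi.neg_one_pow] at h
  linarith

/-- The parities of the data remove exactly the coefficients that the modes cannot produce: α_l(0) =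
0 for odd l and α_l'(0) = 0 for even l. For the others one divides. -/
theorem exists_of_hamParams {p : (S2 → ℝ) × (S2 → ℝ)} (hp : p ∈ hamParams) :
    ∃ lam, IsEvenSolution lam ∧ CauchyData lam p ∧
      ∀ lam', IsEvenSolution lam' → CauchyData lam' p →
        ∀ s ∈ Ioo (-1 : ℝ) 1, ∀ x, lam' s x = lam s x := by
  obtain ⟨hs1, hs2, hpe, hpo⟩ := hp
  have he := hs1.hasHarmonicExpansion
  have hu := hs2.hasHarmonicExpansion
  have hm := hasModeExpansion_modeSeries (rapidlyDecreasing_modeCoeff he.1 hu.1)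
  refine ⟨_, hm.isEvenSolution, fun x => ⟨?_, ?_⟩, fun lam' h' hf' => ?_⟩
  · have h1 := hm.slice zero_mem_Ioo'
    have h2 : (fun i => modeCoeff (harmCoeff p.1) (harmCoeff p.2) i * alpha i.1 0)
        = harmCoeff p.1 := by
      funext i
      rw [modeCoeff]
      split_ifs with hl
      · obtain ⟨k, hk⟩ := hl
        have := alpha_even_zero_ne k
        rw [show 2 * k = i.1 by omega] at this
        rw [div_mul_cancel₀ _ this]
      · have ho := Nat.not_even_iff_odd.1 hl
        rw [harmCoeff_eq_zero_of_even hpe ho]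
        obtain ⟨k, hk⟩ := ho
        rw [hk, alpha_odd_zero, mul_zero]
    rw [h2] at h1
    exact (h1.2 x).unique (he.2 x)
  · have h1 := hm.slice_dS zero_mem_Ioo'
    have h2 : (fun i => modeCoeff (harmCoeff p.1) (harmCoeff p.2) i * deriv (alpha i.1) 0)
        = harmCoeff p.2 := by
      funext i
      rw [modeCoeff]
      split_ifs with hl
      · rw [harmCoeff_eq_zero_of_odd hpo hl]
        obtain ⟨k, hk⟩ := hl
        rw [show i.1 = 2 * k by omega, deriv_alpha_even_zero, mul_zero]
      · obtain ⟨k, hk⟩ := Nat.not_even_iff_odd.1 hl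
        have := deriv_alpha_odd_zero_ne k
        rw [← hk] at this
        rw [div_mul_cancel₀ _ this]
    rw [h2] at h1
    exact (h1.2 x).unique (hu.2 x)
  · have hm' := h'.hasModeExpansion
    obtain rfl := CauchyData.eq hf'
    exact eq_of_hasModeExpansion hm hm'

/-- A bulk parameter that agrees with `lam` up to `K` has limits that agree with `f` up to `K`. -/
theorem abs_limit_sub_le {F : Filter ℝ} [F.NeBot] {g lam : ℝ → ℝ} {L f K : ℝ}
    (hF : Ioo (-1 : ℝ) 1 ∈ F) (hg : Tendsto g F (𝓝 L)) (hl : Tendsto lam F (𝓝 f))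
    (h : ∀ s ∈ Ioo (-1 : ℝ) 1, |g s - lam s| ≤ K) : |L - f| ≤ K :=
  le_of_tendsto (hg.sub hl).abs (by filter_upwards [hF] with s hs using h s hs)

theorem limit_part {lam : ℝ → S2 → ℝ} {c : HarmonicIndex → ℝ}
    (hl : IsEvenSolution lam) (hc : HasModeExpansion lam c) :
    ∃ f ∈ scriParams, HasHarmonicExpansion f c ∧
      FutureLimit lam f ∧ PastLimit lam (fun x => f (-x)) ∧
      ∀ (Lam : ℝ → ℝ → S2 → ℝ) (C ρ₀ : ℝ), 0 < ρ₀ →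
        (∀ ρ ≥ ρ₀, ∀ s ∈ Ioo (-1 : ℝ) 1, ∀ x,
          |Lam (ρ / Real.sqrt (1 - s ^ 2)) s x - lam s x| ≤ C / ρ) →
        ∀ ρ ≥ ρ₀, ∀ (x : S2) (L : ℝ),
          (Tendsto (fun s => Lam (ρ / Real.sqrt (1 - s ^ 2)) s x) (𝓝[<] 1) (𝓝 L) →
            |L - f x| ≤ C / ρ) ∧
          (Tendsto (fun s => Lam (ρ / Real.sqrt (1 - s ^ 2)) s x) (𝓝[>] (-1)) (𝓝 L) →
            |L - f (-x)| ≤ C / ρ) := by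
  have hf := hc.futureLimit
  refine ⟨harmSeries c, smoothS2_harmSeries hc.1, hasHarmonicExpansion_harmSeries hc.1, hf,
    hl.pastLimit hf, fun Lam C ρ₀ _ h ρ hρ x L => ⟨fun hL => ?_, fun hL => ?_⟩⟩
  · exact abs_limit_sub_le ioo_mem_future hL (hf x) fun s hs => h ρ hρ s hs x
  · exact abs_limit_sub_le ioo_mem_past hL (hl.pastLimit hf x) fun s hs => h ρ hρ s hs x

theorem cauchy_part {lam : ℝ → S2 → ℝ} {c : HarmonicIndex → ℝ}
    (hl : IsEvenSolution lam) (hc : HasModeExpansion lam c) :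
    ∃ p ∈ hamParams, CauchyData lam p ∧
      ∃ e u : HarmonicIndex → ℝ, HasHarmonicExpansion p.1 e ∧ HasHarmonicExpansion p.2 u ∧
        (∀ k m, e ⟨2 * k + 1, m⟩ = 0) ∧ (∀ k m, u ⟨2 * k, m⟩ = 0) ∧
        (∀ k m, c ⟨2 * k + 1, m⟩ * deriv (alpha (2 * k + 1)) 0 = u ⟨2 * k + 1, m⟩) ∧
        (∀ k m, c ⟨2 * k, m⟩ * alpha (2 * k) 0 = e ⟨2 * k, m⟩) ∧
        (∀ m, c ⟨0, m⟩ = e ⟨0, m⟩) ∧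
        (∀ m, c ⟨1, m⟩ = 1 / 2 * u ⟨1, m⟩) ∧
        (∀ m, c ⟨2, m⟩ = -(1 / 2) * e ⟨2, m⟩) := by
  refine ⟨_, hl.mem_hamParams, cauchyData_self lam, _, _, hc.slice zero_mem_Ioo',
    hc.slice_dS zero_mem_Ioo', fun k m => ?_, fun k m => ?_, fun k m => rfl, fun k m => rfl,
    fun m => ?_, fun m => ?_, fun m => ?_⟩
  · simp only [alpha_odd_zero, mul_zero]
  · simp only [deriv_alpha_even_zero, mul_zero]
  · simp only [alpha_zero zero_mem_Ioo', mul_one]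
  · simp only [deriv_alpha_one_zero]; ring
  · simp only [alpha_two_zero]; ring

/-! ### Commutators of conformal vector fields on the sphere -/

/-- The derivative of `f` along the tangential part of `x ↦ A x + c`. -/
def confD (A : E3 →L[ℝ] E3) (c : E3) (f : S2 → ℝ) (x : S2) : ℝ :=
  fderiv ℝ (radialExt f) (x : E3) (A x + c)

theorem confD_eq {f : S2 → ℝ} (hf : SmoothS2 f) (A : E3 →L[ℝ] E3) (c : E3) (x : S2) :
    confD A c f x = ∑ j, inner ℝ (A x + c) (rotGen j x) * rotD j f x := by
  rw [confD, fderiv_radialExt (coe_ne_zero x) (hf.differentiableAt (coe_ne_zero x))]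
  refine Finset.sum_congr rfl fun j _ => ?_
  rw [radialExt_coe, norm_coe, real_inner_comm]; simp [mul_comm]

theorem rotD_eq_confD (j : Fin 3) (f : S2 → ℝ) (x : S2) : rotD j f x = confD (rotGen j) 0 f x := by
  rw [confD, add_zero, rotD]

theorem smoothS2_inner_rotGen (A : E3 →L[ℝ] E3) (c : E3) (j : Fin 3) :
    SmoothS2 fun x => inner ℝ (A x + c) (rotGen j (x : E3)) :=
  smoothS2_of_contDiff (G := fun y => inner ℝ (A y + c) (rotGen j y))
    ((A.contDiff.add contDiff_const).inner ℝ (contDiff_rotGen j))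

theorem SmoothS2.confD {f : S2 → ℝ} (hf : SmoothS2 f) (A : E3 →L[ℝ] E3) (c : E3) :
    SmoothS2 (confD A c f) := by
  rw [funext (confD_eq hf A c)]
  exact smoothS2_sum fun j _ => (smoothS2_inner_rotGen A c j).mul (hf.rotD j)

theorem radialExt_confD {f : S2 → ℝ} (hf : SmoothS2 f) (A : E3 →L[ℝ] E3) (c : E3) {y : E3}
    (hy : y ≠ 0) : radialExt (confD A c f) y = fderiv ℝ (radialExt f) y (A y + ‖y‖ • c) := by
  have hn := norm_ne_zero_iff.2 hy
  rw [radialExt_eq _ hy, confD, ← fderiv_radialExt_proj hy (hf.differentiableAt hy), proj_coe_eq hy,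
    map_smul, smul_add, smul_smul, inv_mul_cancel₀ hn, one_smul]

theorem hasFDerivAt_norm_sphere (x : S2) : HasFDerivAt (fun y : E3 => ‖y‖) (innerSL ℝ (x : E3))
    (x : E3) := by
  have e1 : HasFDerivAt (fun y : E3 => (‖y‖ ^ 2)) (2 • innerSL ℝ (x : E3)) (x : E3) :=
    (hasStrictFDerivAt_norm_sq (x : E3)).hasFDerivAt
  have e2 := e1.sqrt (by simp)
  simp only [norm_nonneg, Real.sqrt_sq] at e2
  refine e2.congr_fderiv (ContinuousLinearMap.ext fun v => ?_)
  simp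

/-- The derivative of f extends off the sphere as the derivative along y ↦ B y + ‖y‖ d.
Differentiating the norm produces the term with ⟨x, A x + c⟩ d. -/
theorem confD_confD {f : S2 → ℝ} (hf : SmoothS2 f) (A B : E3 →L[ℝ] E3) (c d : E3) (x : S2) :
    confD A c (confD B d f) x
      = fderiv ℝ (fderiv ℝ (radialExt f)) (x : E3) (A x + c) (B x + d)
        + fderiv ℝ (radialExt f) (x : E3) (B (A x + c) + (inner ℝ (x : E3) (A x + c) : ℝ) • d) := by
  have hx := coe_ne_zero x
  obtain ⟨F, hF⟩ : ∃ F, F = fderiv ℝ (radialExt f) := ⟨_, rfl⟩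
  have hd : HasFDerivAt F (fderiv ℝ F (x : E3)) (x : E3) := by
    rw [hF]
    exact ((((hf.contDiffOn.contDiffAt (isOpen_compl_singleton.mem_nhds hx))).fderiv_right (m := ∞)
      (by simp)).differentiableAt (by simp)).hasFDerivAt
  have h1 : HasFDerivAt (fun y : E3 => B y + ‖y‖ • d)
      (B + (innerSL ℝ (x : E3)).smulRight d) (x : E3) :=
    B.hasFDerivAt.add ((hasFDerivAt_norm_sphere x).smul_const d)
  have h2 := hd.clm_apply h1
  have h3 := h2.congr_of_eventuallyEq (f₁ := radialExt (confD B d f)) (by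
    filter_upwards [isOpen_compl_singleton.mem_nhds hx] with y hy
    rw [radialExt_confD hf B d hy, hF])
  rw [confD, h3.fderiv, ← hF]
  simp only [add_apply, ContinuousLinearMap.comp_apply, ContinuousLinearMap.flip_apply,
    ContinuousLinearMap.smulRight_apply, innerSL_apply_apply, norm_coe, one_smul]
  ring

/-- Symmetry of the second derivative leaves a first-order operator, given by the bracket of the two
extended fields. -/
theorem confD_comm {f : S2 → ℝ} (hf : SmoothS2 f) (A B : E3 →L[ℝ] E3) (c d : E3) (x : S2) :
    confD A c (confD B d f) x - confD B d (confD A c f) x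
      = fderiv ℝ (radialExt f) (x : E3) ((B (A x + c) + (inner ℝ (x : E3) (A x + c) : ℝ) • d)
        - (A (B x + d) + (inner ℝ (x : E3) (B x + d) : ℝ) • c)) := by
  have hx := coe_ne_zero x
  have hsymm := (hf.contDiffOn.contDiffAt (isOpen_compl_singleton.mem_nhds hx)).isSymmSndFDerivAt
    (by rw [minSmoothness_of_isRCLikeNormedField]; exact WithTop.coe_le_coe.2 le_top)
  rw [confD_confD hf, confD_confD hf, hsymm.eq (A x + c) (B x + d), map_sub]
  ring

theorem rotD_comm {f : S2 → ℝ} (hf : SmoothS2 f) (j k : Fin 3) (x : S2) :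
    rotD j (rotD k f) x - rotD k (rotD j f) x = fderiv ℝ (radialExt f) (x : E3)
      (rotGen k (rotGen j x) - rotGen j (rotGen k x)) := by
  have h := confD_comm hf (rotGen j) (rotGen k) 0 0 x
  simp only [add_zero, smul_zero] at h
  rw [← h, rotD_congr (rotD_eq_confD k f), rotD_congr (rotD_eq_confD j f), rotD_eq_confD,
    rotD_eq_confD k]

theorem rotD_comm_next {f : S2 → ℝ} (hf : SmoothS2 f) (x : S2) :
    (rotD 0 (rotD 1 f) x = rotD 1 (rotD 0 f) x - rotD 2 f x) ∧
    (rotD 1 (rotD 2 f) x = rotD 2 (rotD 1 f) x - rotD 0 f x) ∧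
    (rotD 2 (rotD 0 f) x = rotD 0 (rotD 2 f) x - rotD 1 f x) := by
  have e : ∀ j k m : Fin 3, rotGen k (rotGen j (x : E3)) - rotGen j (rotGen k x) = -rotGen m x →
      rotD j (rotD k f) x = rotD k (rotD j f) x - rotD m f x := fun j k m h => by
    have := rotD_comm hf j k x
    rw [h, map_neg] at this
    rw [rotD.eq_def m]
    linarith
  refine ⟨e 0 1 2 ?_, e 1 2 0 ?_, e 2 0 1 ?_⟩ <;>
  · ext i; fin_cases i <;> simp [rotGen_apply]

theorem rotD_sub {f g : S2 → ℝ} (hf : SmoothS2 f) (hg : SmoothS2 g) (j : Fin 3) (x : S2) :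
    rotD j (fun x => f x - g x) x = rotD j f x - rotD j g x := by
  have : (fun x => f x - g x) = fun x => f x + (-1) * g x := by funext x; ring
  rw [this, rotD_add hf (hg.const_mul _), rotD_const_mul hg]; ring

/-- The standard proof that a Casimir element is central, from two of the cyclic commutation
relations; stated for a cyclic triple so that it serves all three axes. -/
theorem rotD_sq_comm {a b c : Fin 3}
    (h1 : ∀ {g : S2 → ℝ}, SmoothS2 g → ∀ x, rotD a (rotD b g) x = rotD b (rotD a g) x - rotD c g x)
    (h2 : ∀ {g : S2 → ℝ}, SmoothS2 g → ∀ x, rotD c (rotD a g) x = rotD a (rotD c g) x - rotD b g x)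
    {f : S2 → ℝ} (hf : SmoothS2 f) (x : S2) :
    rotD a (rotD b (rotD b f)) x + rotD a (rotD c (rotD c f)) x
      = rotD b (rotD b (rotD a f)) x + rotD c (rotD c (rotD a f)) x := by
  have e1 := h1 (hf.rotD b) x
  have e2 : rotD b (rotD a (rotD b f)) x = rotD b (rotD b (rotD a f)) x - rotD b (rotD c f) x := by
    rw [rotD_congr (h1 hf), rotD_sub ((hf.rotD a).rotD b) (hf.rotD c)]
  have e3 := h2 (hf.rotD c) x
  have e4 : rotD c (rotD c (rotD a f)) x = rotD c (rotD a (rotD c f)) x - rotD c (rotD b f) x := by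
    rw [rotD_congr (h2 hf), rotD_sub ((hf.rotD c).rotD a) (hf.rotD b)]
  linarith

theorem lap_rotD {f : S2 → ℝ} (hf : SmoothS2 f) (j : Fin 3) (x : S2) :
    lap (rotD j f) x = rotD j (lap f) x := by
  have e : rotD j (lap f) x = rotD j (rotD 0 (rotD 0 f)) x + rotD j (rotD 1 (rotD 1 f)) x
      + rotD j (rotD 2 (rotD 2 f)) x := by
    have := rotD_sum (t := Finset.univ) (f := fun k => rotD k (rotD k f))
      (fun k _ => (hf.rotD k).rotD k) j x
    rw [Fin.sum_univ_three] at this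
    exact this
  rw [e, lap, Fin.sum_univ_three]
  have c01 := fun {g : S2 → ℝ} (hg : SmoothS2 g) x => (rotD_comm_next hg x).1
  have c12 := fun {g : S2 → ℝ} (hg : SmoothS2 g) x => (rotD_comm_next hg x).2.1
  have c20 := fun {g : S2 → ℝ} (hg : SmoothS2 g) x => (rotD_comm_next hg x).2.2
  fin_cases j
  · have := rotD_sq_comm c01 c20 hf x
    simp only [Fin.zero_eta]; linarith
  · have := rotD_sq_comm c12 c01 hf x
    simp only [Fin.mk_one]; linarith
  · have := rotD_sq_comm c20 c12 hf x
    simp only [Fin.reduceFinMk]; linarith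

/-! ### The coordinate functions and their gradients -/

/-- The coordinate function `x_i` of the sphere. -/
def coordS (i : Fin 3) (x : S2) : ℝ := (x : E3) i

theorem smoothS2_coordS (i : Fin 3) : SmoothS2 (coordS i) := smoothS2_of_contDiff (contDiff_coord i)

theorem rotD_linear (φ : E3 →L[ℝ] ℝ) (j : Fin 3) (x : S2) :
    rotD j (fun x : S2 => φ x) x = φ (rotGen j x) :=
  rotD_of_hasFDerivAt (fun _ => rfl) j φ.hasFDerivAt

theorem rotD_coordS (i j : Fin 3) (x : S2) : rotD j (coordS i) x = rotGen j (x : E3) i :=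
  rotD_linear (EuclideanSpace.proj i) j x

theorem rotD_rotD_coordS (i j k : Fin 3) (x : S2) :
    rotD j (rotD k (coordS i)) x = rotGen k (rotGen j (x : E3)) i := by
  rw [rotD_congr (rotD_coordS i k)]
  exact rotD_linear ((EuclideanSpace.proj i).comp (rotGen k)) j x

/-- The derivative along the gradient of `x_i`. -/
def gradD (i : Fin 3) (f : S2 → ℝ) (x : S2) : ℝ := ∑ k, rotD k (coordS i) x * rotD k f x

theorem SmoothS2.gradD {f : S2 → ℝ} (hf : SmoothS2 f) (i : Fin 3) : SmoothS2 (gradD i f) :=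
  smoothS2_sum fun k _ => ((smoothS2_coordS i).rotD k).mul (hf.rotD k)

theorem lap_mul {f g : S2 → ℝ} (hf : SmoothS2 f) (hg : SmoothS2 g) (x : S2) :
    lap (fun x => f x * g x) x
      = f x * lap g x + g x * lap f x + 2 * ∑ j, rotD j f x * rotD j g x := by
  have h : ∀ j, rotD j (rotD j fun x => f x * g x) x = f x * rotD j (rotD j g) x
      + g x * rotD j (rotD j f) x + 2 * (rotD j f x * rotD j g x) := fun j => by
    rw [rotD_congr (rotD_mul hf hg j), rotD_add (hf.mul (hg.rotD j)) (hg.mul (hf.rotD j)),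
      rotD_mul hf (hg.rotD j), rotD_mul hg (hf.rotD j)]
    ring
  simp only [lap, h, Finset.sum_add_distrib, ← Finset.mul_sum]

theorem lap_sum {ι : Type*} {t : Finset ι} {f : ι → S2 → ℝ} (h : ∀ i ∈ t, SmoothS2 (f i)) (x : S2) :
    lap (fun x => ∑ i ∈ t, f i x) x = ∑ i ∈ t, lap (f i) x := by
  simp only [lap]
  rw [Finset.sum_comm]
  refine Finset.sum_congr rfl fun j _ => ?_
  rw [rotD_congr (rotD_sum h j), rotD_sum fun i hi => (h i hi).rotD j]

theorem lap_add {f g : S2 → ℝ} (hf : SmoothS2 f) (hg : SmoothS2 g) (x : S2) :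
    lap (fun x => f x + g x) x = lap f x + lap g x := by
  simp only [lap, ← Finset.sum_add_distrib]
  exact Finset.sum_congr rfl fun j _ => by
    rw [rotD_congr (rotD_add hf hg j), rotD_add (hf.rotD j) (hg.rotD j)]

theorem lap_const_mul {f : S2 → ℝ} (hf : SmoothS2 f) (c : ℝ) (x : S2) :
    lap (fun x => c * f x) x = c * lap f x := by
  simp only [lap, Finset.mul_sum]
  exact Finset.sum_congr rfl fun j _ => by
    rw [rotD_congr (rotD_const_mul hf c j), rotD_const_mul (hf.rotD j)]

theorem lap_coordS (i : Fin 3) (x : S2) : lap (coordS i) x = -2 * coordS i x := by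
  simp only [lap, rotD_rotD_coordS, Fin.sum_univ_three, coordS]
  fin_cases i <;> simp [rotGen_apply] <;> ring

theorem lap_rotD_coordS (i k : Fin 3) (x : S2) :
    lap (rotD k (coordS i)) x = -2 * rotD k (coordS i) x := by
  rw [lap_rotD (smoothS2_coordS i), rotD_congr (lap_coordS i), rotD_const_mul (smoothS2_coordS i)]

theorem lap_coordS_mul {f : S2 → ℝ} (hf : SmoothS2 f) (i : Fin 3) (x : S2) :
    lap (fun x => coordS i x * f x) x
      = coordS i x * lap f x - 2 * coordS i x * f x + 2 * gradD i f x := by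
  rw [lap_mul (smoothS2_coordS i) hf, lap_coordS, gradD]; ring

/-- The one relation in the overcomplete frame: Σ x_k e_k × x = x × x = 0. -/
theorem sum_coordS_mul_rotD (f : S2 → ℝ) (x : S2) :
    ∑ k, coordS k x * rotD k f x = 0 := by
  have h : ∑ k, (x : E3) k • rotGen k (x : E3) = 0 := by
    ext i; fin_cases i <;> simp [Fin.sum_univ_three, rotGen_apply] <;> ring
  have h2 := congrArg (fderiv ℝ (radialExt f) (x : E3)) h
  simp only [map_sum, map_smul, map_zero, smul_eq_mul] at h2
  exact h2

/-- That relation differentiated along the i-th rotation. -/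
theorem sum_coordS_mul_rotD_rotD {f : S2 → ℝ} (hf : SmoothS2 f) (i : Fin 3) (x : S2) :
    ∑ k, coordS k x * rotD i (rotD k f) x = gradD i f x := by
  have h := rotD_congr (sum_coordS_mul_rotD f) i x
  rw [rotD_const, rotD_sum fun k _ => (smoothS2_coordS k).mul (hf.rotD k)] at h
  simp only [rotD_mul (smoothS2_coordS _) (hf.rotD _), Finset.sum_add_distrib] at h
  have h2 : ∑ k, rotD k f x * rotD i (coordS k) x = -gradD i f x := by
    rw [gradD, ← Finset.sum_neg_distrib]
    refine Finset.sum_congr rfl fun k _ => ?_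
    have : rotGen i (x : E3) k = -rotGen k (x : E3) i := by
      fin_cases i <;> fin_cases k <;> simp [rotGen_apply]
    rw [rotD_coordS, rotD_coordS, this]; ring
  linarith

/-- The gradient of x_i is a conformal field, so its commutator with Δ is a multiple of Δ. In two
dimensions no first-order term remains: the two contributions ∓ 2 `gradD i f` cancel. -/
theorem lap_gradD {f : S2 → ℝ} (hf : SmoothS2 f) (i : Fin 3) (x : S2) :
    lap (gradD i f) x = gradD i (lap f) x - 2 * coordS i x * lap f x := by
  have h1 : lap (gradD i f) x = ∑ k, lap (fun x => rotD k (coordS i) x * rotD k f x) x :=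
    lap_sum (fun k _ => ((smoothS2_coordS i).rotD k).mul (hf.rotD k)) x
  have h2 : ∀ k, lap (fun x => rotD k (coordS i) x * rotD k f x) x
      = rotD k (coordS i) x * rotD k (lap f) x - 2 * (rotD k (coordS i) x * rotD k f x)
        + 2 * ∑ j, rotD j (rotD k (coordS i)) x * rotD j (rotD k f) x := fun k => by
    rw [lap_mul ((smoothS2_coordS i).rotD k) (hf.rotD k), lap_rotD hf, lap_rotD_coordS]; ring
  have h3 : ∑ k, ∑ j, rotD j (rotD k (coordS i)) x * rotD j (rotD k f) x
      = ∑ k, coordS k x * rotD i (rotD k f) x - coordS i x * lap f x := by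
    simp only [rotD_rotD_coordS, lap, Fin.sum_univ_three, coordS]
    fin_cases i <;> simp [rotGen_apply] <;> ring
  rw [h1]
  simp only [h2, Finset.sum_add_distrib, Finset.sum_sub_distrib, ← Finset.mul_sum]
  rw [h3, sum_coordS_mul_rotD_rotD hf]
  simp only [gradD]
  ring

/-! ### The Lorentz algebra in components -/

/-- The spatial block of a Lorentz generator. -/
def spaceMap (M : so31) : E3 →L[ℝ] E3 :=
  LinearMap.toContinuousLinearMap
    { toFun := fun y => WithLp.toLp 2 (fun i => ∑ j, M.1 (Sum.inl i) (Sum.inl j) * y j)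
      map_add' := fun y z => by
        ext i; simp [mul_add, Finset.sum_add_distrib]
      map_smul' := fun r y => by
        ext i; simp only [PiLp.smul_apply, smul_eq_mul, RingHom.id_apply, Finset.mul_sum]
        exact Finset.sum_congr rfl fun j _ => by ring }

theorem spaceMap_apply (M : so31) (y : E3) (i : Fin 3) :
    spaceMap M y i = ∑ j, M.1 (Sum.inl i) (Sum.inl j) * y j := rfl

theorem rotPart_eq (M : so31) (x : S2) : rotPart M x = spaceMap M x := rfl

/-- The boost vector of a Lorentz generator. -/
def boostVec (M : so31) : E3 := WithLp.toLp 2 fun i => M.1 (Sum.inl i) (Sum.inr 0)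

theorem boostVec_apply (M : so31) (i : Fin 3) : boostVec M i = M.1 (Sum.inl i) (Sum.inr 0) := rfl

theorem boostPart_eq (M : so31) (x : S2) : boostPart M x = -∑ i, boostVec M i * coordS i x := rfl

theorem so31_symm (M : so31) : (∀ i j, M.1 (Sum.inl i) (Sum.inl j) = -M.1 (Sum.inl j) (Sum.inl i)) ∧
    (∀ i, M.1 (Sum.inr 0) (Sum.inl i) = M.1 (Sum.inl i) (Sum.inr 0)) ∧
    M.1 (Sum.inr 0) (Sum.inr 0) = 0 := by
  have h : M.1 ∈ skewAdjointMatricesLieSubalgebra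
    (LieAlgebra.Orthogonal.indefiniteDiagonal (Fin 3) (Fin 1) ℝ) := M.2
  rw [mem_skewAdjointMatricesLieSubalgebra, mem_skewAdjointMatricesSubmodule] at h
  simp only [Matrix.IsSkewAdjoint, Matrix.IsAdjointPair, LieAlgebra.Orthogonal.indefiniteDiagonal]
    at h
  have key : ∀ a b, _ := fun a b => congrFun (congrFun h a) b
  simp only [Matrix.mul_diagonal, Matrix.diagonal_mul, Matrix.transpose_apply,
    Matrix.neg_apply] at key
  refine ⟨fun i j => ?_, fun i => ?_, ?_⟩
  · have := key (Sum.inl j) (Sum.inl i)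
    simp at this
    linarith
  · have := key (Sum.inl i) (Sum.inr 0)
    simp at this
    linarith
  · have := key (Sum.inr 0) (Sum.inr 0)
    simp at this
    linarith

/-- The rotation vector of a Lorentz generator. -/
def rotVec (M : so31) : Fin 3 → ℝ :=
  ![M.1 (Sum.inl 2) (Sum.inl 1), M.1 (Sum.inl 0) (Sum.inl 2), M.1 (Sum.inl 1) (Sum.inl 0)]

theorem spaceMap_eq_sum (M : so31) (y : E3) : spaceMap M y = ∑ j, rotVec M j • rotGen j y := by
  obtain ⟨h, -, -⟩ := so31_symm M
  have h0 : ∀ i, M.1 (Sum.inl i) (Sum.inl i) = 0 := fun i => by linarith [h i i]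
  ext i
  rw [spaceMap_apply]
  simp only [Fin.sum_univ_three, PiLp.add_apply, PiLp.smul_apply, smul_eq_mul]
  fin_cases i
  · simp [rotVec, rotGen_apply, h0]
    rw [h 0 1]; ring
  · simp [rotVec, rotGen_apply, h0]
    rw [h 1 2]; ring
  · simp [rotVec, rotGen_apply, h0]
    rw [h 2 0]; ring

theorem inner_spaceMap_self (M : so31) (y : E3) : inner ℝ y (spaceMap M y) = 0 := by
  rw [spaceMap_eq_sum, inner_sum]
  exact Finset.sum_eq_zero fun j _ => by rw [real_inner_smul_right, inner_rotGen_self, mul_zero]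

theorem inner_boostVec (M : so31) (y : E3) :
    inner ℝ (boostVec M) y = ∑ i, boostVec M i * y i := by
  rw [inner_E3, Fin.sum_univ_three]

theorem linearField_eq (M : so31) (p : ℝ × E3) : linearField M p
    = (inner ℝ (boostVec M) p.2, p.1 • boostVec M + spaceMap M p.2) := by
  obtain ⟨-, h1, h2⟩ := so31_symm M
  refine Prod.ext ?_ ?_
  · rw [linearField, inner_boostVec, h2]
    simp [h1, boostVec_apply]
  · ext i
    simp [linearField, boostVec_apply, spaceMap_apply, mul_comm]

theorem smoothS2_boostPart (M : so31) : SmoothS2 (boostPart M) := by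
  have h : boostPart M = fun x => (-1) * ∑ i, boostVec M i * coordS i x := by
    funext x; rw [boostPart_eq]; ring
  rw [h]
  exact (smoothS2_sum fun i _ => (smoothS2_coordS i).const_mul _).const_mul _

theorem rotD_boostPart (M : so31) (j : Fin 3) (x : S2) :
    rotD j (boostPart M) x = -inner ℝ (boostVec M) (rotGen j x) := by
  have h := rotD_linear (-(innerSL ℝ (boostVec M))) j x
  have e : ∀ x : S2, boostPart M x = (-(innerSL ℝ (boostVec M))) (x : E3) := fun x => by
    rw [boostPart_eq, neg_apply, innerSL_apply_apply, inner_boostVec]; rfl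
  rw [rotD_congr e, h]; rfl

theorem inner_sphereGrad_rotGen (f : S2 → ℝ) (j : Fin 3) (x : S2) :
    inner ℝ (sphereGrad f x) (rotGen j (x : E3)) = rotD j f x := by
  rw [sphereGrad, gradient, InnerProductSpace.toDual_symm_apply]; rfl

theorem along_rotPart {f : S2 → ℝ} (hf : SmoothS2 f) (M : so31) (x : S2) :
    along (rotPart M) f x = ∑ j, rotVec M j * rotD j f x := by
  have h := confD_eq hf (spaceMap M) 0 x
  simp only [add_zero] at h
  rw [along_eq hf]
  simp only [rotPart_eq]
  rw [← h, confD, add_zero, spaceMap_eq_sum, map_sum]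
  exact Finset.sum_congr rfl fun j _ => by rw [map_smul]; rfl

theorem sum_inner_boostVec_mul_rotD (M : so31) (f : S2 → ℝ) (x : S2) :
    ∑ j, inner ℝ (boostVec M) (rotGen j (x : E3)) * rotD j f x
      = ∑ i, boostVec M i * gradD i f x := by
  simp only [inner_boostVec, gradD, rotD_coordS, Finset.sum_mul, Finset.mul_sum]
  rw [Finset.sum_comm]
  exact Finset.sum_congr rfl fun i _ => Finset.sum_congr rfl fun j _ => by ring

theorem along_sub_smul_boost {f : S2 → ℝ} (hf : SmoothS2 f) (M : so31) (s : ℝ) (x : S2) :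
    along (fun z => rotPart M z - s • sphereGrad (boostPart M) z) f x
      = ∑ j, rotVec M j * rotD j f x + s * ∑ i, boostVec M i * gradD i f x := by
  rw [← along_rotPart hf, ← sum_inner_boostVec_mul_rotD, along_eq hf, along_eq hf, Finset.mul_sum,
    ← Finset.sum_add_distrib]
  refine Finset.sum_congr rfl fun j _ => ?_
  rw [inner_sub_left, real_inner_smul_left, inner_sphereGrad_rotGen (boostPart M),
    rotD_boostPart]
  ring

theorem deltaScri_eq {f : S2 → ℝ} (hf : SmoothS2 f) (M : so31) (x : S2) :
    deltaScri (boostPart M) (rotPart M) f x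
      = ∑ j, rotVec M j * rotD j f x + ∑ i, boostVec M i * gradD i f x := by
  have h := along_sub_smul_boost hf M 1 x
  simp only [one_smul, one_mul] at h
  exact h

/-- The field Y - Db is the tangential part of x ↦ A x + c, for which the commutator is already
known. -/
theorem deltaScri_eq_confD {f : S2 → ℝ} (hf : SmoothS2 f) (M : so31) (x : S2) :
    deltaScri (boostPart M) (rotPart M) f x = confD (spaceMap M) (boostVec M) f x := by
  rw [deltaScri_eq hf, ← along_rotPart hf, ← sum_inner_boostVec_mul_rotD, confD_eq hf,
    along_eq hf, ← Finset.sum_add_distrib]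
  exact Finset.sum_congr rfl fun j _ => by rw [rotPart_eq, inner_add_left]; ring

theorem hypLie_eq {lam : ℝ → S2 → ℝ} (h : SmoothHyp lam) (M : so31) {s : ℝ}
    (hs : s ∈ Ioo (-1 : ℝ) 1) (x : S2) : hypLie (boostPart M) (rotPart M) lam s x
      = ∑ j, rotVec M j * rotD j (lam s) x
        + ∑ i, boostVec M i * ((1 - s ^ 2) * (coordS i x * dS lam s x) + s * gradD i (lam s) x) := by
  rw [hypLie, along_sub_smul_boost (h.slice hs), boostPart_eq, dS]
  simp only [mul_add, Finset.sum_add_distrib, Finset.mul_sum, ← Finset.sum_neg_distrib,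
    Finset.sum_mul]
  rw [add_left_comm]
  congr 1
  congr 1
  · exact Finset.sum_congr rfl fun i _ => by ring
  · exact Finset.sum_congr rfl fun i _ => by ring

/-! ### Linear combinations of even solutions -/

theorem RapidlyDecreasing.add {c d : HarmonicIndex → ℝ} (hc : RapidlyDecreasing c)
    (hd : RapidlyDecreasing d) : RapidlyDecreasing fun i => c i + d i := by
  intro k
  obtain ⟨C, hC⟩ := hc k
  obtain ⟨D, hD⟩ := hd k
  refine ⟨C + D, fun i => ?_⟩
  calc _ ≤ ((i.1 : ℝ) + 1) ^ k * (|c i| + |d i|) := by gcongr; exact abs_add_le _ _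
    _ = ((i.1 : ℝ) + 1) ^ k * |c i| + ((i.1 : ℝ) + 1) ^ k * |d i| := by ring
    _ ≤ C + D := add_le_add (hC i) (hD i)

theorem RapidlyDecreasing.const_mul {c : HarmonicIndex → ℝ} (hc : RapidlyDecreasing c) (r : ℝ) :
    RapidlyDecreasing fun i => r * c i :=
  hc.of_le (B := |r|) (n := 0) fun i => by rw [abs_mul]; simp

/-- In terms of mode coefficients linearity is immediate. -/
theorem IsEvenSolution.add {lam lam' : ℝ → S2 → ℝ} (h : IsEvenSolution lam)
    (h' : IsEvenSolution lam') : IsEvenSolution fun s x => lam s x + lam' s x := by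
  obtain ⟨hc, hs⟩ := h.hasModeExpansion
  obtain ⟨hc', hs'⟩ := h'.hasModeExpansion
  refine HasModeExpansion.isEvenSolution ⟨hc.add hc', fun s hI x => ?_⟩
  simpa only [add_mul] using (hs s hI x).add (hs' s hI x)

theorem IsEvenSolution.const_mul {lam : ℝ → S2 → ℝ} (h : IsEvenSolution lam) (r : ℝ) :
    IsEvenSolution fun s x => r * lam s x := by
  obtain ⟨hc, hs⟩ := h.hasModeExpansion
  refine HasModeExpansion.isEvenSolution ⟨hc.const_mul r, fun s hI x => ?_⟩
  simpa only [mul_assoc] using (hs s hI x).mul_left r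

theorem IsEvenSolution.sum_three {lam : Fin 3 → ℝ → S2 → ℝ} (h : ∀ j, IsEvenSolution (lam j))
    (r : Fin 3 → ℝ) : IsEvenSolution fun s x => ∑ j, r j * lam j s x := by
  simp only [Fin.sum_univ_three]
  exact (((h 0).const_mul _).add ((h 1).const_mul _)).add ((h 2).const_mul _)

/-! ### Lorentz invariance of the wave equation -/

theorem rotD_neg_apply {f g : S2 → ℝ} (hf : SmoothS2 f) (h : ∀ x, f (-x) = g x) (j : Fin 3)
    (x : S2) : rotD j f (-x) = rotD j g x := by
  have hd := (hf.differentiableAt (coe_ne_zero (-x))).hasFDerivAt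
  have h1 : HasFDerivAt (fun y : E3 => radialExt f (-y))
      ((fderiv ℝ (radialExt f) ((-x : S2) : E3)).comp (-ContinuousLinearMap.id ℝ E3)) (x : E3) :=
    HasFDerivAt.comp (x : E3) (f := fun y : E3 => -y) hd (hasFDerivAt_id (x : E3)).neg
  have h2 := rotD_of_hasFDerivAt (f := g) (G := fun y : E3 => radialExt f (-y))
    (fun z => by rw [← h]; exact (radialExt_coe f (-z)).symm) j h1
  rw [h2, rotD]
  have h3 : rotGen j (((-x : S2)) : E3) = -rotGen j (x : E3) := map_neg (rotGen j) (x : E3)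
  rw [h3]
  simp

theorem IsEvenSolution.rotD {lam : ℝ → S2 → ℝ} (h : IsEvenSolution lam) (j : Fin 3) :
    IsEvenSolution fun s => rotD j (lam s) := by
  refine isEvenSolution_of_wave_eq (h.smooth.rotD j) (fun s hs x => ?_) fun s hs x => ?_
  · have e : dS (dS fun s => LargeU1.rotD j (lam s)) s x = LargeU1.rotD j (dS (dS lam) s) x := by
      rw [dS_congr (fun s hs x => dS_rotD h.smooth j hs x) hs, dS_rotD h.smooth.dS j hs]
    rw [e, lap_rotD (h.smooth.slice hs), rotD_congr (fun x => (h.wave_eq hs x).symm),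
      rotD_const_mul (h.smooth.dS.dS.slice hs)]
  · exact rotD_neg_apply (h.smooth.slice (neg_mem_Ioo' hs)) (h.even s hs) j x

/-- The action of the `i`-th boost on functions on the hyperboloid. -/
def boostD (i : Fin 3) (lam : ℝ → S2 → ℝ) (s : ℝ) (x : S2) : ℝ :=
  (1 - s ^ 2) * (coordS i x * dS lam s x) + s * gradD i (lam s) x

theorem SmoothHyp.gradD {lam : ℝ → S2 → ℝ} (h : SmoothHyp lam) (i : Fin 3) :
    SmoothHyp fun s => gradD i (lam s) :=
  SmoothHyp.sum fun k _ =>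
    (smoothS2_iff_smoothHyp.1 ((smoothS2_coordS i).rotD k)).mul (h.rotD k)

theorem smoothHyp_fst : SmoothHyp fun s _ => s :=
  smoothHyp_of_contDiffOn contDiff_id.contDiffOn

theorem smoothHyp_one_sub_sq : SmoothHyp fun s _ => 1 - s ^ 2 :=
  smoothHyp_of_contDiffOn (contDiff_const.sub (contDiff_id.pow 2)).contDiffOn

theorem SmoothHyp.boostD {lam : ℝ → S2 → ℝ} (h : SmoothHyp lam) (i : Fin 3) :
    SmoothHyp (boostD i lam) :=
  (smoothHyp_one_sub_sq.mul ((smoothS2_iff_smoothHyp.1 (smoothS2_coordS i)).mul h.dS)).add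
    (smoothHyp_fst.mul (h.gradD i))

theorem dS_gradD {lam : ℝ → S2 → ℝ} (h : SmoothHyp lam) (i : Fin 3) {s : ℝ}
    (hs : s ∈ Ioo (-1 : ℝ) 1) (x : S2) : dS (fun s => gradD i (lam s)) s x = gradD i (dS lam s) x := by
  have h1 : HasDerivAt (fun σ => gradD i (lam σ) x)
      (∑ k, rotD k (coordS i) x * dS (fun s => rotD k (lam s)) s x) s :=
    HasDerivAt.fun_sum fun k _ => (hasDerivAt_of_smoothHyp (h.rotD k) hs x).const_mul _
  rw [dS, h1.deriv]
  exact Finset.sum_congr rfl fun k _ => by rw [dS_rotD h k hs]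

theorem hasDerivAt_one_sub_sq (s : ℝ) : HasDerivAt (fun s : ℝ => 1 - s ^ 2) (-(2 * s)) s := by
  simpa using (hasDerivAt_pow 2 s).const_sub 1

theorem dS_boostD {lam : ℝ → S2 → ℝ} (h : SmoothHyp lam) (i : Fin 3) {s : ℝ}
    (hs : s ∈ Ioo (-1 : ℝ) 1) (x : S2) : dS (boostD i lam) s x
      = -(2 * s) * (coordS i x * dS lam s x) + (1 - s ^ 2) * (coordS i x * dS (dS lam) s x)
        + gradD i (lam s) x + s * gradD i (dS lam s) x := by
  have h1 := ((hasDerivAt_one_sub_sq s).mul ((hasDerivAt_of_smoothHyp h.dS hs x).const_mul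
    (coordS i x))).add ((hasDerivAt_id s).mul (hasDerivAt_of_smoothHyp (h.gradD i) hs x))
  refine h1.deriv.trans ?_
  rw [dS_gradD h i hs]
  simp only [id]
  ring

theorem gradD_congr {f g : S2 → ℝ} (h : ∀ x, f x = g x) (i : Fin 3) (x : S2) :
    gradD i f x = gradD i g x := by rw [funext h]

theorem gradD_const_mul {f : S2 → ℝ} (hf : SmoothS2 f) (c : ℝ) (i : Fin 3) (x : S2) :
    gradD i (fun x => c * f x) x = c * gradD i f x := by
  simp only [gradD, rotD_const_mul hf, Finset.mul_sum]
  exact Finset.sum_congr rfl fun k _ => by ring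

/-- The operator (1 - s²) ∂_s² - Δ is applied to the boosted function. The commutators of Δ with x_i
and with the gradient field, the wave equation and its s-derivative make all terms cancel. -/
theorem IsEvenSolution.boostD {lam : ℝ → S2 → ℝ} (h : IsEvenSolution lam) (i : Fin 3) :
    IsEvenSolution (boostD i lam) := by
  refine isEvenSolution_of_wave_eq (h.smooth.boostD i) (fun s hs x => ?_) fun s hs x => ?_
  · have hd := hasDerivAt_of_smoothHyp h.smooth.dS.dS hs x
    -- The s-derivative of the wave equation, which eliminates the third derivative in s.
    have hW : (1 - s ^ 2) * dS (dS (dS lam)) s x - 2 * s * dS (dS lam) s x = lap (dS lam s) x := by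
      have e1 : dS (fun s x => (1 - s ^ 2) * dS (dS lam) s x) s x
          = dS (fun s x => lap (lam s) x) s x := dS_congr (fun s hs x => h.wave_eq hs x) hs x
      have e2 : HasDerivAt (fun σ => lap (lam σ) x)
          (∑ k, dS (fun s => LargeU1.rotD k (LargeU1.rotD k (lam s))) s x) s :=
        HasDerivAt.fun_sum fun k _ => hasDerivAt_of_smoothHyp ((h.smooth.rotD k).rotD k) hs x
      have e3 : ∀ k, dS (fun s => LargeU1.rotD k (LargeU1.rotD k (lam s))) s x
          = LargeU1.rotD k (LargeU1.rotD k (dS lam s)) x := fun k => by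
        rw [dS_rotD (h.smooth.rotD k) k hs, rotD_congr fun x => dS_rotD h.smooth k hs x]
      have e4 : dS (fun s x => lap (lam s) x) s x = lap (dS lam s) x := by
        refine e2.deriv.trans ?_
        simp only [e3]; rfl
      have e5 := ((hasDerivAt_one_sub_sq s).mul hd).deriv
      have e6 : dS (fun s x => (1 - s ^ 2) * dS (dS lam) s x) s x = _ := e5
      rw [← e4, ← e1, e6]; ring
    have hg : HasDerivAt (fun σ => -(2 * σ) * (coordS i x * dS lam σ x)
        + (1 - σ ^ 2) * (coordS i x * dS (dS lam) σ x) + LargeU1.gradD i (lam σ) x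
        + σ * LargeU1.gradD i (dS lam σ) x)
        (-2 * (coordS i x * dS lam s x) - (2 * s) * (coordS i x * dS (dS lam) s x)
          + (-(2 * s) * (coordS i x * dS (dS lam) s x)
            + (1 - s ^ 2) * (coordS i x * dS (dS (dS lam)) s x))
          + LargeU1.gradD i (dS lam s) x
          + (LargeU1.gradD i (dS lam s) x + s * LargeU1.gradD i (dS (dS lam) s) x)) s := by
      have a1 : HasDerivAt (fun σ : ℝ => -(2 * σ)) (-2) s :=
        ((hasDerivAt_id s).const_mul (2 : ℝ)).neg.congr_deriv (by simp)
      have a2 := hasDerivAt_of_smoothHyp (h.smooth.gradD i) hs x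
      have a3 := hasDerivAt_of_smoothHyp (h.smooth.dS.gradD i) hs x
      rw [dS_gradD h.smooth i hs] at a2
      rw [dS_gradD h.smooth.dS i hs] at a3
      refine ((((a1.mul ((hasDerivAt_of_smoothHyp h.smooth.dS hs x).const_mul (coordS i x))).add
        ((hasDerivAt_one_sub_sq s).mul (hd.const_mul (coordS i x)))).add a2).add
        ((hasDerivAt_id s).mul a3)).congr_deriv ?_
      simp only [id]; ring
    have e7 : dS (dS (LargeU1.boostD i lam)) s x = _ :=
      (dS_congr (lam' := fun σ x => -(2 * σ) * (coordS i x * dS lam σ x)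
        + (1 - σ ^ 2) * (coordS i x * dS (dS lam) σ x) + LargeU1.gradD i (lam σ) x
        + σ * LargeU1.gradD i (dS lam σ) x)
        (fun s hs x => dS_boostD h.smooth i hs x) hs x).trans hg.deriv
    have s1 := h.smooth.slice hs
    have s2 := h.smooth.dS.slice hs
    have e8 : lap (LargeU1.boostD i lam s) x = (1 - s ^ 2) * (coordS i x * lap (dS lam s) x
        - 2 * coordS i x * dS lam s x + 2 * LargeU1.gradD i (dS lam s) x)
        + s * (LargeU1.gradD i (lap (lam s)) x - 2 * coordS i x * lap (lam s) x) := by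
      rw [← lap_coordS_mul s2, ← lap_gradD s1, ← lap_const_mul ((smoothS2_coordS i).mul s2),
        ← lap_const_mul (s1.gradD i), ← lap_add (((smoothS2_coordS i).mul s2).const_mul _)
        ((s1.gradD i).const_mul _)]
      rfl
    have e9 : LargeU1.gradD i (lap (lam s)) x
        = (1 - s ^ 2) * LargeU1.gradD i (dS (dS lam) s) x := by
      rw [gradD_congr fun x => (h.wave_eq hs x).symm,
        gradD_const_mul (h.smooth.dS.dS.slice hs)]
    rw [e7, e8, e9, ← hW, ← h.wave_eq hs]
    ring
  -- Evenness: under the antipodal map x_i, ∂_s λ, s and the derivative along the gradient of x_i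
  -- are all odd, and they occur in pairs.
  · have e1 : coordS i (-x) = -coordS i x := rfl
    have e2 : LargeU1.gradD i (lam (-s)) (-x) = -LargeU1.gradD i (lam s) x := by
      simp only [LargeU1.gradD, ← Finset.sum_neg_distrib]
      refine Finset.sum_congr rfl fun k _ => ?_
      have h3 : rotGen k (((-x : S2)) : E3) = -rotGen k (x : E3) := map_neg (rotGen k) (x : E3)
      rw [rotD_neg_apply (h.smooth.slice (neg_mem_Ioo' hs)) (h.even s hs), rotD_coordS, rotD_coordS,
        h3]
      simp
    rw [LargeU1.boostD, LargeU1.boostD, e1, e2, h.dS_neg hs]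
    ring

theorem IsEvenSolution.hypLie {lam : ℝ → S2 → ℝ} (h : IsEvenSolution lam) (M : so31) :
    IsEvenSolution (hypLie (boostPart M) (rotPart M) lam) :=
  ((IsEvenSolution.sum_three (fun j => h.rotD j) (rotVec M)).add
    (IsEvenSolution.sum_three (fun i => h.boostD i) fun i => boostVec M i)).congr
      fun _ hs x => hypLie_eq h.smooth M hs x

/-! ### The Lorentz vector fields from Minkowski space -/

/-- The extension to spacelike points is homogeneous of degree 0, with s = t/‖y‖ and direction
y/‖y‖. The chain rule along p + τ Mp gives components independent of r. -/
theorem hasDerivAt_linearField {lam : ℝ → S2 → ℝ} (h : SmoothHyp lam) (M : so31) {s : ℝ}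
    (hs : s ∈ Ioo (-1 : ℝ) 1) (x : S2) {r : ℝ} (hr : 0 < r) :
    HasDerivAt (fun τ : ℝ => (fun q : ℝ × E3 => radialExt (lam (q.1 / ‖q.2‖)) q.2)
      ((r * s, r • (x : E3)) + τ • linearField M (r * s, r • (x : E3))))
      (hypLie (boostPart M) (rotPart M) lam s x) 0 := by
  set v := linearField M (r * s, r • (x : E3)) with hv
  set y : E3 := r • (x : E3) with hy
  have hy0 : y ≠ 0 := smul_ne_zero hr.ne' (coe_ne_zero x)
  have hyn : ‖y‖ = r := by rw [hy, norm_smul, norm_coe, Real.norm_of_nonneg hr.le, mul_one]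
  have c1 : HasDerivAt (fun τ : ℝ => r * s + τ * v.1) v.1 0 := by
    simpa using ((hasDerivAt_id (0 : ℝ)).mul_const v.1).const_add (r * s)
  have c2 : HasDerivAt (fun τ : ℝ => y + τ • v.2) v.2 0 :=
    (((hasDerivAt_id (0 : ℝ)).smul_const v.2).const_add y).congr_deriv (by simp)
  have c3 : HasDerivAt (fun τ : ℝ => ‖y + τ • v.2‖) (inner ℝ y v.2 / r) 0 := by
    have e := c2.norm_sq.sqrt (by simp [hy0])
    simp only [norm_nonneg, Real.sqrt_sq, zero_smul, add_zero, hyn] at e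
    exact e.congr_deriv (by rw [Real.sqrt_sq hr.le]; field_simp)
  have hw : inner ℝ y v.2 = r * (r * s * inner ℝ (boostVec M) (x : E3)) := by
    rw [hv, linearField_eq]
    simp only
    rw [inner_add_right, inner_spaceMap_self, add_zero, real_inner_smul_right, hy,
      real_inner_smul_left, real_inner_comm]
    ring
  have hv1 : v.1 = r * inner ℝ (boostVec M) (x : E3) := by
    rw [hv, linearField_eq]
    simp only
    rw [hy, real_inner_smul_right]
  -- The rotation part is orthogonal to y, so only the boost moves s; its component (1 - s²) ⟨c, x⟩
  -- is -(1 - s²) b.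
  have c4 : HasDerivAt (fun τ : ℝ => (r * s + τ * v.1) / ‖y + τ • v.2‖)
      ((1 - s ^ 2) * inner ℝ (boostVec M) (x : E3)) 0 := by
    refine (c1.div c3 (by simp [hy0])).congr_deriv ?_
    simp only [zero_smul, add_zero, zero_mul, hyn]
    rw [hw, hv1]
    field_simp
  have c5 := c4.prodMk c2
  have hp : (s, y) ∈ flatDom := ⟨hs, hy0⟩
  have hd := (h.differentiableAt hp).hasFDerivAt
  have he : ((r * s + (0 : ℝ) * v.1) / ‖y + (0 : ℝ) • v.2‖, y + (0 : ℝ) • v.2) = (s, y) := by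
    simp only [zero_smul, add_zero, zero_mul, hyn]
    rw [mul_div_cancel_left₀ _ hr.ne']
  have c6 := HasFDerivAt.comp_hasDerivAt (0 : ℝ)
    (f := fun τ : ℝ => ((r * s + τ * v.1) / ‖y + τ • v.2‖, y + τ • v.2)) (by rw [he]; exact hd) c5
  refine HasDerivAt.congr_deriv (f' := _) c6 ?_
  have hf : ∀ f : ℝ → S2 → ℝ, flatExt f (s, y) = f s x := fun f => by
    rw [flatExt, hy, radialExt_smul _ hr (coe_ne_zero x), radialExt_coe]
  have hj : ∀ j, inner ℝ (rotGen j y) v.2 = r ^ 2 * inner ℝ (spaceMap M x + s • boostVec M)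
      (rotGen j (x : E3)) := fun j => by
    rw [hv, linearField_eq]
    simp only
    rw [hy, map_smul, map_smul, real_inner_smul_left, real_inner_comm, inner_add_left,
      inner_add_left, real_inner_smul_left, real_inner_smul_left, real_inner_smul_left]
    ring
  rw [fderiv_flatExt h hp]
  simp only [hf, hj, hyn]
  have h1 : hypLie (boostPart M) (rotPart M) lam s x
      = (1 - s ^ 2) * inner ℝ (boostVec M) (x : E3) * dS lam s x
        + confD (spaceMap M) (s • boostVec M) (lam s) x := by
    rw [hypLie, boostPart_eq, inner_boostVec, confD_eq (h.slice hs), along_eq (h.slice hs), dS]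
    congr 1
    · simp only [coordS]; ring
    · refine Finset.sum_congr rfl fun j _ => ?_
      rw [inner_sub_left, real_inner_smul_left, inner_sphereGrad_rotGen, rotD_boostPart, rotPart_eq,
        inner_add_left, real_inner_smul_left]
      ring
  rw [h1, confD_eq (h.slice hs)]
  congr 1
  refine Finset.sum_congr rfl fun j _ => ?_
  field_simp

/-! ### The Lorentz action on the two parametrizations -/

/-- The angular derivatives converge to those of the limit and (1 - s²) ∂_s λ tends to 0, so the
field tends to its tangential part at s = 1. -/
theorem IsEvenSolution.futureLimit_hypLie {lam : ℝ → S2 → ℝ} (h : IsEvenSolution lam) (M : so31)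
    {f : S2 → ℝ} (hf : FutureLimit lam f) :
    FutureLimit (LargeU1.hypLie (boostPart M) (rotPart M) lam)
      (deltaScri (boostPart M) (rotPart M) f) := by
  have hm := h.hasModeExpansion
  obtain rfl := hf.unique hm.futureLimit
  intro x
  have hid : Tendsto (fun s : ℝ => s) (𝓝[<] 1) (𝓝 1) := tendsto_id.mono_left nhdsWithin_le_nhds
  have h1 := tendsto_finsetSum Finset.univ fun j _ =>
    (hm.rotD_futureLimit j x).const_mul (rotVec M j)
  have h2 := tendsto_finsetSum Finset.univ fun i _ =>
    (((hm.dS_futureLimit x).const_mul (coordS i x)).add (hid.mul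
      (tendsto_finsetSum Finset.univ fun k _ =>
        (hm.rotD_futureLimit k x).const_mul (LargeU1.rotD k (coordS i) x)))).const_mul (boostVec M i)
  have h3 := h1.add h2
  have e : deltaScri (boostPart M) (rotPart M) (harmSeries _) x = _ :=
    deltaScri_eq (smoothS2_harmSeries hm.1) M x
  rw [e]
  simp only [mul_zero, zero_add, one_mul] at h3
  refine h3.congr' ?_
  filter_upwards [ioo_mem_future] with s hs
  rw [hypLie_eq h.smooth M hs]
  congr 1
  exact Finset.sum_congr rfl fun i _ => by rw [gradD]; ring

/-- The first component is the Lie derivative read at s = 0. For the second, the s-derivative of a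
boost at 0 is x_i ∂_s² λ plus the gradient term; replacing ∂_s² λ by Δλ turns this into the
divergence of b times the gradient. -/
theorem IsEvenSolution.cauchyData_hypLie {lam : ℝ → S2 → ℝ} (h : IsEvenSolution lam) (M : so31)
    {p : (S2 → ℝ) × (S2 → ℝ)} (hp : CauchyData lam p) :
    CauchyData (LargeU1.hypLie (boostPart M) (rotPart M) lam)
      (deltaHam (boostPart M) (rotPart M) p) := by
  obtain rfl := hp.eq
  have s1 := h.smooth.slice zero_mem_Ioo'
  have s2 := h.smooth.dS.slice zero_mem_Ioo'
  have hb := smoothS2_boostPart M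
  intro x
  constructor
  · simp only [LargeU1.hypLie, deltaHam, zero_smul, sub_zero, dS]
    ring
  · have hd : HasDerivAt (fun s => LargeU1.hypLie (boostPart M) (rotPart M) lam s x)
        (∑ j, rotVec M j * LargeU1.rotD j (dS lam 0) x + ∑ i, boostVec M i *
          (coordS i x * lap (lam 0) x + gradD i (lam 0) x)) 0 := by
      have a1 : HasDerivAt (fun s => ∑ j, rotVec M j * LargeU1.rotD j (lam s) x)
          (∑ j, rotVec M j * LargeU1.rotD j (dS lam 0) x) 0 :=
        HasDerivAt.fun_sum fun j _ => by
          rw [← dS_rotD h.smooth j zero_mem_Ioo']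
          exact (hasDerivAt_of_smoothHyp (h.smooth.rotD j) zero_mem_Ioo' x).const_mul _
      have a2 : HasDerivAt (fun s => ∑ i, boostVec M i * LargeU1.boostD i lam s x)
          (∑ i, boostVec M i * (coordS i x * lap (lam 0) x + gradD i (lam 0) x)) 0 :=
        HasDerivAt.fun_sum fun i _ => by
          have := hasDerivAt_of_smoothHyp (h.smooth.boostD i) zero_mem_Ioo' x
          rw [dS_boostD h.smooth i zero_mem_Ioo'] at this
          refine (this.const_mul _).congr_deriv ?_
          rw [← h.wave_eq zero_mem_Ioo']
          ring
      refine (a1.add a2).congr_of_eventuallyEq ?_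
      filter_upwards [isOpen_Ioo.mem_nhds zero_mem_Ioo'] with s hs using hypLie_eq h.smooth M hs x
    have hdiv : sphereDiv (fun z => boostPart M z • sphereGrad (lam 0) z) x
        = boostPart M x * lap (lam 0) x
          + ∑ j, LargeU1.rotD j (boostPart M) x * LargeU1.rotD j (lam 0) x := by
      have e : (fun z => boostPart M z • sphereGrad (lam 0) z)
          = fun z : S2 => ∑ j, (boostPart M z * LargeU1.rotD j (lam 0) z) • rotGen j (z : E3) := by
        funext z
        rw [sphereGrad_eq s1, Finset.smul_sum]
        exact Finset.sum_congr rfl fun j _ => smul_smul _ _ _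
      rw [e, sphereDiv_sum_rotGen fun j => hb.mul (s1.rotD j), lap, Finset.mul_sum,
        ← Finset.sum_add_distrib]
      exact Finset.sum_congr rfl fun j _ => by rw [rotD_mul hb (s1.rotD j)]; ring
    rw [hd.deriv]
    simp only [deltaHam]
    rw [along_rotPart s2, hdiv, boostPart_eq]
    simp only [rotD_boostPart, neg_mul, Finset.sum_neg_distrib]
    rw [sum_inner_boostVec_mul_rotD]
    simp only [mul_add, Finset.sum_add_distrib, Finset.sum_mul]
    rw [Finset.sum_congr rfl fun i _ => (mul_assoc (boostVec M i) (coordS i x) (lap (lam 0) x)).symm]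
    ring

/-! ### Representations of the Lorentz algebra -/

/-- Both sides are derivatives along tangential parts of affine fields, so only vectors have to be
compared. The terms ⟨x, d⟩ c - ⟨x, c⟩ d from two boosts are the rotation that the matrix bracket
puts in the spatial block. -/
theorem deltaScri_lie {f : S2 → ℝ} (hf : SmoothS2 f) (M N : so31) (x : S2) :
    deltaScri (boostPart ⁅M, N⁆) (rotPart ⁅M, N⁆) f x
      = deltaScri (boostPart N) (rotPart N) (deltaScri (boostPart M) (rotPart M) f) x
        - deltaScri (boostPart M) (rotPart M) (deltaScri (boostPart N) (rotPart N) f) x := by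
  have hsm := fun M : so31 => hf.confD (spaceMap M) (boostVec M)
  have e := fun M : so31 => funext fun x => deltaScri_eq_confD hf M x
  rw [e M, e N, deltaScri_eq_confD (hsm M), deltaScri_eq_confD (hsm N), deltaScri_eq_confD hf,
    confD_comm hf, confD]
  congr 1
  have hb : (⁅M, N⁆ : so31).1 = M.1 * N.1 - N.1 * M.1 := rfl
  have hs := fun M : so31 => so31_symm M
  rw [inner_add_right, inner_add_right, inner_spaceMap_self, inner_spaceMap_self,
    real_inner_comm, inner_boostVec, real_inner_comm, inner_boostVec]
  ext i
  simp only [PiLp.add_apply, PiLp.sub_apply, PiLp.smul_apply, smul_eq_mul, spaceMap_apply,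
    boostVec_apply, hb, Matrix.sub_apply, Matrix.mul_apply, Fintype.sum_sum_type,
    Finset.univ_unique, Fin.default_eq_zero, Finset.sum_singleton, (hs M).2.1, (hs N).2.1,
    (hs M).2.2, (hs N).2.2, Fin.sum_univ_three]
  ring

theorem smoothS2_deltaScri {f : S2 → ℝ} (hf : SmoothS2 f) (M : so31) :
    SmoothS2 (deltaScri (boostPart M) (rotPart M) f) := by
  rw [funext fun x => deltaScri_eq_confD hf M x]
  exact hf.confD _ _

/-- A derivation of an abelian Lie algebra is just a linear map. -/
def scriDerivation (T : scriParams →ₗ[ℝ] scriParams) : LieDerivation ℝ scriParams scriParams where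
  toLinearMap := T
  leibniz' a b := by
    rw [show ⁅a, b⁆ = 0 from rfl, show ⁅a, T b⁆ = 0 from rfl, show ⁅b, T a⁆ = 0 from rfl, map_zero,
      sub_zero]

/-- A derivation of an abelian Lie algebra is just a linear map. -/
def hamDerivation (T : hamParams →ₗ[ℝ] hamParams) : LieDerivation ℝ hamParams hamParams where
  toLinearMap := T
  leibniz' a b := by
    rw [show ⁅a, b⁆ = 0 from rfl, show ⁅a, T b⁆ = 0 from rfl, show ⁅b, T a⁆ = 0 from rfl, map_zero,
      sub_zero]

theorem gradD_add {f g : S2 → ℝ} (hf : SmoothS2 f) (hg : SmoothS2 g) (i : Fin 3) (x : S2) :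
    gradD i (fun x => f x + g x) x = gradD i f x + gradD i g x := by
  simp only [gradD, rotD_add hf hg, mul_add, Finset.sum_add_distrib]

/-- The action `-δ_M` on the null-infinity parameters. -/
def scriAct (M : so31) : scriParams →ₗ[ℝ] scriParams where
  toFun f := ⟨-deltaScri (boostPart M) (rotPart M) f.1,
    scriParams.neg_mem (smoothS2_deltaScri f.2 M)⟩
  map_add' f g := by
    apply Subtype.ext
    funext x
    have e : ∀ h : scriParams, deltaScri (boostPart M) (rotPart M) h.1 x = _ := fun h =>
      deltaScri_eq h.2 M x
    have e' : (f + g).1 = fun x => f.1 x + g.1 x := rfl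
    simp only [Submodule.coe_add, Pi.neg_apply, Pi.add_apply]
    rw [← Submodule.coe_add, e, e, e, e']
    simp only [rotD_add f.2 g.2, gradD_add f.2 g.2, mul_add, Finset.sum_add_distrib]
    ring
  map_smul' r f := by
    apply Subtype.ext
    funext x
    have e : ∀ h : scriParams, deltaScri (boostPart M) (rotPart M) h.1 x = _ := fun h =>
      deltaScri_eq h.2 M x
    have e' : (r • f).1 = fun x => r * f.1 x := rfl
    simp only [Submodule.coe_smul, Pi.neg_apply, Pi.smul_apply, RingHom.id_apply]
    rw [← Submodule.coe_smul, e, e, e']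
    simp only [rotD_const_mul f.2, gradD_const_mul f.2, smul_eq_mul, mul_left_comm _ r,
      ← Finset.mul_sum]
    ring

theorem rotVec_add (M N : so31) (j : Fin 3) : rotVec (M + N) j = rotVec M j + rotVec N j := by
  fin_cases j <;> rfl

theorem boostVec_add (M N : so31) (i : Fin 3) :
    boostVec (M + N) i = boostVec M i + boostVec N i := rfl

theorem rotVec_smul (r : ℝ) (M : so31) (j : Fin 3) : rotVec (r • M) j = r * rotVec M j := by
  fin_cases j <;> rfl

theorem boostVec_smul (r : ℝ) (M : so31) (i : Fin 3) : boostVec (r • M) i = r * boostVec M i := rfl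

/-- The representation of the Lorentz algebra on the null-infinity parameters. -/
def scriRep : so31 →ₗ⁅ℝ⁆ LieDerivation ℝ scriParams scriParams where
  toFun M := scriDerivation (scriAct M)
  map_add' M N := by
    refine LieDerivation.ext fun f => Subtype.ext (funext fun x => ?_)
    change -deltaScri _ _ f.1 x = -deltaScri _ _ f.1 x + -deltaScri _ _ f.1 x
    rw [deltaScri_eq f.2, deltaScri_eq f.2, deltaScri_eq f.2]
    simp only [rotVec_add, boostVec_add, add_mul, Finset.sum_add_distrib]
    ring
  map_smul' r M := by
    refine LieDerivation.ext fun f => Subtype.ext (funext fun x => ?_)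
    change -deltaScri _ _ f.1 x = r * -deltaScri _ _ f.1 x
    rw [deltaScri_eq f.2, deltaScri_eq f.2]
    simp only [rotVec_smul, boostVec_smul, mul_assoc, ← Finset.mul_sum]
    ring
  map_lie' {M N} := by
    refine LieDerivation.ext fun f => Subtype.ext (funext fun x => ?_)
    rw [LieDerivation.commutator_apply]
    change -deltaScri _ _ f.1 x = -deltaScri _ _ (-deltaScri _ _ f.1) x
      - -deltaScri _ _ (-deltaScri _ _ f.1) x
    have e : ∀ (M : so31) {g : S2 → ℝ}, SmoothS2 g → deltaScri (boostPart M) (rotPart M) (-g) x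
        = -deltaScri (boostPart M) (rotPart M) g x := fun M g hg => by
      have h := congrFun (congrArg Subtype.val ((scriAct M).map_neg ⟨g, hg⟩)) x
      change -deltaScri _ _ (-g) x = - -deltaScri _ _ g x at h
      linarith
    rw [e M (smoothS2_deltaScri f.2 N), e N (smoothS2_deltaScri f.2 M), deltaScri_lie f.2]
    ring

/-! ### The matching of the two symmetry algebras -/

/-- `p` and `f` are the Cauchy data and the future limit of an even solution. -/
def Matched (p : (S2 → ℝ) × (S2 → ℝ)) (f : S2 → ℝ) : Prop :=
  ∃ lam, IsEvenSolution lam ∧ CauchyData lam p ∧ FutureLimit lam f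

theorem Matched.exists_right (p : hamParams) : ∃ f : scriParams, Matched p.1 f.1 := by
  obtain ⟨lam, h, hc, -⟩ := exists_of_hamParams p.2
  have hm := h.hasModeExpansion
  exact ⟨⟨harmSeries _, smoothS2_harmSeries hm.1⟩, lam, h, hc, hm.futureLimit⟩

theorem Matched.exists_left (f : scriParams) : ∃ p : hamParams, Matched p.1 f.1 := by
  obtain ⟨lam, h, hf, -⟩ := exists_of_scriParams f.2
  exact ⟨⟨_, h.mem_hamParams⟩, lam, h, cauchyData_self lam, hf⟩

/-- Cauchy data fix the solution on the open interval, hence its limit. -/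
theorem Matched.right_unique {p : (S2 → ℝ) × (S2 → ℝ)} {f g : S2 → ℝ} (hf : Matched p f)
    (hg : Matched p g) : f = g := by
  obtain ⟨lam, h, hc, hl⟩ := hf
  obtain ⟨lam', h', hc', hl'⟩ := hg
  obtain rfl := hc.eq
  obtain ⟨mu, -, -, hu⟩ := exists_of_hamParams h.mem_hamParams
  funext x
  refine tendsto_nhds_unique (hl x) ((hl' x).congr' ?_)
  filter_upwards [ioo_mem_future] with s hs
  rw [hu lam' h' hc' s hs, hu lam h hc s hs]

theorem Matched.left_unique {p q : (S2 → ℝ) × (S2 → ℝ)} {f : S2 → ℝ} (hp : Matched p f)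
    (hq : Matched q f) : p = q := by
  obtain ⟨lam, h, hc, hl⟩ := hp
  obtain ⟨lam', h', hc', hl'⟩ := hq
  have hm := h.hasModeExpansion
  have hf : f ∈ scriParams := hl.unique hm.futureLimit ▸ smoothS2_harmSeries hm.1
  obtain ⟨mu, -, -, hu⟩ := exists_of_scriParams hf
  have e : ∀ s ∈ Ioo (-1 : ℝ) 1, ∀ x, lam s x = lam' s x := fun s hs x => by
    rw [hu lam' h' hl' s hs, hu lam h hl s hs]
  rw [hc.eq, hc'.eq]
  exact Prod.ext (funext (e 0 zero_mem_Ioo')) (funext fun x => dS_congr e zero_mem_Ioo' x)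

theorem Matched.add {p q : (S2 → ℝ) × (S2 → ℝ)} {f g : S2 → ℝ} (h : Matched p f)
    (h' : Matched q g) : Matched (p + q) (f + g) := by
  obtain ⟨lam, h, hc, hl⟩ := h
  obtain ⟨lam', h', hc', hl'⟩ := h'
  refine ⟨_, h.add h', fun x => ⟨congrArg₂ (· + ·) (hc x).1 (hc' x).1, ?_⟩,
    fun x => (hl x).add (hl' x)⟩
  have := (hasDerivAt_of_smoothHyp h.smooth zero_mem_Ioo' x).add
    (hasDerivAt_of_smoothHyp h'.smooth zero_mem_Ioo' x)
  exact this.deriv.trans (congrArg₂ (· + ·) (hc x).2 (hc' x).2)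

theorem Matched.smul {p : (S2 → ℝ) × (S2 → ℝ)} {f : S2 → ℝ} (h : Matched p f) (r : ℝ) :
    Matched (r • p) (r • f) := by
  obtain ⟨lam, h, hc, hl⟩ := h
  refine ⟨_, h.const_mul r, fun x => ⟨congrArg (r * ·) (hc x).1, ?_⟩,
    fun x => (hl x).const_mul r⟩
  have := (hasDerivAt_of_smoothHyp h.smooth zero_mem_Ioo' x).const_mul r
  exact this.deriv.trans (congrArg (r * ·) (hc x).2)

/-- The Lie derivative of one solution witnesses both transformed parameters at once; this is the
equivariance of Φ. -/
theorem Matched.neg_delta {p : (S2 → ℝ) × (S2 → ℝ)} {f : S2 → ℝ} (h : Matched p f) (M : so31) :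
    Matched (-deltaHam (boostPart M) (rotPart M) p) (-deltaScri (boostPart M) (rotPart M) f) := by
  obtain ⟨lam, h, hc, hl⟩ := h
  have h1 : Matched (deltaHam (boostPart M) (rotPart M) p)
      (deltaScri (boostPart M) (rotPart M) f) :=
    ⟨_, h.hypLie M, h.cauchyData_hypLie M hc, h.futureLimit_hypLie M hl⟩
  have h2 := h1.smul (-1)
  rwa [neg_one_smul, neg_one_smul] at h2

theorem Matched.mem_hamParams {p : (S2 → ℝ) × (S2 → ℝ)} {f : S2 → ℝ} (h : Matched p f) :
    p ∈ hamParams := by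
  obtain ⟨lam, h, hc, -⟩ := h
  rw [hc.eq]; exact h.mem_hamParams

/-- The null-infinity parameter of the even solution with given Cauchy data. -/
def matchFun (p : hamParams) : scriParams := (Matched.exists_right p).choose

theorem matched_matchFun (p : hamParams) : Matched p.1 (matchFun p).1 :=
  (Matched.exists_right p).choose_spec

theorem matchFun_eq_iff {p : hamParams} {f : scriParams} : matchFun p = f ↔ Matched p.1 f.1 :=
  ⟨fun h => h ▸ matched_matchFun p, fun h => Subtype.ext ((matched_matchFun p).right_unique h)⟩

/-- The linear isomorphism from Cauchy data to null-infinity parameters. -/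
def matchEquiv : hamParams ≃ₗ[ℝ] scriParams :=
  LinearEquiv.ofBijective
    { toFun := matchFun
      map_add' := fun p q => matchFun_eq_iff.2 ((matched_matchFun p).add (matched_matchFun q))
      map_smul' := fun r p => matchFun_eq_iff.2 ((matched_matchFun p).smul r) }
    ⟨fun p q h => Subtype.ext ((matched_matchFun p).left_unique (by
        have h' : matchFun p = matchFun q := h
        rw [h']; exact matched_matchFun q)),
      fun f => (Matched.exists_left f).imp fun _ hp => matchFun_eq_iff.2 hp⟩

theorem matchEquiv_eq_iff {p : hamParams} {f : scriParams} :
    matchEquiv p = f ↔ Matched p.1 f.1 := matchFun_eq_iff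

theorem matched_matchEquiv (p : hamParams) : Matched p.1 (matchEquiv p).1 := matched_matchFun p

/-- The action on the Hamiltonian parameters, transported from null infinity. -/
def hamAct (M : so31) : hamParams →ₗ[ℝ] hamParams :=
  matchEquiv.symm.toLinearMap ∘ₗ scriAct M ∘ₗ matchEquiv.toLinearMap

theorem matchEquiv_hamAct (M : so31) (p : hamParams) :
    matchEquiv (hamAct M p) = scriAct M (matchEquiv p) := matchEquiv.apply_symm_apply _

/-- Since matched pairs stay matched under both actions and Φ is injective, the transported action
is the explicit one. Its linearity and bracket relations then need no separate computation. -/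
theorem hamAct_coe (M : so31) (p : hamParams) :
    (hamAct M p).1 = -deltaHam (boostPart M) (rotPart M) p.1 := by
  have h := (matched_matchEquiv p).neg_delta M
  have h2 : matchEquiv ⟨_, h.mem_hamParams⟩ = scriAct M (matchEquiv p) := matchEquiv_eq_iff.2 h
  rw [← matchEquiv_hamAct] at h2
  exact (congrArg Subtype.val (matchEquiv.injective h2)).symm

/-- The representation of the Lorentz algebra on the Hamiltonian parameters. -/
def hamRep : so31 →ₗ⁅ℝ⁆ LieDerivation ℝ hamParams hamParams where
  toFun M := hamDerivation (hamAct M)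
  map_add' M N := by
    -- This law and the two below are checked after applying the injective map `matchEquiv`, where
    -- they are the laws of `scriRep`.
    refine LieDerivation.ext fun p => matchEquiv.injective ?_
    have h : scriRep (M + N) (matchEquiv p) = _ :=
      congrArg (fun D : LieDerivation ℝ scriParams scriParams => D (matchEquiv p))
        (scriRep.map_add M N)
    change matchEquiv (hamAct (M + N) p) = matchEquiv (hamAct M p + hamAct N p)
    rw [map_add, matchEquiv_hamAct, matchEquiv_hamAct, matchEquiv_hamAct]
    exact h
  map_smul' r M := by
    refine LieDerivation.ext fun p => matchEquiv.injective ?_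
    have h : scriRep (r • M) (matchEquiv p) = _ :=
      congrArg (fun D : LieDerivation ℝ scriParams scriParams => D (matchEquiv p))
        (scriRep.map_smul r M)
    change matchEquiv (hamAct (r • M) p) = matchEquiv (r • hamAct M p)
    rw [map_smul, matchEquiv_hamAct, matchEquiv_hamAct]
    exact h
  map_lie' {M N} := by
    refine LieDerivation.ext fun p => matchEquiv.injective ?_
    have h : scriRep ⁅M, N⁆ (matchEquiv p) = _ :=
      congrArg (fun D : LieDerivation ℝ scriParams scriParams => D (matchEquiv p))
        (scriRep.map_lie M N)
    rw [LieDerivation.commutator_apply] at h ⊢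
    change matchEquiv (hamAct ⁅M, N⁆ p)
      = matchEquiv (hamAct M (hamAct N p) - hamAct N (hamAct M p))
    rw [map_sub, matchEquiv_hamAct, matchEquiv_hamAct, matchEquiv_hamAct, matchEquiv_hamAct,
      matchEquiv_hamAct]
    exact h

/-- The isomorphism of the semidirect sums. -/
def matchSemiDirect : LieAlgebra.SemiDirectSum hamParams so31 hamRep ≃ₗ⁅ℝ⁆
    LieAlgebra.SemiDirectSum scriParams so31 scriRep where
  toFun z := ⟨matchEquiv z.left, z.right⟩
  invFun z := ⟨matchEquiv.symm z.left, z.right⟩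
  left_inv z := by simp
  right_inv z := by simp
  map_add' z w := by simp
  map_smul' r z := by simp
  map_lie' {z w} := by
    have e : ∀ (M : so31) (p : hamParams), matchEquiv (hamRep M p) = scriRep M (matchEquiv p) :=
      matchEquiv_hamAct
    simp only [LieAlgebra.SemiDirectSum.lie_eq_mk, map_add, map_sub, e]
    -- Equivariance has matched the mixed terms; the brackets within the abelian summands are zero
    -- on both sides.
    congr 3
    exact map_zero matchEquiv

theorem mem_antipodalDiagonal_iff (q : scriParams × scriParams) : q ∈ antipodalDiagonal ↔
    ∃ lam, IsEvenSolution lam ∧ FutureLimit lam q.1.1 ∧ PastLimit lam q.2.1 := by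
  constructor
  · intro h
    obtain ⟨lam, hl, hf, -⟩ := exists_of_scriParams q.1.2
    refine ⟨lam, hl, hf, ?_⟩
    have h' : q.2.1 = fun x => q.1.1 (-x) := funext h
    rw [h']
    exact hl.pastLimit hf
  · rintro ⟨lam, hl, hf, hp⟩ x
    exact congrFun (hp.unique (hl.pastLimit hf)) x

end LargeU1

end

/-! ### The theorem, assembled from the preceding parts. -/

open LargeU1 in
theorem mainTheorem3 :
    -- the wave operator of the hyperboloid in coordinates
    (∀ lam : ℝ → S2 → ℝ, SmoothHyp lam → ∀ s ∈ Ioo (-1 : ℝ) 1, ∀ x,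
      hypBox lam s x = -(1 - s ^ 2) ^ 2 * deriv (deriv (fun σ => lam σ x)) s
        + (1 - s ^ 2) * sphereLaplacian (lam s) x) ∧
    -- the functions `α_l`: boundary behaviour, first examples
    (∀ l : ℕ,
      (legendreP l).eval 1 = 1 ∧ (legendreP l).eval (-1) = (-1) ^ l ∧
      Tendsto (alpha l) (𝓝[<] 1) (𝓝 1) ∧
      Tendsto (alpha l) (𝓝[>] (-1)) (𝓝 ((-1) ^ l)) ∧
      Tendsto (fun s => (1 - s ^ 2) * deriv (alpha l) s) (𝓝[<] 1) (𝓝 0) ∧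
      Tendsto (fun s => (1 - s ^ 2) * deriv (alpha l) s) (𝓝[>] (-1)) (𝓝 0)) ∧
    (∀ s ∈ Ioo (-1 : ℝ) 1,
      alpha 0 s = 1 ∧
      alpha 1 s = s + (1 - s ^ 2) / 2 * Real.log ((1 + s) / (1 - s)) ∧
      alpha 2 s = 3 * s ^ 2 - 2 + 3 * s * (1 - s ^ 2) / 2 * Real.log ((1 + s) / (1 - s))) ∧
    (∀ k : ℕ, alpha (2 * k) 0 ≠ 0 ∧ deriv (alpha (2 * k + 1)) 0 ≠ 0) ∧
    -- smooth functions on the sphere have unique harmonic coefficients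
    (∀ f : S2 → ℝ, SmoothS2 f ↔ ∃! c, HasHarmonicExpansion f c) ∧
    -- the even solutions are exactly the mode expansions in `α_l Y_{l,m}`
    (∀ lam : ℝ → S2 → ℝ, IsEvenSolution lam ↔ ∃! c, HasModeExpansion lam c) ∧
    -- limits at `s = ± 1`, Cauchy data at `s = 0`, and their harmonic coefficients
    (∀ (lam : ℝ → S2 → ℝ) (c : HarmonicIndex → ℝ),
      IsEvenSolution lam → HasModeExpansion lam c →
      (∃ f ∈ scriParams, HasHarmonicExpansion f c ∧
        FutureLimit lam f ∧ PastLimit lam (fun x => f (-x)) ∧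
        -- bulk parameters `Lam η s x = lam s x + O(ρ⁻¹)` in the coordinate `ρ = η √(1 - s²)`
        ∀ (Lam : ℝ → ℝ → S2 → ℝ) (C ρ₀ : ℝ), 0 < ρ₀ →
          (∀ ρ ≥ ρ₀, ∀ s ∈ Ioo (-1 : ℝ) 1, ∀ x,
            |Lam (ρ / Real.sqrt (1 - s ^ 2)) s x - lam s x| ≤ C / ρ) →
          ∀ ρ ≥ ρ₀, ∀ (x : S2) (L : ℝ),
            (Tendsto (fun s => Lam (ρ / Real.sqrt (1 - s ^ 2)) s x) (𝓝[<] 1) (𝓝 L) →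
              |L - f x| ≤ C / ρ) ∧
            (Tendsto (fun s => Lam (ρ / Real.sqrt (1 - s ^ 2)) s x) (𝓝[>] (-1)) (𝓝 L) →
              |L - f (-x)| ≤ C / ρ)) ∧
      (∃ p ∈ hamParams, CauchyData lam p ∧
        ∃ e u : HarmonicIndex → ℝ, HasHarmonicExpansion p.1 e ∧ HasHarmonicExpansion p.2 u ∧
          (∀ k m, e ⟨2 * k + 1, m⟩ = 0) ∧ (∀ k m, u ⟨2 * k, m⟩ = 0) ∧
          (∀ k m, c ⟨2 * k + 1, m⟩ * deriv (alpha (2 * k + 1)) 0 = u ⟨2 * k + 1, m⟩) ∧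
          (∀ k m, c ⟨2 * k, m⟩ * alpha (2 * k) 0 = e ⟨2 * k, m⟩) ∧
          (∀ m, c ⟨0, m⟩ = e ⟨0, m⟩) ∧
          (∀ m, c ⟨1, m⟩ = 1 / 2 * u ⟨1, m⟩) ∧
          (∀ m, c ⟨2, m⟩ = -(1 / 2) * e ⟨2, m⟩))) ∧
    -- each of the two parametrizations determines the even solution, and is unconstrained
    (∀ f ∈ scriParams, ∃ lam, IsEvenSolution lam ∧ FutureLimit lam f ∧
      ∀ lam', IsEvenSolution lam' → FutureLimit lam' f →
        ∀ s ∈ Ioo (-1 : ℝ) 1, ∀ x, lam' s x = lam s x) ∧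
    (∀ p ∈ hamParams, ∃ lam, IsEvenSolution lam ∧ CauchyData lam p ∧
      ∀ lam', IsEvenSolution lam' → CauchyData lam' p →
        ∀ s ∈ Ioo (-1 : ℝ) 1, ∀ x, lam' s x = lam s x) ∧
    -- the Lorentz vector fields of the hyperboloid are induced by the linear action of the
    -- Lorentz algebra on Minkowski space, whose spacelike points are `(t, y) = (r s, r x)`
    (∀ (M : so31) (lam : ℝ → S2 → ℝ), SmoothHyp lam →
      ∀ s ∈ Ioo (-1 : ℝ) 1, ∀ (x : S2) (r : ℝ), 0 < r →
        HasDerivAt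
          (fun τ : ℝ =>
            (fun q : ℝ × E3 => radialExt (lam (q.1 / ‖q.2‖)) q.2)
              ((r * s, r • (x : E3)) + τ • linearField M (r * s, r • (x : E3))))
          (hypLie (boostPart M) (rotPart M) lam s x) 0) ∧
    -- the Lorentz action on even solutions, in both parametrizations
    (∀ (M : so31) (lam : ℝ → S2 → ℝ), IsEvenSolution lam →
      IsEvenSolution (hypLie (boostPart M) (rotPart M) lam) ∧
      (∀ f, FutureLimit lam f →
        FutureLimit (hypLie (boostPart M) (rotPart M) lam)
          (deltaScri (boostPart M) (rotPart M) f) ∧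
        PastLimit (hypLie (boostPart M) (rotPart M) lam)
          (fun x => deltaScri (boostPart M) (rotPart M) f (-x))) ∧
      (∀ p, CauchyData lam p →
        CauchyData (hypLie (boostPart M) (rotPart M) lam)
          (deltaHam (boostPart M) (rotPart M) p))) ∧
    -- equality of the two symmetry algebras
    (∃ (ψH : so31 →ₗ⁅ℝ⁆ LieDerivation ℝ hamParams hamParams)
       (ψJ : so31 →ₗ⁅ℝ⁆ LieDerivation ℝ scriParams scriParams)
       (Φ : hamParams ≃ₗ[ℝ] scriParams)
       (Ψ : LieAlgebra.SemiDirectSum hamParams so31 ψH ≃ₗ⁅ℝ⁆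
            LieAlgebra.SemiDirectSum scriParams so31 ψJ),
      -- `M ↦ M p` reverses brackets of vector fields, whence the signs
      (∀ M p, (ψH M p).1 = -deltaHam (boostPart M) (rotPart M) p.1) ∧
      (∀ M f, (ψJ M f).1 = -deltaScri (boostPart M) (rotPart M) f.1) ∧
      (∀ (p : hamParams) (f : scriParams), Φ p = f ↔
        ∃ lam, IsEvenSolution lam ∧ CauchyData lam p.1 ∧ FutureLimit lam f.1) ∧
      (∀ M p, Φ (ψH M p) = ψJ M (Φ p)) ∧
      (∀ p M, Ψ ⟨p, M⟩ = ⟨Φ p, M⟩)) ∧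
    -- the symmetries at spatial infinity form the diagonal subgroup of those at null infinity
    (∀ q : scriParams × scriParams, q ∈ antipodalDiagonal ↔
      ∃ lam, IsEvenSolution lam ∧ FutureLimit lam q.1.1 ∧ PastLimit lam q.2.1) := by
  refine ⟨fun lam h s hs x => ?_, fun l => ?_,
    fun s hs => ⟨alpha_zero hs, alpha_one hs, alpha_two hs⟩,
    fun k => ⟨alpha_even_zero_ne k, deriv_alpha_odd_zero_ne k⟩, smoothS2_iff_existsUnique,
    isEvenSolution_iff_existsUnique,
    fun lam c h hc => ⟨limit_part h hc, cauchy_part h hc⟩,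
    fun f hf => exists_of_scriParams hf, fun p hp => exists_of_hamParams hp,
    fun M lam h s hs x r hr => hasDerivAt_linearField h M hs x hr,
    fun M lam h => ⟨h.hypLie M,
      fun f hf => ⟨h.futureLimit_hypLie M hf,
        (h.hypLie M).pastLimit (h.futureLimit_hypLie M hf)⟩,
      fun p hp => h.cauchyData_hypLie M hp⟩,
    ⟨hamRep, scriRep, matchEquiv, matchSemiDirect, hamAct_coe, fun M f => rfl,
      fun p f => matchEquiv_eq_iff, matchEquiv_hamAct, fun p M => rfl⟩,
    mem_antipodalDiagonal_iff⟩
  · rw [hypBox_eq h hs, sphereLaplacian_eq (h.slice hs)]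
    rfl
  · exact ⟨legendreP_eval_one l, legendreP_eval_neg_one l, (alpha_boundary l).1,
      (alpha_boundary l).2, (deriv_alpha_boundary l).1, (deriv_alpha_boundary l).2⟩
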